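/- Fix integers $k\ge 1$, $p,q\ge 0$ and a lag $i\ge 1$, real $k\times k$ matrices $A_1,\dots,A_p,B_1,\dots,B_q$, a symmetric positive definite $k\times k$ matrix $\Sigma$, and a measurable $f:]0,\infty[\to[0,\infty[$ with $f>0$ a.e. and $\mu_{k-1;f}:=\int_0^\infty r^{k-1}f(r)\,dr<\infty$. For each $n$, let $X_t=X_t^{(n)}$ and $\varepsilon_t=\varepsilon_t^{(n)}$ satisfy $X_t-\sum_{j=1}^pA_jX_{t-j}=\varepsilon_t+\sum_{j=1}^qB_j\varepsilon_{t-j}$ almost surely for $t=1,\dots,n$, where $\varepsilon_1,\dots,\varepsilon_n$ are i.i.d. with density $z\mapsto(\omega_k\mu_{k-1;f})^{-1}(\det\Sigma)^{-1/2}f(\|z\|_\Sigma)$. Here $\|z\|_\Sigma:=(z'\Sigma^{-1}z)^{1/2}$ and $\omega_k$ is the surface measure of the unit sphere of $\mathbb R^k$. Let $Z_1,\dots,Z_n$ be the residuals computed from $X_1,\dots,X_n$ and the actual initial values $X_{-p+1},\dots,X_0$, $\varepsilon_{-q+1},\dots,\varepsilon_0$. That is, with $B_0:=I_k$ and with the matrices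 $H_u$ defined by $\sum_{j=0}^{\min(q,u)}B_jH_{u-j}=\delta_{u0}I_k$ $(u\ge0)$, $$Z_t=\sum_{l=0}^{t-1}H_l\Big(X_{t-l}-\sum_{j=1}^pA_jX_{t-l-j}\Big)+\sum_{a=0}^{q-1}H_{t+q-1-a}\sum_{b=0}^{a}B_{a-b}\,\varepsilon_{-q+1+b}.$$ Let $\Sigma^{-1/2}$ be the upper triangular matrix with positive diagonal such that $(\Sigma^{-1/2})'\Sigma^{-1/2}=\Sigma^{-1}$, and put $d_t:=\|Z_t\|_\Sigma$, $U_t:=\Sigma^{-1/2}Z_t/\|\Sigma^{-1/2}Z_t\|$ and $\tilde F_k(r):=\mu_{k-1;f}^{-1}\int_0^r s^{k-1}f(s)\,ds$. Let $C=C^{(n)}$ be an upper triangular matrix with positive diagonal and upper left entry $1$ such that $$\frac1n\sum_{t=1}^n\frac{CZ_t}{\|CZ_t\|}\frac{(CZ_t)'}{\|CZ_t\|}=\frac1kI_k$$ (any such matrix if there are several, and $C:=I_k$ if there is none). Let $\widehat\Sigma:=(C'C)^{-1}$ be Tyler's scatter estimator, $W_t:=CZ_t/\|CZ_t\|$ the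 Tyler residuals, and $\hat R_t$ the rank of the pseudo-Mahalanobis distance $\|Z_t\|_{\widehat\Sigma}$ among $\|Z_1\|_{\widehat\Sigma},\dots,\|Z_n\|_{\widehat\Sigma}$. Let $K_1,K_2:]0,1[\to\mathbb R$ be continuous, each of them the difference of two nondecreasing functions that are square-integrable on $]0,1[$. Put $$\tilde\Gamma^{(n)}_{i;K}:=C'\Big(\frac1{n-i}\sum_{t=i+1}^nK_1\Big(\frac{\hat R_t}{n+1}\Big)K_2\Big(\frac{\hat R_{t-i}}{n+1}\Big)W_tW_{t-i}'\Big)(C')^{-1},$$ $$\Gamma^{(n)}_{i;K;\Sigma,f}:=(\Sigma^{-1/2})'\Big(\frac1{n-i}\sum_{t=i+1}^nK_1(\tilde F_k(d_t))K_2(\tilde F_k(d_{t-i}))U_tU_{t-i}'\Big)\big((\Sigma^{-1/2})'\big)^{-1}.$$ Then $\operatorname{vec}\big(\tilde\Gamma^{(n)}_{i;K}-\Gamma^{(n)}_{i;K;\Sigma,f}\big)=o_P(n^{-1/2})$ as $n\to\infty$. -/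

import Mathlib

open MeasureTheory ProbabilityTheory Filter Set
open scoped Topology Matrix

noncomputable section

namespace RankCrossCov

/-! ### Inverse square roots and elliptic noise -/

/-- Upper triangular with positive diagonal entries. -/
def IsUpperPos {k : ℕ} (S : Matrix (Fin k) (Fin k) ℝ) : Prop :=
  (∀ a b, b < a → S a b = 0) ∧ ∀ a, 0 < S a a

theorem IsUpperPos.bt {k : ℕ} {S : Matrix (Fin k) (Fin k) ℝ} (h : IsUpperPos S) :
    S.BlockTriangular id := fun a b hab => h.1 a b hab

theorem IsUpperPos.det_pos {k : ℕ} {S : Matrix (Fin k) (Fin k) ℝ} (h : IsUpperPos S) :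
    0 < S.det := by
  rw [Matrix.det_of_isUpperTriangular h.bt]
  exact Finset.prod_pos fun a _ => h.2 a

theorem upperPos_unique {k : ℕ} {S T : Matrix (Fin k) (Fin k) ℝ}
    (hS : IsUpperPos S) (hT : IsUpperPos T) (h : Sᵀ * S = Tᵀ * T) : S = T := by
  have hSu : IsUnit S.det := hS.det_pos.ne'.isUnit
  have hTu : IsUnit T.det := hT.det_pos.ne'.isUnit
  let := S.invertibleOfIsUnitDet hSu
  let := T.invertibleOfIsUnitDet hTu
  -- `M = T S⁻¹ = (S T⁻¹)'` is both upper and lower triangular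
  have e1 : T * S⁻¹ = (S * T⁻¹)ᵀ := by
    have h2 : Tᵀ * (T * S⁻¹) = Sᵀ := by
      rw [← Matrix.mul_assoc, ← h, Matrix.mul_assoc, Matrix.mul_nonsing_inv _ hSu, Matrix.mul_one]
    rw [Matrix.transpose_mul, Matrix.transpose_nonsing_inv, ← h2, ← Matrix.mul_assoc,
      Matrix.nonsing_inv_mul _ (by simpa using hTu), Matrix.one_mul]
  have b1 : (T * S⁻¹).BlockTriangular id :=
    hT.bt.mul (Matrix.blockTriangular_inv_of_blockTriangular hS.bt)
  have b2 : (S * T⁻¹).BlockTriangular id :=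
    hS.bt.mul (Matrix.blockTriangular_inv_of_blockTriangular hT.bt)
  set M := T * S⁻¹ with hM
  have hMS : M * S = T := by
    rw [hM, Matrix.mul_assoc, Matrix.nonsing_inv_mul _ hSu, Matrix.mul_one]
  have hdiag : ∀ a b, a ≠ b → M a b = 0 := by
    intro a b hab
    rcases lt_or_gt_of_ne hab with hlt | hgt
    · rw [e1]; exact b2 hlt
    · exact b1 hgt
  have hMd : M = Matrix.diagonal fun a => M a a := by
    ext a b
    by_cases hab : a = b
    · subst hab; simp
    · simp [hab, hdiag a b hab]
  have hpos : ∀ a, 0 < M a a := by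
    intro a
    have h3 : M a a * S a a = T a a := by
      have := congrFun (congrFun hMS a) a
      rw [hMd, Matrix.diagonal_mul] at this
      exact this
    exact pos_of_mul_pos_left (h3 ▸ hT.2 a) (hS.2 a).le
  have hsq : Mᵀ * M = 1 := by
    have h4 : S * T⁻¹ * M = 1 := by
      rw [hM, Matrix.mul_assoc, ← Matrix.mul_assoc T⁻¹, Matrix.nonsing_inv_mul _ hTu,
        Matrix.one_mul, Matrix.mul_nonsing_inv _ hSu]
    rw [← h4]
    congr 1
    rw [e1, Matrix.transpose_transpose]
  have hone : M = 1 := by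
    rw [hMd, ← Matrix.diagonal_one]
    congr 1
    funext a
    have h5 := congrFun (congrFun hsq a) a
    rw [hMd, Matrix.diagonal_transpose, Matrix.diagonal_mul_diagonal, Matrix.diagonal_apply_eq,
      Matrix.one_apply_eq] at h5
    nlinarith [hpos a]
  rw [← hMS, hone, Matrix.one_mul]

theorem exists_upperPos {k : ℕ} {Q : Matrix (Fin k) (Fin k) ℝ} (hQ : Q.PosDef) :
    ∃ S, IsUpperPos S ∧ Sᵀ * S = Q := by
  have hlow : (LDL.lowerInv hQ)ᵀ.BlockTriangular id :=
    fun a b hab => LDL.lowerInv_triangular hQ hab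
  have hU : ((LDL.lowerInv hQ)ᵀ)⁻¹.BlockTriangular id :=
    Matrix.blockTriangular_inv_of_blockTriangular hlow
  set U := ((LDL.lowerInv hQ)ᵀ)⁻¹ with hUdef
  have hUL : Uᵀ = LDL.lower hQ := by
    rw [hUdef, LDL.lower, Matrix.transpose_nonsing_inv, Matrix.transpose_transpose]
  have hdec : Uᵀ * LDL.diag hQ * U = Q := by
    have := LDL.lower_conj_diag hQ
    rwa [← hUL, Matrix.conjTranspose_eq_transpose_of_trivial, Matrix.transpose_transpose] at this
  have hdet : U.det ≠ 0 := by
    intro h0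
    have := hQ.det_pos
    rw [← hdec, Matrix.det_mul, h0, mul_zero] at this
    exact lt_irrefl _ this
  have hUd : ∀ a, U a a ≠ 0 := by
    rw [Matrix.det_of_isUpperTriangular hU] at hdet
    exact fun a => Finset.prod_ne_zero_iff.1 hdet a (Finset.mem_univ a)
  have hd : ∀ a, 0 < LDL.diagEntries hQ a := by
    have hpd : (LDL.diag hQ).PosDef := by
      rw [LDL.diag_eq_lowerInv_conj]
      exact hQ.mul_mul_conjTranspose_same
        (Matrix.vecMul_injective_of_invertible (LDL.lowerInv hQ))
    exact Matrix.posDef_diagonal_iff.1 hpd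
  refine ⟨Matrix.diagonal (fun a => √(LDL.diagEntries hQ a) * SignType.sign (U a a)) * U,
    ⟨fun a b hab => ?_, fun a => ?_⟩, ?_⟩
  · rw [Matrix.diagonal_mul, hU hab, mul_zero]
  · rw [Matrix.diagonal_mul, mul_assoc, sign_mul_self]
    exact mul_pos (Real.sqrt_pos.2 (hd a)) (abs_pos.2 (hUd a))
  · rw [Matrix.transpose_mul, Matrix.diagonal_transpose, Matrix.mul_assoc,
      ← Matrix.mul_assoc (Matrix.diagonal _), Matrix.diagonal_mul_diagonal, ← Matrix.mul_assoc]
    have : (Matrix.diagonal fun a => √(LDL.diagEntries hQ a) * (SignType.sign (U a a) : ℝ) *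
        (√(LDL.diagEntries hQ a) * (SignType.sign (U a a) : ℝ))) = LDL.diag hQ := by
      rw [LDL.diag]
      congr 1
      funext a
      have h1 : (SignType.sign (U a a) : ℝ) * (SignType.sign (U a a) : ℝ) = 1 := by
        rcases lt_or_gt_of_ne (hUd a) with h | h <;> simp [h]
      rw [mul_mul_mul_comm, h1, mul_one, Real.mul_self_sqrt (hd a).le]
    rw [this, hdec]

/-- The unique upper triangular matrix `S` with positive diagonal and `Sᵀ * S = Σ⁻¹`. -/
def invSqrt {k : ℕ} (Sig : Matrix (Fin k) (Fin k) ℝ) : Matrix (Fin k) (Fin k) ℝ :=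
  Classical.epsilon fun S => IsUpperPos S ∧ Sᵀ * S = Sig⁻¹

theorem invSqrt_eq_iff {k : ℕ} {Sig : Matrix (Fin k) (Fin k) ℝ} (hSig : Sig.PosDef)
    (S : Matrix (Fin k) (Fin k) ℝ) :
    S = invSqrt Sig ↔ IsUpperPos S ∧ Sᵀ * S = Sig⁻¹ := by
  have h0 : IsUpperPos (invSqrt Sig) ∧ (invSqrt Sig)ᵀ * invSqrt Sig = Sig⁻¹ :=
    Classical.epsilon_spec (exists_upperPos hSig.inv)
  exact ⟨fun h => h ▸ h0, fun h => upperPos_unique h.1 h0.1 (h.2.trans h0.2.symm)⟩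

/-- `‖z‖_Σ = (z' Σ⁻¹ z)^{1/2}`. -/
def scatterNorm {k : ℕ} (Sig : Matrix (Fin k) (Fin k) ℝ) (z : EuclideanSpace ℝ (Fin k)) : ℝ :=
  √(z.ofLp ⬝ᵥ (Sig⁻¹ *ᵥ z.ofLp))

/-- `μ_{l;f} = ∫₀^∞ r^l f(r) dr`. -/
def radialMoment (l : ℕ) (f : ℝ → ℝ) : ℝ := ∫ r in Ioi (0 : ℝ), r ^ l * f r

/-- `f` (only its values on `]0, ∞[` matter) is nonnegative, a.e. positive, and
`∫₀^∞ r^{k-1} f(r) dr < ∞`. -/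
structure IsRadialDensity (k : ℕ) (f : ℝ → ℝ) : Prop where
  measurable : Measurable f
  nonneg : ∀ r, 0 < r → 0 ≤ f r
  pos_ae : ∀ᵐ r ∂(volume.restrict (Ioi (0 : ℝ))), 0 < f r
  integrable : IntegrableOn (fun r => r ^ (k - 1) * f r) (Ioi 0)

/-- `ω_k`, the surface measure of the unit sphere of `ℝ^k`. -/
def sphereArea (k : ℕ) : ℝ :=
  (volume : Measure (EuclideanSpace ℝ (Fin k))).toSphere.real univ

/-- The elliptic density `c_{k,f} (det Σ)^{-1/2} f(‖z‖_Σ)`, `c_{k,f} = (ω_k μ_{k-1;f})⁻¹`. -/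
def ellipticDensity {k : ℕ} (Sig : Matrix (Fin k) (Fin k) ℝ) (f : ℝ → ℝ)
    (z : EuclideanSpace ℝ (Fin k)) : ℝ :=
  (sphereArea k * radialMoment (k - 1) f)⁻¹ * (√Sig.det)⁻¹ * f (scatterNorm Sig z)

/-- The distribution on `ℝ^k` with density `ellipticDensity Sig f`. -/
def ellipticLaw {k : ℕ} (Sig : Matrix (Fin k) (Fin k) ℝ) (f : ℝ → ℝ) :
    Measure (EuclideanSpace ℝ (Fin k)) :=
  volume.withDensity fun z => ENNReal.ofReal (ellipticDensity Sig f z)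

/-- The probability density `f̃_k(r) = (μ_{k-1;f})⁻¹ r^{k-1} f(r) I[r > 0]`. -/
def radialPdf (k : ℕ) (f : ℝ → ℝ) (r : ℝ) : ℝ :=
  if 0 < r then (radialMoment (k - 1) f)⁻¹ * (r ^ (k - 1) * f r) else 0

/-- The distribution function `F̃_k` of `f̃_k`. -/
def radialCdf (k : ℕ) (f : ℝ → ℝ) (r : ℝ) : ℝ := ∫ s in Iic r, radialPdf k f s

/-! ### The VARMA model and its residuals

Coefficient matrices `A₁, …, A_p`, `B₁, …, B_q` are given by functions on `ℕ`, of which only the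
values at `1, …, p`, resp. `1, …, q`, are used. -/

/-- The coefficient of `L^j` in `A(L) = I - ∑_{j=1}^p A_j L^j`, for `j ≤ p`. -/
def arCoeff {k : ℕ} (A : ℕ → Matrix (Fin k) (Fin k) ℝ) (j : ℕ) : Matrix (Fin k) (Fin k) ℝ :=
  if j = 0 then 1 else -A j

/-- The coefficient of `L^j` in `B(L) = I + ∑_{j=1}^q B_j L^j`, for `j ≤ q`. -/
def maCoeff {k : ℕ} (B : ℕ → Matrix (Fin k) (Fin k) ℝ) (j : ℕ) : Matrix (Fin k) (Fin k) ℝ :=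
  if j = 0 then 1 else B j

/-- The Green's matrices `H_u` of `B(L)`: `∑_{j=0}^{min(q,u)} B_j H_{u-j} = δ_{u0} I` (`B₀ = I`). -/
def green {k : ℕ} (q : ℕ) (B : ℕ → Matrix (Fin k) (Fin k) ℝ) : ℕ → Matrix (Fin k) (Fin k) ℝ
  | 0 => 1
  | u + 1 => -∑ j : Fin (min q (u + 1)), B (j + 1) * green q B (u - j)

/-- The residual `Z_t`, `t ≥ 1`, computed from the observed series `x_1, …, x_t` and from the
initial values `x_{-p+1}, …, x_0` and `e_{-q+1}, …, e_0`:
`Z_t = ∑_{i=0}^{t-1} H_i (A(L) x)_{t-i}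
  + ∑_{a=0}^{q-1} H_{t+q-1-a} ∑_{b=0}^{a} B_{a-b} e_{-q+1+b}`. -/
def residual {k : ℕ} (p q : ℕ) (A B : ℕ → Matrix (Fin k) (Fin k) ℝ)
    (x e : ℤ → EuclideanSpace ℝ (Fin k)) (t : ℕ) : EuclideanSpace ℝ (Fin k) :=
  (∑ i ∈ Finset.range t, ∑ j ∈ Finset.range (p + 1),
      Matrix.toEuclideanLin (green q B i * arCoeff A j) (x ((t : ℤ) - i - j)))
    + ∑ a ∈ Finset.range q, ∑ b ∈ Finset.range (a + 1),
      Matrix.toEuclideanLin (green q B (t + q - 1 - a) * maCoeff B (a - b))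
        (e (-(q : ℤ) + 1 + b))

/-- The hypothesis `H^(n)(θ₀, Σ, f)`: the observed series `X_1, …, X_n` is generated by the
VARMA(p, q) equation `A(L) X_t = B(L) ε_t`, where `(ε_1, …, ε_n)` has the joint density
`∏ₜ ellipticDensity Sig f (z_t)`. Nothing is required of the initial values. -/
structure VARMAHypothesis {k : ℕ} (p q : ℕ) (A B : ℕ → Matrix (Fin k) (Fin k) ℝ)
    (Sig : Matrix (Fin k) (Fin k) ℝ) (f : ℝ → ℝ) (n : ℕ) {Ω : Type*} [MeasurableSpace Ω]
    (P : Measure Ω) (X ε : ℤ → Ω → EuclideanSpace ℝ (Fin k)) : Prop where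
  noise : HasLaw (fun ω (t : Fin n) => ε ((t : ℤ) + 1) ω)
    (Measure.pi fun _ : Fin n => ellipticLaw Sig f) P
  equation : ∀ᵐ ω ∂P, ∀ t : ℤ, 1 ≤ t → t ≤ n →
    ∑ j ∈ Finset.range (p + 1), Matrix.toEuclideanLin (arCoeff A j) (X (t - j) ω)
      = ∑ j ∈ Finset.range (q + 1), Matrix.toEuclideanLin (maCoeff B j) (ε (t - j) ω)

/-! ### Tyler's estimator, ranks and signs of a sample `z 1, …, z n` -/

/-- `M z / ‖M z‖`. -/
def direction {k : ℕ} (M : Matrix (Fin k) (Fin k) ℝ) (z : EuclideanSpace ℝ (Fin k)) :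
    EuclideanSpace ℝ (Fin k) :=
  ‖Matrix.toEuclideanLin M z‖⁻¹ • Matrix.toEuclideanLin M z

/-- The rank-one matrix `u v'`. -/
def outer {k : ℕ} (u v : EuclideanSpace ℝ (Fin k)) : Matrix (Fin k) (Fin k) ℝ :=
  Matrix.vecMulVec u.ofLp v.ofLp

/-- `C` is upper triangular with positive diagonal and a `1` in the upper left corner, and
`n⁻¹ ∑ₜ (C z_t / ‖C z_t‖) (C z_t / ‖C z_t‖)' = k⁻¹ I`. -/
def IsTylerRoot {k : ℕ} (n : ℕ) (z : ℕ → EuclideanSpace ℝ (Fin k))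
    (C : Matrix (Fin k) (Fin k) ℝ) : Prop :=
  IsUpperPos C ∧ (∀ a : Fin k, (a : ℕ) = 0 → C a a = 1) ∧
    (n : ℝ)⁻¹ • ∑ t ∈ Finset.Icc 1 n, outer (direction C (z t)) (direction C (z t))
      = (k : ℝ)⁻¹ • (1 : Matrix (Fin k) (Fin k) ℝ)

open Classical in
/-- The matrix `C_Tyl` (the identity matrix for those samples for which there is none). -/
def tylerRoot {k : ℕ} (n : ℕ) (z : ℕ → EuclideanSpace ℝ (Fin k)) : Matrix (Fin k) (Fin k) ℝ :=
  if h : ∃ C, IsTylerRoot n z C then h.choose else 1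

/-- Tyler's estimator of scatter `(C_Tyl' C_Tyl)⁻¹`. -/
def tylerScatter {k : ℕ} (n : ℕ) (z : ℕ → EuclideanSpace ℝ (Fin k)) :
    Matrix (Fin k) (Fin k) ℝ :=
  ((tylerRoot n z)ᵀ * tylerRoot n z)⁻¹

/-- The pseudo-Mahalanobis rank of `z t`: the rank of `‖z t‖_Σ̂` among
`‖z 1‖_Σ̂, …, ‖z n‖_Σ̂`, where `Σ̂` is Tyler's estimator. -/
def pmRank {k : ℕ} (n : ℕ) (z : ℕ → EuclideanSpace ℝ (Fin k)) (t : ℕ) : ℕ :=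
  ((Finset.Icc 1 n).filter fun s =>
    scatterNorm (tylerScatter n z) (z s) ≤ scatterNorm (tylerScatter n z) (z t)).card

/-- The Tyler residual `W_t = C_Tyl z_t / ‖C_Tyl z_t‖`. -/
def tylerResidual {k : ℕ} (n : ℕ) (z : ℕ → EuclideanSpace ℝ (Fin k)) (t : ℕ) :
    EuclideanSpace ℝ (Fin k) :=
  direction (tylerRoot n z) (z t)

/-! ### Scores and cross-covariance matrices -/

/-- A score function on `]0, 1[`: continuous, and a difference of two nondecreasing functions that
are square-integrable on `]0, 1[`. -/
structure IsScore (K : ℝ → ℝ) : Prop where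
  continuousOn : ContinuousOn K (Ioo 0 1)
  exists_sub : ∃ g h : ℝ → ℝ, MonotoneOn g (Ioo 0 1) ∧ MonotoneOn h (Ioo 0 1) ∧
    IntegrableOn (fun u => g u ^ 2) (Ioo 0 1) ∧ IntegrableOn (fun u => h u ^ 2) (Ioo 0 1) ∧
    ∀ u ∈ Ioo (0 : ℝ) 1, K u = g u - h u

/-- The rank-based `K`-cross-covariance matrix of lag `i` of the sample `z 1, …, z n`. -/
def rankCrossCov {k : ℕ} (K₁ K₂ : ℝ → ℝ) (i n : ℕ) (z : ℕ → EuclideanSpace ℝ (Fin k)) :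
    Matrix (Fin k) (Fin k) ℝ :=
  (tylerRoot n z)ᵀ
    * (((n : ℝ) - i)⁻¹ • ∑ t ∈ Finset.Icc (i + 1) n,
        (K₁ ((pmRank n z t : ℝ) / (n + 1)) * K₂ ((pmRank n z (t - i) : ℝ) / (n + 1)))
          • outer (tylerResidual n z t) (tylerResidual n z (t - i)))
    * ((tylerRoot n z)ᵀ)⁻¹

/-- Its counterpart based on the exact scores `K_ℓ(F̃_k(d_t))`, with `d_t = ‖z t‖_Σ`, and the exact
unit vectors `U_t = Σ^{-1/2} z_t / ‖Σ^{-1/2} z_t‖`. -/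
def exactCrossCov {k : ℕ} (K₁ K₂ : ℝ → ℝ) (Sig : Matrix (Fin k) (Fin k) ℝ) (f : ℝ → ℝ)
    (i n : ℕ) (z : ℕ → EuclideanSpace ℝ (Fin k)) : Matrix (Fin k) (Fin k) ℝ :=
  (invSqrt Sig)ᵀ
    * (((n : ℝ) - i)⁻¹ • ∑ t ∈ Finset.Icc (i + 1) n,
        (K₁ (radialCdf k f (scatterNorm Sig (z t)))
            * K₂ (radialCdf k f (scatterNorm Sig (z (t - i)))))
          • outer (direction (invSqrt Sig) (z t)) (direction (invSqrt Sig) (z (t - i))))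
    * ((invSqrt Sig)ᵀ)⁻¹

/-- `Y_n = o_P(r_n)` as `n → ∞`, where `Y_n` is defined on the probability space `(Ω_n, P_n)`. -/
def IsLittleOP {Ω : ℕ → Type*} [∀ n, MeasurableSpace (Ω n)] (P : ∀ n, Measure (Ω n))
    {E : Type*} [Norm E] (Y : ∀ n, Ω n → E) (r : ℕ → ℝ) : Prop :=
  ∀ δ : ℝ, 0 < δ → Tendsto (fun n => P n {ω | δ * r n < ‖Y n ω‖}) atTop (𝓝 0)

end RankCrossCov

end

noncomputable section

namespace RankCrossCov

open scoped RealInnerProductSpace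

/-! With the actual initial values, the residuals are almost surely the innovations, because the
Green's matrices invert the moving-average polynomial (`residual_eq`). The claim thus concerns an
i.i.d. elliptic sample `y`. Conjugating an outer product splits each matrix entry
(`transpose_conj_outer_apply`), so an entry of the difference is `(n - i)⁻¹ ∑ (α_s β_u - α⁰_s β⁰_u)`
over the pairs with `s = u + i`. Here `α`, `β` are rank scores times linear functionals of Tyler
residuals, and `α⁰`, `β⁰` are their exact counterparts.

The rate `n^(-1/2)` comes from symmetry, not from a rate of convergence of Tyler's estimator.
Tyler's equation and the ranks do not change when a single observation changes sign or when
observations are permuted, so `α` and `α⁰` are odd in their own observation and permutation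
equivariant. Oddness makes the summands of distinct lagged pairs uncorrelated. Equivariance gives
all off-diagonal pairs the same second moment, which is therefore at most about the average over all
pairs, and that average factorises. Hence the sum has second moment `O(n q)`
(`integral_sq_sum_lagPairs_le`), with `q` small as soon as the averages of `(α - α⁰)²` and `(β -
β⁰)²` are small. Truncating to an invariant event and applying Chebyshev's inequality finishes this
step (`measure_lagSum_gt_le`).

What remains is mere consistency, `n⁻¹ ∑ (α_s - α⁰_s)² → 0` in probability
(`exists_measure_avg_rankStat_sub_le`). Its ingredients are: Tyler's root exists, is unique and is,
up to a positive factor, close to `Σ^{-1/2}` whenever the second and fourth moments of the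
directions are nearly correct (`exists_tylerEq_near_one`, `TylerEq.unique`, `exists_goodSet_root`);
ranks of slightly perturbed radii are uniformly close to the probability integral transforms of the
radii (`IsRadialDensity.rank_close`); scores that are differences of monotone square-integrable
functions have uniformly small tails on the rank grid (`IsScore.avg_sq_sub_le`).

Tyler's root is an arbitrary choice, so it is replaced by a measurable, invariant map `R` which
agrees with it, up to scale, on an event of probability tending to one (`exists_isNearRoot`). The
scale cancels in the cross-covariance matrix. -/

/-! ### Matrices acting on Euclidean space, spectral decompositions -/

theorem inner_eq_dotProduct {k : ℕ} (x y : EuclideanSpace ℝ (Fin k)) :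
    ⟪x, y⟫ = x.ofLp ⬝ᵥ y.ofLp := by
  rw [EuclideanSpace.inner_eq_star_dotProduct, star_trivial, dotProduct_comm]

theorem ofLp_toEuclideanLin {k : ℕ} (M : Matrix (Fin k) (Fin k) ℝ)
    (x : EuclideanSpace ℝ (Fin k)) : (Matrix.toEuclideanLin M x).ofLp = M *ᵥ x.ofLp := rfl

theorem inner_toEuclideanLin_left {k : ℕ} (M : Matrix (Fin k) (Fin k) ℝ)
    (x y : EuclideanSpace ℝ (Fin k)) :
    ⟪Matrix.toEuclideanLin M x, y⟫ = ⟪x, Matrix.toEuclideanLin Mᵀ y⟫ := by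
  simp only [inner_eq_dotProduct, ofLp_toEuclideanLin]
  rw [Matrix.dotProduct_mulVec, Matrix.vecMul_transpose]

theorem toEuclideanLin_mul_apply {k : ℕ} (M N : Matrix (Fin k) (Fin k) ℝ)
    (x : EuclideanSpace ℝ (Fin k)) :
    Matrix.toEuclideanLin (M * N) x = Matrix.toEuclideanLin M (Matrix.toEuclideanLin N x) := by
  ext a
  simp [Matrix.mulVec_mulVec]

theorem toEuclideanLin_one_apply {k : ℕ} (x : EuclideanSpace ℝ (Fin k)) :
    Matrix.toEuclideanLin (1 : Matrix (Fin k) (Fin k) ℝ) x = x := by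
  ext a
  simp

/-- The spectral decomposition of `Tᵀ * T`. -/
theorem exists_spectral {k : ℕ} (T : Matrix (Fin k) (Fin k) ℝ) :
    ∃ (b : OrthonormalBasis (Fin k) ℝ (EuclideanSpace ℝ (Fin k))) (lam : Fin k → ℝ),
      (∀ x y, ⟪Matrix.toEuclideanLin T x, Matrix.toEuclideanLin T y⟫
        = ∑ j, lam j * (⟪b j, x⟫ * ⟪b j, y⟫)) ∧ ∏ j, lam j = T.det ^ 2 := by
  have hG : (Tᵀ * T).IsHermitian := by
    simpa using Matrix.isHermitian_conjTranspose_mul_self T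
  refine ⟨hG.eigenvectorBasis, hG.eigenvalues, fun x y => ?_, ?_⟩
  · rw [real_inner_comm, inner_toEuclideanLin_left, ← toEuclideanLin_mul_apply, real_inner_comm,
      inner_toEuclideanLin_left, ← hG.eigenvectorBasis.sum_inner_mul_inner]
    refine Finset.sum_congr rfl fun j _ => ?_
    have h1 : Matrix.toEuclideanLin (Tᵀ * T) (hG.eigenvectorBasis j)
        = hG.eigenvalues j • hG.eigenvectorBasis j := by
      ext a
      have := congrFun (hG.mulVec_eigenvectorBasis j) a
      simpa [ofLp_toEuclideanLin] using this
    rw [← inner_toEuclideanLin_left, h1, inner_smul_left,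
      real_inner_comm (hG.eigenvectorBasis j) x]
    simp; ring
  · have := hG.det_eq_prod_eigenvalues
    simp only [Matrix.det_mul, Matrix.det_transpose, RCLike.ofReal_real_eq_id, id] at this
    rw [← this, sq]

theorem spectral_eq_norm_sq {k : ℕ} {T : Matrix (Fin k) (Fin k) ℝ}
    {b : OrthonormalBasis (Fin k) ℝ (EuclideanSpace ℝ (Fin k))} {lam : Fin k → ℝ}
    (h : ∀ x y, ⟪Matrix.toEuclideanLin T x, Matrix.toEuclideanLin T y⟫
        = ∑ j, lam j * (⟪b j, x⟫ * ⟪b j, y⟫)) (j : Fin k) :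
    lam j = ‖Matrix.toEuclideanLin T (b j)‖ ^ 2 := by
  rw [← real_inner_self_eq_norm_sq, h, Finset.sum_eq_single j]
  · simp [b.orthonormal.1 j]
  · intro l _ hl
    rw [b.orthonormal.2 hl]; simp
  · simp

theorem sum_sq_inner_basis {k : ℕ}
    (b : OrthonormalBasis (Fin k) ℝ (EuclideanSpace ℝ (Fin k))) (x : EuclideanSpace ℝ (Fin k)) :
    ∑ j, ⟪b j, x⟫ ^ 2 = ‖x‖ ^ 2 := by
  rw [← real_inner_self_eq_norm_sq, ← b.sum_inner_mul_inner x x]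
  refine Finset.sum_congr rfl fun j _ => ?_
  rw [real_inner_comm x (b j), sq]

theorem spectral_norm_sq {k : ℕ} {T : Matrix (Fin k) (Fin k) ℝ}
    {b : OrthonormalBasis (Fin k) ℝ (EuclideanSpace ℝ (Fin k))} {lam : Fin k → ℝ}
    (h : ∀ x y, ⟪Matrix.toEuclideanLin T x, Matrix.toEuclideanLin T y⟫
        = ∑ j, lam j * (⟪b j, x⟫ * ⟪b j, y⟫)) (x : EuclideanSpace ℝ (Fin k)) :
    ‖Matrix.toEuclideanLin T x‖ ^ 2 = ∑ j, lam j * ⟪b j, x⟫ ^ 2 := by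
  rw [← real_inner_self_eq_norm_sq, h]
  simp [sq]

/-! ### Directions and Tyler's equation -/

theorem toEuclideanLin_ne_zero {k : ℕ} {M : Matrix (Fin k) (Fin k) ℝ} (hM : M.det ≠ 0)
    {z : EuclideanSpace ℝ (Fin k)} (hz : z ≠ 0) : Matrix.toEuclideanLin M z ≠ 0 := by
  intro h
  apply hz
  rw [← toEuclideanLin_one_apply z, ← Matrix.nonsing_inv_mul M hM.isUnit,
    toEuclideanLin_mul_apply, h, map_zero]

theorem norm_direction {k : ℕ} {M : Matrix (Fin k) (Fin k) ℝ} (hM : M.det ≠ 0)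
    {z : EuclideanSpace ℝ (Fin k)} (hz : z ≠ 0) : ‖direction M z‖ = 1 := by
  have := norm_ne_zero_iff.2 (toEuclideanLin_ne_zero hM hz)
  rw [direction, norm_smul, norm_inv, norm_norm, inv_mul_cancel₀ this]

theorem norm_direction_le {k : ℕ} (M : Matrix (Fin k) (Fin k) ℝ)
    (z : EuclideanSpace ℝ (Fin k)) : ‖direction M z‖ ≤ 1 := by
  rw [direction, norm_smul, norm_inv, norm_norm]
  exact inv_mul_le_one_of_le₀ le_rfl (norm_nonneg _)

theorem norm_inv_smul_smul {V : Type*} [NormedAddCommGroup V] [NormedSpace ℝ V]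
    {c : ℝ} (hc : 0 < c) (x : V) : ‖c • x‖⁻¹ • (c • x) = ‖x‖⁻¹ • x := by
  rw [norm_smul, smul_smul, Real.norm_of_nonneg hc.le, mul_inv, mul_right_comm,
    inv_mul_cancel₀ hc.ne', one_mul]

theorem direction_smul_right {k : ℕ} (M : Matrix (Fin k) (Fin k) ℝ) {c : ℝ} (hc : 0 < c)
    (z : EuclideanSpace ℝ (Fin k)) : direction M (c • z) = direction M z := by
  rw [direction, map_smul, norm_inv_smul_smul hc, direction]

theorem direction_smul_left {k : ℕ} (M : Matrix (Fin k) (Fin k) ℝ) {c : ℝ} (hc : 0 < c)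
    (z : EuclideanSpace ℝ (Fin k)) : direction (c • M) z = direction M z := by
  rw [direction, map_smul, LinearMap.smul_apply, norm_inv_smul_smul hc, direction]

theorem direction_neg {k : ℕ} (M : Matrix (Fin k) (Fin k) ℝ)
    (z : EuclideanSpace ℝ (Fin k)) : direction M (-z) = -direction M z := by
  rw [direction, map_neg, norm_neg, smul_neg, direction]

theorem direction_mul {k : ℕ} (M N : Matrix (Fin k) (Fin k) ℝ)
    (z : EuclideanSpace ℝ (Fin k)) : direction (M * N) z = direction M (direction N z) := by
  by_cases h : Matrix.toEuclideanLin N z = 0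
  · simp [direction, h]
  · rw [direction.eq_1 N, direction_smul_right _ (inv_pos.2 (norm_pos_iff.2 h)), direction,
      toEuclideanLin_mul_apply, direction]

/-- Tyler's equation for a finite sample. -/
def TylerEq {k : ℕ} {ι : Type*} [Fintype ι] (z : ι → EuclideanSpace ℝ (Fin k))
    (C : Matrix (Fin k) (Fin k) ℝ) : Prop :=
  (Fintype.card ι : ℝ)⁻¹ • ∑ t, outer (direction C (z t)) (direction C (z t))
    = (k : ℝ)⁻¹ • (1 : Matrix (Fin k) (Fin k) ℝ)

theorem TylerEq.quad {k : ℕ} {ι : Type*} [Fintype ι] {z : ι → EuclideanSpace ℝ (Fin k)}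
    {C : Matrix (Fin k) (Fin k) ℝ} (h : TylerEq z C) (x : EuclideanSpace ℝ (Fin k)) :
    (Fintype.card ι : ℝ)⁻¹ * ∑ t, ⟪x, direction C (z t)⟫ ^ 2 = (k : ℝ)⁻¹ * ‖x‖ ^ 2 := by
  have h1 := congrArg (fun M : Matrix (Fin k) (Fin k) ℝ => x.ofLp ⬝ᵥ (M *ᵥ x.ofLp)) h
  simp only [Matrix.smul_mulVec, dotProduct_smul, Matrix.one_mulVec, smul_eq_mul,
    Matrix.sum_mulVec, dotProduct_sum] at h1
  rw [← real_inner_self_eq_norm_sq, inner_eq_dotProduct, ← h1]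
  congr 1
  refine Finset.sum_congr rfl fun t _ => ?_
  rw [outer, Matrix.vecMulVec_mulVec, inner_eq_dotProduct, dotProduct_smul, dotProduct_comm x.ofLp,
    op_smul_eq_smul, smul_eq_mul, sq]

theorem TylerEq.smul {k : ℕ} {ι : Type*} [Fintype ι] {z : ι → EuclideanSpace ℝ (Fin k)}
    {C : Matrix (Fin k) (Fin k) ℝ} (h : TylerEq z C) {c : ℝ} (hc : 0 < c) :
    TylerEq z (c • C) := by
  simpa only [TylerEq, direction_smul_left _ hc] using h

/-- Affine equivariance: it suffices to solve Tyler's equation for the whitened unit vectors, where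
the solution is expected near the identity. -/
theorem TylerEq.mul_of_direction {k : ℕ} {ι : Type*} [Fintype ι]
    {z : ι → EuclideanSpace ℝ (Fin k)} {T S : Matrix (Fin k) (Fin k) ℝ}
    (h : TylerEq (fun t => direction S (z t)) T) : TylerEq z (T * S) := by
  simpa only [TylerEq, direction_mul] using h

/-- If no pair of hyperplanes contains the sample, the solution of Tyler's equation is unique up to
normalization. -/
theorem TylerEq.unique {k : ℕ} {ι : Type*} [Fintype ι] [Nonempty ι]
    {z : ι → EuclideanSpace ℝ (Fin k)} {C D : Matrix (Fin k) (Fin k) ℝ}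
    (hz0 : ∀ t, z t ≠ 0)
    (hz : ∀ x y : EuclideanSpace ℝ (Fin k), x ≠ 0 → y ≠ 0 → ∃ t, ⟪x, z t⟫ ≠ 0 ∧ ⟪y, z t⟫ ≠ 0)
    (hCu : IsUpperPos C) (hDu : IsUpperPos D) (hC : TylerEq z C) (hD : TylerEq z D)
    (a₀ : Fin k) (h0 : C a₀ a₀ = D a₀ a₀) : C = D := by
  have : Nonempty (Fin k) := ⟨a₀⟩
  have hk : (0 : ℝ) < k := by
    have := a₀.pos
    exact_mod_cast this
  have hCd := hCu.det_pos.ne'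
  have hDd := hDu.det_pos.ne'
  set M := D * C⁻¹ with hM
  have hMC : M * C = D := by
    rw [hM, Matrix.mul_assoc, Matrix.nonsing_inv_mul _ hCd.isUnit, Matrix.mul_one]
  have hMd : M.det ≠ 0 := by
    intro h
    rw [← hMC, Matrix.det_mul, h, zero_mul] at hDd
    exact hDd rfl
  -- `M` carries the `C`-directions `w t` to the `D`-directions. Both Tyler equations are tested at
  -- a top eigenvector `b m` of `MᵀM`. The second gives each term the extra weight `lam m / ‖M (w
  -- t)‖² ≥ 1`, yet both sums have the same value.
  obtain ⟨b, lam, hb, -⟩ := exists_spectral M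
  have hlam := spectral_eq_norm_sq hb
  have hq := spectral_norm_sq hb
  obtain ⟨m, hm⟩ := Finite.exists_max lam
  have hlm : 0 < lam m := by
    rw [hlam]
    exact pow_pos (norm_pos_iff.2 (toEuclideanLin_ne_zero hMd (b.orthonormal.ne_zero m))) 2
  set w : ι → EuclideanSpace ℝ (Fin k) := fun t => direction C (z t) with hw
  have hw1 : ∀ t, ‖w t‖ = 1 := fun t => norm_direction hCd (hz0 t)
  have hw0 : ∀ t, w t ≠ 0 := fun t h => by simpa [h] using hw1 t
  have hMw : ∀ t, 0 < ‖Matrix.toEuclideanLin M (w t)‖ := fun t =>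
    norm_pos_iff.2 (toEuclideanLin_ne_zero hMd (hw0 t))
  have hle : ∀ t, ‖Matrix.toEuclideanLin M (w t)‖ ^ 2 ≤ lam m := by
    intro t
    rw [hq]
    calc ∑ j, lam j * ⟪b j, w t⟫ ^ 2 ≤ ∑ j, lam m * ⟪b j, w t⟫ ^ 2 :=
          Finset.sum_le_sum fun j _ => mul_le_mul_of_nonneg_right (hm j) (sq_nonneg _)
      _ = lam m := by rw [← Finset.mul_sum, sum_sq_inner_basis, hw1]; ring
  have hin : ∀ x, ⟪Matrix.toEuclideanLin M (b m), Matrix.toEuclideanLin M x⟫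
      = lam m * ⟪b m, x⟫ := by
    intro x
    rw [hb, Finset.sum_eq_single m]
    · simp [b.orthonormal.1 m]
    · intro l _ hl
      rw [b.orthonormal.2 hl]; simp
    · simp
  have hcard : (0 : ℝ) < Fintype.card ι := by exact_mod_cast Fintype.card_pos
  have e1 : ∑ t, ⟪b m, w t⟫ ^ 2 = Fintype.card ι * (k : ℝ)⁻¹ := by
    have := hC.quad (b m)
    rw [b.orthonormal.1 m] at this
    rw [← inv_mul_eq_iff_eq_mul₀ hcard.ne', this]; ring
  have e2 : ∑ t, lam m * ⟪b m, w t⟫ ^ 2 / ‖Matrix.toEuclideanLin M (w t)‖ ^ 2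
      = Fintype.card ι * (k : ℝ)⁻¹ := by
    have := hD.quad (Matrix.toEuclideanLin M (b m))
    rw [← hlam, inv_mul_eq_iff_eq_mul₀ hcard.ne'] at this
    have e3 : ∀ t, ⟪Matrix.toEuclideanLin M (b m), direction D (z t)⟫ ^ 2
        = lam m * (lam m * ⟪b m, w t⟫ ^ 2 / ‖Matrix.toEuclideanLin M (w t)‖ ^ 2) := by
      intro t
      rw [← hMC, direction_mul, direction, inner_smul_right, hin]
      change _ = lam m * (lam m * ⟪b m, direction C (z t)⟫ ^ 2
        / ‖Matrix.toEuclideanLin M (direction C (z t))‖ ^ 2)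
      field_simp
    rw [Finset.sum_congr rfl fun t _ => e3 t, ← Finset.mul_sum] at this
    have h5 : lam m * ∑ t, lam m * ⟪b m, w t⟫ ^ 2 / ‖Matrix.toEuclideanLin M (w t)‖ ^ 2
      = lam m * (Fintype.card ι * (k : ℝ)⁻¹) := by rw [this]; ring
    exact mul_left_cancel₀ hlm.ne' h5
  have hterm : ∀ t, ⟪b m, w t⟫ ^ 2
      ≤ lam m * ⟪b m, w t⟫ ^ 2 / ‖Matrix.toEuclideanLin M (w t)‖ ^ 2 := by
    intro t
    rw [le_div_iff₀ (pow_pos (hMw t) 2), mul_comm]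
    exact mul_le_mul_of_nonneg_right (hle t) (sq_nonneg _)
  -- Equality must hold term by term. So either `w t` is orthogonal to `b m`, or `M` stretches `w t`
  -- maximally; then `w t` lies in the top eigenspace and is orthogonal to every `b j` with another
  -- eigenvalue.
  have heq := (Finset.sum_eq_sum_iff_of_le fun t _ => hterm t).1 (e1.trans e2.symm)
  have hor : ∀ t j, lam j ≠ lam m → ⟪b m, w t⟫ = 0 ∨ ⟪b j, w t⟫ = 0 := by
    intro t j hj
    by_cases h : ⟪b m, w t⟫ = 0
    · exact Or.inl h
    right
    have h1 := heq t (Finset.mem_univ t)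
    have h2 : ‖Matrix.toEuclideanLin M (w t)‖ ^ 2 = lam m := by
      rw [eq_div_iff (pow_pos (hMw t) 2).ne', mul_comm] at h1
      exact mul_right_cancel₀ (pow_ne_zero 2 h) h1
    have h3 : ∑ l, (lam m - lam l) * ⟪b l, w t⟫ ^ 2 = 0 := by
      simp only [sub_mul, Finset.sum_sub_distrib]
      rw [← hq, h2, ← Finset.mul_sum, sum_sq_inner_basis, hw1]; ring
    have h4 := (Finset.sum_eq_zero_iff_of_nonneg fun l _ =>
      mul_nonneg (sub_nonneg.2 (hm l)) (sq_nonneg _)).1 h3 j (Finset.mem_univ j)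
    have h5 : lam m - lam j ≠ 0 := sub_ne_zero.2 (Ne.symm hj)
    simpa [h5] using h4
  -- A second eigenvalue would confine the sample to the pair of hyperplanes orthogonal to `Cᵀ (b
  -- m)` and `Cᵀ (b j)`.
  have hall : ∀ j, lam j = lam m := by
    intro j
    by_contra hj
    have hCt : Cᵀ.det ≠ 0 := by rwa [Matrix.det_transpose]
    obtain ⟨t, ht1, ht2⟩ := hz (Matrix.toEuclideanLin Cᵀ (b m)) (Matrix.toEuclideanLin Cᵀ (b j))
      (toEuclideanLin_ne_zero hCt (b.orthonormal.ne_zero m))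
      (toEuclideanLin_ne_zero hCt (b.orthonormal.ne_zero j))
    rw [inner_toEuclideanLin_left, Matrix.transpose_transpose] at ht1 ht2
    rcases hor t j hj with h | h
    · rw [hw] at h
      simp only [direction, inner_smul_right, mul_eq_zero, inv_eq_zero, norm_eq_zero] at h
      exact h.elim (toEuclideanLin_ne_zero hCd (hz0 t)) ht1
    · rw [hw] at h
      simp only [direction, inner_smul_right, mul_eq_zero, inv_eq_zero, norm_eq_zero] at h
      exact h.elim (toEuclideanLin_ne_zero hCd (hz0 t)) ht2
  have hG : Mᵀ * M = lam m • (1 : Matrix (Fin k) (Fin k) ℝ) := by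
    have hin2 : ∀ x y, ⟪x, Matrix.toEuclideanLin (Mᵀ * M) y⟫ = lam m * ⟪x, y⟫ := by
      intro x y
      rw [toEuclideanLin_mul_apply, ← inner_toEuclideanLin_left, hb,
        ← b.sum_inner_mul_inner x y, Finset.mul_sum]
      refine Finset.sum_congr rfl fun j _ => ?_
      rw [hall, real_inner_comm x (b j)]
    ext a c
    have := hin2 (EuclideanSpace.single a 1) (EuclideanSpace.single c 1)
    simpa [inner_eq_dotProduct, ofLp_toEuclideanLin, Matrix.one_apply, Pi.single_apply,
      Matrix.mul_apply, Matrix.mulVec, dotProduct, eq_comm] using this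
  have hs : (0 : ℝ) < √(lam m) := Real.sqrt_pos.2 hlm
  have hD2 : D = √(lam m) • C := by
    apply upperPos_unique hDu
    · exact ⟨fun a c hac => by simp [hCu.1 a c hac], fun a => by
        simpa using mul_pos hs (hCu.2 a)⟩
    · rw [← hMC, Matrix.transpose_mul, Matrix.mul_assoc, ← Matrix.mul_assoc Mᵀ, hG,
        Matrix.transpose_smul]
      simp only [Matrix.smul_mul, Matrix.mul_smul, Matrix.one_mul, smul_smul,
        Real.mul_self_sqrt hlm.le]
  have h1 : √(lam m) = 1 := by
    have := congrFun (congrFun hD2 a₀) a₀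
    simp only [Matrix.smul_apply, smul_eq_mul] at this
    rw [← h0] at this
    have hp := hCu.2 a₀
    field_simp at this
    exact this.symm
  rw [hD2, h1, one_smul]

/-! ### Existence of a solution of Tyler's equation near the identity -/

theorem norm_toEuclideanLin_le {k : ℕ} {M : Matrix (Fin k) (Fin k) ℝ} {ρ : ℝ}
    (hM : ∀ a b, |M a b| ≤ ρ) (v : EuclideanSpace ℝ (Fin k)) :
    ‖Matrix.toEuclideanLin M v‖ ≤ k * ρ * ‖v‖ := by
  rcases Nat.eq_zero_or_pos k with rfl | hk
  · have : v = 0 := Subsingleton.elim _ _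
    simp [this]
  have hρ : 0 ≤ ρ := (abs_nonneg _).trans (hM ⟨0, hk⟩ ⟨0, hk⟩)
  have h : ‖Matrix.toEuclideanLin M v‖ ^ 2 ≤ (k * ρ * ‖v‖) ^ 2 := by
    rw [EuclideanSpace.real_norm_sq_eq]
    calc ∑ a, (Matrix.toEuclideanLin M v).ofLp a ^ 2
        ≤ ∑ a : Fin k, (k * ρ ^ 2) * ‖v‖ ^ 2 := by
          refine Finset.sum_le_sum fun a _ => ?_
          have h0 : (Matrix.toEuclideanLin M v).ofLp a = ∑ b, M a b * v.ofLp b := rfl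
          rw [EuclideanSpace.real_norm_sq_eq, h0]
          refine (Finset.sum_mul_sq_le_sq_mul_sq _ (fun b => M a b) fun b => v.ofLp b).trans ?_
          refine mul_le_mul_of_nonneg_right ?_ (Finset.sum_nonneg fun _ _ => sq_nonneg _)
          calc ∑ b, M a b ^ 2 ≤ ∑ b : Fin k, ρ ^ 2 := Finset.sum_le_sum fun b _ =>
                sq_le_sq' (abs_le.1 (hM a b)).1 (abs_le.1 (hM a b)).2
            _ = k * ρ ^ 2 := by simp
      _ = (k * ρ * ‖v‖) ^ 2 := by simp; ring
  exact le_of_sq_le_sq h (by positivity)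

theorem abs_norm_toEuclideanLin_sub_le {k : ℕ} {T : Matrix (Fin k) (Fin k) ℝ} {ρ : ℝ}
    (hT : ∀ a b, |T a b - (1 : Matrix (Fin k) (Fin k) ℝ) a b| ≤ ρ)
    (v : EuclideanSpace ℝ (Fin k)) :
    |‖Matrix.toEuclideanLin T v‖ - ‖v‖| ≤ k * ρ * ‖v‖ := by
  refine (abs_norm_sub_norm_le _ _).trans ?_
  have : Matrix.toEuclideanLin T v - v = Matrix.toEuclideanLin (T - 1) v := by
    rw [map_sub, LinearMap.sub_apply, toEuclideanLin_one_apply]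
  rw [this]
  exact norm_toEuclideanLin_le (fun a b => by simpa using hT a b) v

/-- Jensen's inequality for the logarithm with an explicit gap. Applying `log x ≤ x - 1` at `√(lam i
/ m)` instead of `lam i / m` leaves the square `(√(lam i) - √m)² / m` to spare. -/
theorem log_sum_ge {k : ℕ} {p lam : Fin k → ℝ} (hp : ∀ i, 0 ≤ p i) (hp1 : ∑ i, p i = 1)
    (hl : ∀ i, 0 < lam i) (j l : Fin k) :
    ∑ i, p i * Real.log (lam i)
      + p j * p l * (√(lam j) - √(lam l)) ^ 2 / ∑ i, p i * lam i
      ≤ Real.log (∑ i, p i * lam i) := by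
  set m := ∑ i, p i * lam i with hm
  have hm0 : 0 < m := by
    obtain ⟨i, hi⟩ : ∃ i, 0 < p i := by
      by_contra! h
      have : ∑ i, p i ≤ 0 := Finset.sum_nonpos fun i _ => h i
      linarith
    exact Finset.sum_pos' (fun i _ => mul_nonneg (hp i) (hl i).le)
      ⟨i, Finset.mem_univ i, mul_pos hi (hl i)⟩
  have h1 : ∀ i, Real.log (lam i) ≤ Real.log m + (lam i / m - 1)
      - (√(lam i) - √m) ^ 2 / m := by
    intro i
    have h2 := Real.log_le_sub_one_of_pos (x := √(lam i) / √m)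
      (div_pos (Real.sqrt_pos.2 (hl i)) (Real.sqrt_pos.2 hm0))
    rw [Real.log_div (Real.sqrt_pos.2 (hl i)).ne' (Real.sqrt_pos.2 hm0).ne',
      Real.log_sqrt (hl i).le, Real.log_sqrt hm0.le] at h2
    have e1 : lam i / m = (√(lam i) / √m) ^ 2 := by
      rw [div_pow, Real.sq_sqrt (hl i).le, Real.sq_sqrt hm0.le]
    have e2 : (√(lam i) - √m) ^ 2 / m = (√(lam i) / √m - 1) ^ 2 := by
      have := Real.sqrt_pos.2 hm0
      nth_rewrite 2 [← Real.sq_sqrt hm0.le]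
      field_simp
    rw [e1, e2]
    nlinarith
  have h2 : ∑ i, p i * Real.log (lam i)
      ≤ Real.log m - (∑ i, p i * (√(lam i) - √m) ^ 2) / m := by
    calc ∑ i, p i * Real.log (lam i)
        ≤ ∑ i, p i * (Real.log m + (lam i / m - 1) - (√(lam i) - √m) ^ 2 / m) :=
          Finset.sum_le_sum fun i _ => mul_le_mul_of_nonneg_left (h1 i) (hp i)
      _ = (∑ i, p i) * (Real.log m - 1) + (∑ i, p i * lam i) / m
          - (∑ i, p i * (√(lam i) - √m) ^ 2) / m := by
          rw [Finset.sum_mul, Finset.sum_div, Finset.sum_div, ← Finset.sum_add_distrib,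
            ← Finset.sum_sub_distrib]
          exact Finset.sum_congr rfl fun i _ => by ring
      _ = _ := by rw [hp1, ← hm, div_self hm0.ne']; ring
  -- Two summands suffice: `p_j x² + p_l y² ≥ p_j p_l (x - y)²` because `p_j + p_l ≤ 1`.
  have h3 : p j * p l * (√(lam j) - √(lam l)) ^ 2 ≤ ∑ i, p i * (√(lam i) - √m) ^ 2 := by
    have hnn : ∀ i ∈ Finset.univ, 0 ≤ p i * (√(lam i) - √m) ^ 2 :=
      fun i _ => mul_nonneg (hp i) (sq_nonneg _)
    by_cases hjl : j = l
    · subst hjl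
      simpa using Finset.sum_nonneg hnn
    have hs := Finset.add_le_sum hnn (Finset.mem_univ j) (Finset.mem_univ l) hjl
    have hs1 := Finset.add_le_sum (fun i _ => hp i) (Finset.mem_univ j) (Finset.mem_univ l) hjl
    rw [hp1] at hs1
    refine le_trans ?_ hs
    set x := √(lam j) - √m
    set y := √(lam l) - √m
    have : √(lam j) - √(lam l) = x - y := by simp [x, y]
    rw [this]
    have g1 : p j * p j * x ^ 2 ≤ p j * (1 - p l) * x ^ 2 :=
      mul_le_mul_of_nonneg_right (mul_le_mul_of_nonneg_left (by linarith) (hp j)) (sq_nonneg _)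
    have g2 : p l * p l * y ^ 2 ≤ p l * (1 - p j) * y ^ 2 :=
      mul_le_mul_of_nonneg_right (mul_le_mul_of_nonneg_left (by linarith) (hp l)) (sq_nonneg _)
    nlinarith [sq_nonneg (p j * x + p l * y)]
  have h4 := div_le_div_of_nonneg_right h3 hm0.le
  linarith

/-- Tyler's objective function, on upper triangular matrices with positive diagonal. -/
def tylerObj {k : ℕ} {ι : Type*} [Fintype ι] (u : ι → EuclideanSpace ℝ (Fin k))
    (T : Matrix (Fin k) (Fin k) ℝ) : ℝ :=
  k * ((Fintype.card ι : ℝ)⁻¹ * ∑ t, Real.log (‖Matrix.toEuclideanLin T (u t)‖ ^ 2))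
    - 2 * ∑ a, Real.log (T a a)

/-- The second moments of the finite sample `u` are `η`-close to those of a uniform direction. -/
def SecondMomentsClose {k : ℕ} {ι : Type*} [Fintype ι] (η : ℝ)
    (u : ι → EuclideanSpace ℝ (Fin k)) : Prop :=
  ∀ v, |k * ((Fintype.card ι : ℝ)⁻¹ * ∑ t, ⟪v, u t⟫ ^ 2) - ‖v‖ ^ 2| ≤ η * ‖v‖ ^ 2

/-- A quantitative form of the sample `u` not being contained in a pair of hyperplanes. -/
def FourthMomentsLarge {k : ℕ} {ι : Type*} [Fintype ι] (κ : ℝ)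
    (u : ι → EuclideanSpace ℝ (Fin k)) : Prop :=
  ∀ x y, κ * (‖x‖ ^ 2 * ‖y‖ ^ 2)
    ≤ (Fintype.card ι : ℝ)⁻¹ * ∑ t, ⟪x, u t⟫ ^ 2 * ⟪y, u t⟫ ^ 2

/-- The objective vanishes at the identity. At `T`, the gap in Jensen's inequality, averaged with
the fourth moments, contributes at least `k κ Δ² / 4`, where `Δ` is the spread of the singular
values of `T`. The error in the second moments can lower the objective by at most `4 k η Δ`. A value
`≤ 0` hence forces `Δ ≤ 16 η / κ`. -/
theorem tylerObj_spread_le {k : ℕ} {ι : Type*} [Fintype ι] [Nonempty ι]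
    {u : ι → EuclideanSpace ℝ (Fin k)} (hu : ∀ t, ‖u t‖ = 1)
    {η κ : ℝ} (hκ : 0 < κ) (h2 : SecondMomentsClose η u)
    (h4 : FourthMomentsLarge κ u) {T : Matrix (Fin k) (Fin k) ℝ} (hT : IsUpperPos T)
    (hobj : tylerObj u T ≤ 0)
    {b : OrthonormalBasis (Fin k) ℝ (EuclideanSpace ℝ (Fin k))} {lam : Fin k → ℝ}
    (hb : ∀ x y, ⟪Matrix.toEuclideanLin T x, Matrix.toEuclideanLin T y⟫
        = ∑ j, lam j * (⟪b j, x⟫ * ⟪b j, y⟫)) (hdet : ∏ j, lam j = T.det ^ 2)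
    (hlo : ∀ j, 1 / 4 ≤ lam j) (hhi : ∀ j, lam j ≤ 4) (j l : Fin k)
    (hj : ∀ i, lam j ≤ lam i) (hl : ∀ i, lam i ≤ lam l) :
    √(lam l) - √(lam j) ≤ 16 * η / κ := by
  have hpos : ∀ i, 0 < lam i := fun i => lt_of_lt_of_le (by norm_num) (hlo i)
  have hk : (0 : ℝ) < k := by
    have := j.pos
    exact_mod_cast this
  set N : ℝ := (Fintype.card ι : ℝ)⁻¹ with hN
  have hN0 : 0 < N := inv_pos.2 (by exact_mod_cast Fintype.card_pos)
  have hNc : N * Fintype.card ι = 1 :=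
    inv_mul_cancel₀ (by exact_mod_cast Fintype.card_ne_zero)
  set Δ := √(lam l) - √(lam j) with hΔ
  have hΔ0 : 0 ≤ Δ := sub_nonneg.2 (Real.sqrt_le_sqrt (hl j))
  have hη : 0 ≤ η := by
    have := (abs_nonneg _).trans (h2 (b j))
    simpa [b.orthonormal.1 j] using this
  have hlog : 2 * ∑ a, Real.log (T a a) = ∑ i, Real.log (lam i) := by
    rw [← Real.log_prod (fun i _ => (hpos i).ne'), hdet, Real.log_pow,
      Matrix.det_of_isUpperTriangular hT.bt, Real.log_prod (fun a _ => (hT.2 a).ne')]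
    norm_num
  have hterm : ∀ t, ∑ i, ⟪b i, u t⟫ ^ 2 * Real.log (lam i)
      + ⟪b l, u t⟫ ^ 2 * ⟪b j, u t⟫ ^ 2 * (Δ ^ 2 / 4)
      ≤ Real.log (‖Matrix.toEuclideanLin T (u t)‖ ^ 2) := by
    intro t
    have hp1 : ∑ i, ⟪b i, u t⟫ ^ 2 = 1 := by rw [sum_sq_inner_basis, hu]; norm_num
    have h := log_sum_ge (p := fun i => ⟪b i, u t⟫ ^ 2) (fun i => sq_nonneg _) hp1 hpos l j
    have hm : ∑ i, ⟪b i, u t⟫ ^ 2 * lam i = ‖Matrix.toEuclideanLin T (u t)‖ ^ 2 := by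
      rw [spectral_norm_sq hb]
      exact Finset.sum_congr rfl fun i _ => mul_comm _ _
    have hm4 : ∑ i, ⟪b i, u t⟫ ^ 2 * lam i ≤ 4 := by
      calc ∑ i, ⟪b i, u t⟫ ^ 2 * lam i ≤ ∑ i, ⟪b i, u t⟫ ^ 2 * 4 :=
            Finset.sum_le_sum fun i _ => mul_le_mul_of_nonneg_left (hhi i) (sq_nonneg _)
        _ = 4 := by rw [← Finset.sum_mul, hp1, one_mul]
    have hm0 : 0 < ∑ i, ⟪b i, u t⟫ ^ 2 * lam i := by
      calc (0 : ℝ) < ∑ i, ⟪b i, u t⟫ ^ 2 * (1 / 4) := by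
            rw [← Finset.sum_mul, hp1]; norm_num
        _ ≤ _ := Finset.sum_le_sum fun i _ => mul_le_mul_of_nonneg_left (hlo i) (sq_nonneg _)
    rw [← hm]
    refine le_trans ?_ h
    rw [mul_div_assoc (⟪b l, u t⟫ ^ 2 * ⟪b j, u t⟫ ^ 2)]
    have : Δ ^ 2 / 4 ≤ Δ ^ 2 / ∑ i, ⟪b i, u t⟫ ^ 2 * lam i :=
      div_le_div_of_nonneg_left (sq_nonneg _) hm0 hm4
    have h5 := mul_le_mul_of_nonneg_left this
      (mul_nonneg (sq_nonneg ⟪b l, u t⟫) (sq_nonneg ⟪b j, u t⟫))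
    exact add_le_add_right h5 _
  -- The errors of the second moments along the eigenbasis sum to zero, since the `u t` are unit
  -- vectors. This allows `log (lam j)` to be subtracted below, which makes the linear term
  -- proportional to the spread.
  set c : Fin k → ℝ := fun i => k * (N * ∑ t, ⟪b i, u t⟫ ^ 2) - 1 with hc
  have hcη : ∀ i, |c i| ≤ η := by
    intro i
    have := h2 (b i)
    simpa [b.orthonormal.1 i] using this
  have hc0 : ∑ i, c i = 0 := by
    simp only [hc, Finset.sum_sub_distrib]
    rw [← Finset.mul_sum, ← Finset.mul_sum, Finset.sum_comm]
    simp only [sum_sq_inner_basis, hu]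
    simp [hNc]
  have hsum : ∑ i, c i * Real.log (lam i) + k * (κ * (Δ ^ 2 / 4)) ≤ 0 := by
    refine le_trans ?_ hobj
    have h6 := h4 (b l) (b j)
    rw [b.orthonormal.1 l, b.orthonormal.1 j] at h6
    have h7 : N * ∑ t, (∑ i, ⟪b i, u t⟫ ^ 2 * Real.log (lam i)
      + ⟪b l, u t⟫ ^ 2 * ⟪b j, u t⟫ ^ 2 * (Δ ^ 2 / 4)) ≤
      N * ∑ t, Real.log (‖Matrix.toEuclideanLin T (u t)‖ ^ 2) :=
      mul_le_mul_of_nonneg_left (Finset.sum_le_sum fun t _ => hterm t) hN0.le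
    rw [Finset.sum_add_distrib, mul_add, ← Finset.sum_mul, ← mul_assoc N, Finset.sum_comm] at h7
    have h8 : κ * (Δ ^ 2 / 4) ≤ (N * ∑ t, ⟪b l, u t⟫ ^ 2 * ⟪b j, u t⟫ ^ 2) * (Δ ^ 2 / 4) :=
      mul_le_mul_of_nonneg_right (by simpa using h6) (by positivity)
    have h9 : ∑ i, c i * Real.log (lam i)
        = k * (N * ∑ i, ∑ t, ⟪b i, u t⟫ ^ 2 * Real.log (lam i)) - ∑ i, Real.log (lam i) := by
      rw [Finset.mul_sum, Finset.mul_sum, ← Finset.sum_sub_distrib]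
      refine Finset.sum_congr rfl fun i _ => ?_
      rw [← Finset.sum_mul]; simp only [hc]; ring
    rw [tylerObj, hlog, h9]
    have h10 := mul_le_mul_of_nonneg_left (h7.trans' (add_le_add_right h8 _)) hk.le
    rw [mul_add] at h10
    linarith
  have hdiff : ∀ i, Real.log (lam i) - Real.log (lam j) ≤ 4 * Δ := by
    intro i
    have hsj : 1 / 2 ≤ √(lam j) := Real.le_sqrt_of_sq_le (by linarith [hlo j])
    have g1 : Real.log (lam i) - Real.log (lam j) ≤ Real.log (lam l) - Real.log (lam j) :=
      sub_le_sub_right (Real.log_le_log (hpos i) (hl i)) _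
    have g2 := Real.log_le_sub_one_of_pos (x := √(lam l) / √(lam j))
      (div_pos (Real.sqrt_pos.2 (hpos l)) (Real.sqrt_pos.2 (hpos j)))
    rw [Real.log_div (Real.sqrt_pos.2 (hpos l)).ne' (Real.sqrt_pos.2 (hpos j)).ne',
      Real.log_sqrt (hpos l).le, Real.log_sqrt (hpos j).le] at g2
    have g3 : √(lam l) / √(lam j) - 1 ≤ 2 * Δ := by
      rw [div_sub_one (Real.sqrt_pos.2 (hpos j)).ne', ← hΔ,
        div_le_iff₀ (Real.sqrt_pos.2 (hpos j))]
      nlinarith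
    linarith
  have hlow : -(k * (η * (4 * Δ))) ≤ ∑ i, c i * Real.log (lam i) := by
    have : ∑ i, c i * Real.log (lam i)
        = ∑ i, c i * (Real.log (lam i) - Real.log (lam j)) := by
      simp only [mul_sub, Finset.sum_sub_distrib, ← Finset.sum_mul, hc0]; ring
    rw [this]
    calc -(k * (η * (4 * Δ))) = ∑ i : Fin k, -(η * (4 * Δ)) := by simp
      _ ≤ _ := by
        refine Finset.sum_le_sum fun i _ => ?_
        have d0 : 0 ≤ Real.log (lam i) - Real.log (lam j) :=
          sub_nonneg.2 (Real.log_le_log (hpos j) (hj i))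
        have e1 : -η * (Real.log (lam i) - Real.log (lam j))
            ≤ c i * (Real.log (lam i) - Real.log (lam j)) :=
          mul_le_mul_of_nonneg_right (abs_le.1 (hcη i)).1 d0
        have e2 := mul_le_mul_of_nonneg_left (hdiff i) hη
        linarith
  have hfin : κ * Δ ^ 2 ≤ 16 * η * Δ := by
    have : k * (κ * (Δ ^ 2 / 4)) ≤ k * (η * (4 * Δ)) := by linarith
    have := le_of_mul_le_mul_left this hk
    linarith
  rw [le_div_iff₀ hκ]
  rcases hΔ0.eq_or_lt with h0 | h0
  · rw [← h0]; simpa using hη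
  · have : (Δ * κ) * Δ ≤ (16 * η) * Δ := by linarith [hfin, sq Δ]
    exact le_of_mul_le_mul_right this h0

theorem transpose_mul_self_apply {k : ℕ} (T : Matrix (Fin k) (Fin k) ℝ) (a c : Fin k) :
    (Tᵀ * T) a c = ⟪Matrix.toEuclideanLin T (EuclideanSpace.single a 1),
      Matrix.toEuclideanLin T (EuclideanSpace.single c 1)⟫ := by
  simp [inner_eq_dotProduct, Matrix.mul_apply, Matrix.col, dotProduct]

/-- Continuity at the identity of the Cholesky factor. -/
theorem upperPos_near_one {k : ℕ} {ρ : ℝ} (hρ : 0 < ρ) :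
    ∃ δ > 0, ∀ T : Matrix (Fin k) (Fin k) ℝ, IsUpperPos T →
      (∀ a b, |(Tᵀ * T) a b - (1 : Matrix (Fin k) (Fin k) ℝ) a b| ≤ δ) →
      ∀ a b, |T a b - (1 : Matrix (Fin k) (Fin k) ℝ) a b| < ρ := by
  set g : Matrix (Fin k) (Fin k) ℝ → ℝ := fun T =>
    ∑ a, ∑ b, |(Tᵀ * T) a b - (1 : Matrix (Fin k) (Fin k) ℝ) a b| with hg
  have hgc : Continuous g := by
    refine continuous_finsetSum _ fun a _ => continuous_finsetSum _ fun b _ => ?_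
    have : Continuous fun T : Matrix (Fin k) (Fin k) ℝ => (Tᵀ * T) a b :=
      (continuous_id.matrix_transpose.matrix_mul continuous_id).matrix_elem a b
    fun_prop
  -- Compactness: `g` vanishes only at Cholesky factors of the identity, and on `Q` it has a
  -- positive minimum. The diagonal is only required to be nonnegative so that `Q` is closed; `g T =
  -- 0` makes `T` invertible and restores strict positivity.
  set Q : Set (Matrix (Fin k) (Fin k) ℝ) :=
    {T | (∀ a b, |T a b| ≤ 2) ∧ (∀ a b, b < a → T a b = 0) ∧ (∀ a, 0 ≤ T a a) ∧
      ∃ a b, ρ ≤ |T a b - (1 : Matrix (Fin k) (Fin k) ℝ) a b|} with hQ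
  have hel : ∀ a b, Continuous fun T : Matrix (Fin k) (Fin k) ℝ => T a b := fun a b =>
    continuous_id.matrix_elem a b
  have hQc : IsCompact Q := by
    have hbox : IsCompact (Set.pi univ fun _ : Fin k => Set.pi univ fun _ : Fin k =>
        Icc (-2 : ℝ) 2) := isCompact_univ_pi fun _ => isCompact_univ_pi fun _ => isCompact_Icc
    refine hbox.of_isClosed_subset ?_ ?_
    · have e : Q = (⋂ a, ⋂ b, {T | |T a b| ≤ 2}) ∩ ((⋂ a, ⋂ b, ⋂ (_ : b < a), {T | T a b = 0}) ∩
          ((⋂ a, {T | 0 ≤ T a a}) ∩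
            ⋃ a, ⋃ b, {T | ρ ≤ |T a b - (1 : Matrix (Fin k) (Fin k) ℝ) a b|})) := by
        ext T; simp [hQ]
      rw [e]
      refine (isClosed_iInter fun a => isClosed_iInter fun b =>
        isClosed_le (hel a b).abs continuous_const).inter
        ((isClosed_iInter fun a => isClosed_iInter fun b => isClosed_iInter fun _ =>
          isClosed_eq (hel a b) continuous_const).inter
        ((isClosed_iInter fun a => isClosed_le continuous_const (hel a a)).inter
        (isClosed_iUnion_of_finite fun a => isClosed_iUnion_of_finite fun b =>
          isClosed_le continuous_const ((hel a b).sub continuous_const).abs)))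
    · intro T hT a _ b _
      exact abs_le.1 (hT.1 a b)
  have hpos : ∀ T ∈ Q, 0 < g T := by
    intro T hT
    have hnn : 0 ≤ g T := Finset.sum_nonneg fun _ _ => Finset.sum_nonneg fun _ _ => abs_nonneg _
    refine hnn.lt_of_ne fun h0 => ?_
    have h1 : Tᵀ * T = 1 := by
      ext a b
      have h2 := (Finset.sum_eq_zero_iff_of_nonneg fun a _ =>
        Finset.sum_nonneg fun b _ => abs_nonneg _).1 h0.symm a (Finset.mem_univ a)
      have h3 := (Finset.sum_eq_zero_iff_of_nonneg fun b _ => abs_nonneg _).1 h2 b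
        (Finset.mem_univ b)
      exact sub_eq_zero.1 (abs_eq_zero.1 h3)
    have hdet : T.det ≠ 0 := by
      intro hd
      have := congrArg Matrix.det h1
      simp [Matrix.det_mul, hd] at this
    have hTu : IsUpperPos T := by
      refine ⟨hT.2.1, fun a => (hT.2.2.1 a).lt_of_ne fun h => hdet ?_⟩
      have hbt : T.BlockTriangular id := fun a b hab => hT.2.1 a b hab
      rw [Matrix.det_of_isUpperTriangular hbt]
      exact Finset.prod_eq_zero (Finset.mem_univ a) h.symm
    have hT1 : T = 1 := by
      refine upperPos_unique hTu ⟨fun a b hab => Matrix.one_apply_ne hab.ne', fun a => ?_⟩ ?_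
      · simp
      · simpa using h1
    obtain ⟨a, b, hab⟩ := hT.2.2.2
    rw [hT1, sub_self, abs_zero] at hab
    linarith
  obtain ⟨δ, hδ, hmin⟩ : ∃ δ > 0, ∀ T ∈ Q, δ ≤ g T := by
    rcases Q.eq_empty_or_nonempty with he | hne
    · exact ⟨1, one_pos, by simp [he]⟩
    · obtain ⟨T, hTQ, hT⟩ := hQc.exists_isMinOn hne hgc.continuousOn
      exact ⟨g T, hpos T hTQ, fun T' h' => hT h'⟩
  -- The bound `1` on the diagonal of `TᵀT - 1` keeps the entries of `T` below `2`; the other bound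
  -- keeps the sum of `k²` errors strictly below `δ`.
  refine ⟨min 1 (δ / (k * k + 1)), lt_min one_pos (by positivity), fun T hT hTT a b => ?_⟩
  by_contra! hab
  have hTQ : T ∈ Q := by
    refine ⟨fun c d => ?_, hT.1, fun c => (hT.2 c).le, a, b, hab⟩
    have h1 := (hTT d d).trans (min_le_left _ _)
    rw [Matrix.one_apply_eq, Matrix.mul_apply] at h1
    have h2 : T c d ^ 2 ≤ ∑ j, Tᵀ d j * T j d := by
      simp only [Matrix.transpose_apply, ← sq]
      exact Finset.single_le_sum (f := fun j => T j d ^ 2) (fun j _ => sq_nonneg _)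
        (Finset.mem_univ c)
    have h3 := (abs_le.1 h1).2
    exact abs_le_of_sq_le_sq (by linarith) (by norm_num)
  have h1 := hmin T hTQ
  have h2 : g T ≤ ∑ a : Fin k, ∑ b : Fin k, δ / (k * k + 1) :=
    Finset.sum_le_sum fun c _ => Finset.sum_le_sum fun d _ => (hTT c d).trans (min_le_right _ _)
  simp only [Finset.sum_const, Finset.card_univ, Fintype.card_fin, nsmul_eq_mul] at h2
  have h3 : (k : ℝ) * (k * (δ / (k * k + 1))) < δ := by
    rw [← mul_assoc, mul_div_assoc', div_lt_iff₀ (by positivity)]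
    nlinarith
  linarith

/-- The contributions `2 k log c` of the two terms cancel. This freedom is used to move a
constrained minimiser into the interior of the constraint set. -/
theorem tylerObj_smul {k : ℕ} {ι : Type*} [Fintype ι] [Nonempty ι]
    {u : ι → EuclideanSpace ℝ (Fin k)} (hu : ∀ t, u t ≠ 0)
    {T : Matrix (Fin k) (Fin k) ℝ} (hT : IsUpperPos T) {c : ℝ} (hc : 0 < c) :
    tylerObj u (c • T) = tylerObj u T := by
  have hNc : (Fintype.card ι : ℝ)⁻¹ * Fintype.card ι = 1 :=
    inv_mul_cancel₀ (by exact_mod_cast Fintype.card_ne_zero)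
  have h1 : ∀ t, Real.log (‖Matrix.toEuclideanLin (c • T) (u t)‖ ^ 2)
      = 2 * Real.log c + Real.log (‖Matrix.toEuclideanLin T (u t)‖ ^ 2) := by
    intro t
    have := norm_pos_iff.2 (toEuclideanLin_ne_zero hT.det_pos.ne' (hu t))
    rw [map_smul, LinearMap.smul_apply, norm_smul, mul_pow,
      Real.norm_of_nonneg hc.le, Real.log_mul (by positivity) (by positivity), Real.log_pow]
    norm_num
  have h2 : ∀ a, Real.log ((c • T) a a) = Real.log c + Real.log (T a a) := fun a => by
    rw [Matrix.smul_apply, smul_eq_mul, Real.log_mul hc.ne' (hT.2 a).ne']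
  rw [tylerObj, Finset.sum_congr rfl fun t _ => h1 t, Finset.sum_congr rfl fun a _ => h2 a,
    Finset.sum_add_distrib, Finset.sum_add_distrib, tylerObj]
  simp only [Finset.sum_const, Finset.card_univ, Fintype.card_fin, nsmul_eq_mul]
  linear_combination (2 * Real.log c * k) * hNc

/-- Tyler's equation is the stationarity condition of the objective. For `a ≤ b` the path `(1 + s
E_ab) T` stays upper triangular, and its derivative at `s = 0` is, up to a factor, the `(a, b)`
entry of the equation. The remaining entries follow by symmetry. -/
theorem tylerEq_of_eventually_le {k : ℕ} {ι : Type*} [Fintype ι] [Nonempty ι] (hk : 1 ≤ k)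
    {u : ι → EuclideanSpace ℝ (Fin k)} (hu : ∀ t, u t ≠ 0)
    {T : Matrix (Fin k) (Fin k) ℝ} (hT : IsUpperPos T)
    (hmin : ∀ a b, a ≤ b → ∀ᶠ s : ℝ in 𝓝 0,
      tylerObj u T ≤ tylerObj u ((1 + Matrix.single a b s) * T)) : TylerEq u T := by
  have hk0 : (k : ℝ) ≠ 0 := by positivity
  set y : ι → EuclideanSpace ℝ (Fin k) := fun t => Matrix.toEuclideanLin T (u t) with hy
  have hy0 : ∀ t, 0 < ‖y t‖ := fun t =>
    norm_pos_iff.2 (toEuclideanLin_ne_zero hT.det_pos.ne' (hu t))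
  have key : ∀ a b, a ≤ b → k * ((Fintype.card ι : ℝ)⁻¹ *
      ∑ t, (y t).ofLp a * (y t).ofLp b / ‖y t‖ ^ 2) = if a = b then 1 else 0 := by
    intro a b hab
    have hobj : ∀ s : ℝ, tylerObj u ((1 + Matrix.single a b s) * T)
        = k * ((Fintype.card ι : ℝ)⁻¹ * ∑ t, Real.log (‖y t‖ ^ 2
            + s * (2 * ((y t).ofLp a * (y t).ofLp b)) + s ^ 2 * (y t).ofLp b ^ 2))
          - 2 * ∑ c, Real.log (T c c + s * (if c = a then T b c else 0)) := by
      intro s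
      rw [tylerObj]
      congr 1
      · congr 2
        refine Finset.sum_congr rfl fun t _ => congrArg Real.log ?_
        have e1 : Matrix.toEuclideanLin ((1 + Matrix.single a b s) * T) (u t)
            = y t + (s * (y t).ofLp b) • EuclideanSpace.single a (1 : ℝ) := by
          rw [toEuclideanLin_mul_apply, map_add, LinearMap.add_apply, toEuclideanLin_one_apply]
          congr 1
          ext c
          rw [ofLp_toEuclideanLin, Matrix.single_mulVec]
          simp [hy, Function.update_apply]
        rw [e1, norm_add_sq_real, inner_smul_right, norm_smul]
        simp [inner_eq_dotProduct, mul_pow]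
        ring
      · congr 2
        refine funext fun c => congrArg Real.log ?_
        rw [Matrix.add_mul, Matrix.one_mul, Matrix.add_apply]
        by_cases h : c = a
        · subst h; simp
        · simp [h]
    have hder1 : ∀ t, HasDerivAt (fun s : ℝ => Real.log (‖y t‖ ^ 2
        + s * (2 * ((y t).ofLp a * (y t).ofLp b)) + s ^ 2 * (y t).ofLp b ^ 2))
        (2 * ((y t).ofLp a * (y t).ofLp b) / ‖y t‖ ^ 2) 0 := by
      intro t
      have h1 : HasDerivAt (fun s : ℝ => ‖y t‖ ^ 2
          + s * (2 * ((y t).ofLp a * (y t).ofLp b)) + s ^ 2 * (y t).ofLp b ^ 2)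
          (2 * ((y t).ofLp a * (y t).ofLp b)) 0 := by
        have := (((hasDerivAt_id (0 : ℝ)).mul_const
          (2 * ((y t).ofLp a * (y t).ofLp b))).const_add (‖y t‖ ^ 2)).add
          (((hasDerivAt_id (0 : ℝ)).pow 2).mul_const ((y t).ofLp b ^ 2))
        refine this.congr_deriv ?_
        simp
      have h2 := h1.log (by simpa using (pow_pos (hy0 t) 2).ne')
      simpa using h2
    have hder2 : ∀ c, HasDerivAt (fun s : ℝ =>
        Real.log (T c c + s * (if c = a then T b c else 0)))
        ((if c = a then T b c else 0) / T c c) 0 := by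
      intro c
      have h1 : HasDerivAt (fun s : ℝ => T c c + s * (if c = a then T b c else 0))
          (if c = a then T b c else 0) 0 := by
        simpa using ((hasDerivAt_id (0 : ℝ)).mul_const (if c = a then T b c else 0)).const_add
          (T c c)
      have h2 := h1.log (by simpa using (hT.2 c).ne')
      simpa using h2
    have hder := (((HasDerivAt.fun_sum fun t (_ : t ∈ Finset.univ) => hder1 t).const_mul
      (Fintype.card ι : ℝ)⁻¹).const_mul (k : ℝ)).sub
      ((HasDerivAt.fun_sum fun c (_ : c ∈ Finset.univ) => hder2 c).const_mul 2)
    have hloc : IsLocalMin (fun s : ℝ => k * ((Fintype.card ι : ℝ)⁻¹ * ∑ t, Real.log (‖y t‖ ^ 2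
            + s * (2 * ((y t).ofLp a * (y t).ofLp b)) + s ^ 2 * (y t).ofLp b ^ 2))
          - 2 * ∑ c, Real.log (T c c + s * (if c = a then T b c else 0))) 0 := by
      filter_upwards [hmin a b hab] with s hs
      rw [← hobj, ← hobj]
      simpa using hs
    have h0 := hloc.hasDerivAt_eq_zero hder
    have h1 : ∑ c, (if c = a then T b c else 0) / T c c = if a = b then 1 else 0 := by
      rw [Finset.sum_eq_single a (fun c _ hc => by simp [hc]) (by simp)]
      by_cases h : a = b
      · subst h; simp [(hT.2 a).ne']
      · simp [h, hT.1 b a (lt_of_le_of_ne hab h)]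
    rw [h1] at h0
    have h2 : ∑ t, 2 * ((y t).ofLp a * (y t).ofLp b) / ‖y t‖ ^ 2
        = 2 * ∑ t, (y t).ofLp a * (y t).ofLp b / ‖y t‖ ^ 2 := by
      rw [Finset.mul_sum]
      exact Finset.sum_congr rfl fun t _ => by ring
    rw [h2] at h0
    linarith
  have key' : ∀ a b, k * ((Fintype.card ι : ℝ)⁻¹ *
      ∑ t, (y t).ofLp a * (y t).ofLp b / ‖y t‖ ^ 2) = if a = b then 1 else 0 := by
    intro a b
    rcases le_total a b with h | h
    · exact key a b h
    · simpa only [mul_comm, eq_comm] using key b a h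
  ext a b
  have h := key' a b
  have e1 : ∀ t, outer (direction T (u t)) (direction T (u t)) a b
      = (y t).ofLp a * (y t).ofLp b / ‖y t‖ ^ 2 := by
    intro t
    have e2 : direction T (u t) = ‖y t‖⁻¹ • y t := rfl
    rw [e2, outer, Matrix.vecMulVec_apply]
    simp only [PiLp.smul_apply, smul_eq_mul]
    ring
  rw [Matrix.smul_apply, Matrix.sum_apply, Finset.sum_congr rfl fun t _ => e1 t,
    Matrix.smul_apply, Matrix.one_apply, smul_eq_mul, smul_eq_mul, ← h]
  field_simp

/-- The objective has a minimiser `T₀` on a compact box around the identity, possibly on its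
boundary. Its singular values have small spread, so a multiple `T₁` of it has `T₁ᵀT₁` close to the
identity, and `T₁` lies strictly inside the box by continuity of the Cholesky factor. The objective
is scale invariant, so `T₁` is a local minimiser, hence stationary. -/
theorem exists_tylerEq_near_one {k : ℕ} (hk : 1 ≤ k) {κ ρ : ℝ} (hκ : 0 < κ) (hρ : 0 < ρ) :
    ∃ η > 0, ∀ n : ℕ, 0 < n → ∀ u : Fin n → EuclideanSpace ℝ (Fin k), (∀ t, ‖u t‖ = 1) →
      SecondMomentsClose η u → FourthMomentsLarge κ u →
      ∃ T : Matrix (Fin k) (Fin k) ℝ, IsUpperPos T ∧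
        (∀ a b, |T a b - (1 : Matrix (Fin k) (Fin k) ℝ) a b| < ρ) ∧ TylerEq u T := by
  have hk0 : (0 : ℝ) < k := by positivity
  -- `k r ≤ 1/2` keeps the singular values of matrices in the box between `1/2` and `3/2`, hence the
  -- eigenvalues of `TᵀT` in `[1/4, 4]`.
  set r : ℝ := min ρ (1 / (2 * k)) with hr
  have hr0 : 0 < r := lt_min hρ (by positivity)
  have hkr : k * r ≤ 1 / 2 := by
    calc k * r ≤ k * (1 / (2 * k)) := mul_le_mul_of_nonneg_left (min_le_right _ _) hk0.le
      _ = 1 / 2 := by field_simp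
  have hr12 : r ≤ 1 / 2 := by
    have : (1 : ℝ) ≤ k := by exact_mod_cast hk
    nlinarith
  obtain ⟨δ, hδ, hchol⟩ := upperPos_near_one (k := k) hr0
  -- `(1 + x)² - 1 ≤ 3 x ≤ δ`. With the threshold `κ x / 32` below, the spread `16 η / κ` equals `x
  -- / 2`, and the lower bound `1/2` for singular values turns this into a relative spread of at
  -- most `x`.
  set x : ℝ := min 1 (δ / 3) with hx
  have hx0 : 0 < x := lt_min one_pos (by positivity)
  refine ⟨κ * x / 32, by positivity, fun n hn u hu h2 h4 => ?_⟩
  have : Nonempty (Fin n) := ⟨⟨0, hn⟩⟩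
  have hu0 : ∀ t, u t ≠ 0 := fun t h => by simpa [h] using hu t
  set Q : Set (Matrix (Fin k) (Fin k) ℝ) :=
    {T | (∀ a b, |T a b - (1 : Matrix (Fin k) (Fin k) ℝ) a b| ≤ r) ∧ ∀ a b, b < a → T a b = 0}
    with hQ
  have hel : ∀ a b, Continuous fun T : Matrix (Fin k) (Fin k) ℝ => T a b := fun a b =>
    continuous_id.matrix_elem a b
  have hQc : IsCompact Q := by
    have hbox : IsCompact (Set.pi univ fun _ : Fin k => Set.pi univ fun _ : Fin k =>
        Icc (-2 : ℝ) 2) := isCompact_univ_pi fun _ => isCompact_univ_pi fun _ => isCompact_Icc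
    refine hbox.of_isClosed_subset ?_ ?_
    · have e : Q = (⋂ a, ⋂ b, {T | |T a b - (1 : Matrix (Fin k) (Fin k) ℝ) a b| ≤ r}) ∩
          (⋂ a, ⋂ b, ⋂ (_ : b < a), {T | T a b = 0}) := by
        ext T; simp [hQ]
      rw [e]
      exact (isClosed_iInter fun a => isClosed_iInter fun b =>
        isClosed_le ((hel a b).sub continuous_const).abs continuous_const).inter
        (isClosed_iInter fun a => isClosed_iInter fun b => isClosed_iInter fun _ =>
          isClosed_eq (hel a b) continuous_const)
    · intro T hT a _ b _
      have h1 := abs_le.1 (hT.1 a b)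
      have h3 : (1 : Matrix (Fin k) (Fin k) ℝ) a b ∈ Icc (0 : ℝ) 1 := by
        rw [Matrix.one_apply]; split_ifs <;> simp
      exact ⟨by linarith [h1.1, h3.1], by linarith [h1.2, h3.2]⟩
  have hQu : ∀ T ∈ Q, IsUpperPos T := by
    refine fun T hT => ⟨hT.2, fun a => ?_⟩
    have h1 := abs_le.1 (hT.1 a a)
    rw [Matrix.one_apply_eq] at h1
    linarith [h1.1]
  have h1Q : (1 : Matrix (Fin k) (Fin k) ℝ) ∈ Q :=
    ⟨fun a b => by simpa using hr0.le, fun a b hab => Matrix.one_apply_ne hab.ne'⟩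
  have hcont : ContinuousOn (tylerObj u) Q := by
    have hnc : ∀ t, Continuous fun T : Matrix (Fin k) (Fin k) ℝ =>
        ‖Matrix.toEuclideanLin T (u t)‖ ^ 2 := by
      intro t
      simp only [EuclideanSpace.real_norm_sq_eq, ofLp_toEuclideanLin]
      refine continuous_finsetSum _ fun a _ => Continuous.pow ?_ 2
      have e : (fun T : Matrix (Fin k) (Fin k) ℝ => (T *ᵥ (u t).ofLp) a)
          = fun T => ∑ b, T a b * (u t).ofLp b := rfl
      rw [e]
      exact continuous_finsetSum _ fun b _ => (hel a b).mul continuous_const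
    refine ContinuousOn.sub (continuousOn_const.mul (continuousOn_const.mul
      (continuousOn_finsetSum _ fun t _ => (hnc t).continuousOn.log fun T hT => ?_)))
      (continuousOn_const.mul (continuousOn_finsetSum _ fun a _ =>
        (hel a a).continuousOn.log fun T hT => ((hQu T hT).2 a).ne'))
    exact pow_ne_zero 2 (norm_ne_zero_iff.2
      (toEuclideanLin_ne_zero (hQu T hT).det_pos.ne' (hu0 t)))
  obtain ⟨T₀, hT₀Q, hT₀⟩ := hQc.exists_isMinOn ⟨1, h1Q⟩ hcont
  have hT₀u := hQu T₀ hT₀Q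
  have hobj : tylerObj u T₀ ≤ 0 := by
    refine (hT₀ h1Q).trans ?_
    simp [tylerObj, hu]
  obtain ⟨b, lam, hb, hdet⟩ := exists_spectral T₀
  have hlam := spectral_eq_norm_sq hb
  have hbn : ∀ j, |‖Matrix.toEuclideanLin T₀ (b j)‖ - 1| ≤ 1 / 2 := by
    intro j
    have := abs_norm_toEuclideanLin_sub_le hT₀Q.1 (b j)
    rw [b.orthonormal.1 j] at this
    linarith
  have hlo : ∀ j, 1 / 4 ≤ lam j := fun j => by
    rw [hlam]; nlinarith [(abs_le.1 (hbn j)).1]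
  have hhi : ∀ j, lam j ≤ 4 := fun j => by
    rw [hlam]
    nlinarith [(abs_le.1 (hbn j)).2, norm_nonneg (Matrix.toEuclideanLin T₀ (b j))]
  have : Nonempty (Fin k) := ⟨⟨0, hk⟩⟩
  obtain ⟨j, hj⟩ := Finite.exists_min lam
  obtain ⟨l, hl⟩ := Finite.exists_max lam
  have hΔ := tylerObj_spread_le hu hκ h2 h4 hT₀u hobj hb hdet hlo hhi j l hj hl
  have hΔ' : √(lam l) - √(lam j) ≤ x / 2 := by
    refine hΔ.trans_eq ?_
    field_simp; ring
  have hs : 1 / 2 ≤ √(lam j) := Real.le_sqrt_of_sq_le (by linarith [hlo j])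
  have hs0 : 0 < √(lam j) := by linarith
  set T₁ := (√(lam j))⁻¹ • T₀ with hT₁
  have hT₁u : IsUpperPos T₁ := ⟨fun a c hac => by simp [hT₁, hT₀u.1 a c hac],
    fun a => by simpa [hT₁] using mul_pos (inv_pos.2 hs0) (hT₀u.2 a)⟩
  have hratio : ∀ i, |(lam j)⁻¹ * lam i - 1| ≤ δ := by
    intro i
    have hlj : 0 < lam j := by linarith [hlo j]
    have g1 : 1 ≤ (lam j)⁻¹ * lam i := by
      rw [inv_mul_eq_div, one_le_div hlj]; exact hj i
    have g2 : lam i ≤ lam j * (1 + x) ^ 2 := by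
      have g3 : √(lam i) ≤ √(lam j) * (1 + x) := by
        have := Real.sqrt_le_sqrt (hl i)
        nlinarith
      calc lam i = √(lam i) ^ 2 := (Real.sq_sqrt (by linarith [hlo i])).symm
        _ ≤ (√(lam j) * (1 + x)) ^ 2 := pow_le_pow_left₀ (Real.sqrt_nonneg _) g3 2
        _ = _ := by rw [mul_pow, Real.sq_sqrt hlj.le]
    have g4 : (lam j)⁻¹ * lam i ≤ (1 + x) ^ 2 := by
      rw [inv_mul_le_iff₀ hlj]; exact g2
    rw [abs_of_nonneg (by linarith)]
    have g5 : x ≤ 1 := min_le_left _ _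
    have g6 : x ≤ δ / 3 := min_le_right _ _
    nlinarith
  have hclose : ∀ a c, |(T₁ᵀ * T₁) a c - (1 : Matrix (Fin k) (Fin k) ℝ) a c| ≤ δ := by
    intro a c
    have e1 : (T₁ᵀ * T₁) a c = (lam j)⁻¹ * (T₀ᵀ * T₀) a c := by
      rw [hT₁, Matrix.transpose_smul, Matrix.smul_mul, Matrix.mul_smul, smul_smul, ← mul_inv,
        Real.mul_self_sqrt (by linarith [hlo j]), Matrix.smul_apply, smul_eq_mul]
    have e2 : (1 : Matrix (Fin k) (Fin k) ℝ) a c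
        = ∑ i, ⟪b i, EuclideanSpace.single a 1⟫ * ⟪b i, EuclideanSpace.single c 1⟫ := by
      have := b.sum_inner_mul_inner (EuclideanSpace.single a (1 : ℝ)) (EuclideanSpace.single c 1)
      rw [Finset.sum_congr rfl fun i _ => by rw [real_inner_comm (b i)]] at this
      rw [this]
      simp [inner_eq_dotProduct, Matrix.one_apply, Pi.single_apply, eq_comm]
    rw [e1, transpose_mul_self_apply, hb, e2, Finset.mul_sum, ← Finset.sum_sub_distrib]
    have e3 : ∀ v w : EuclideanSpace ℝ (Fin k), ‖v‖ = 1 → ‖w‖ = 1 →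
        |∑ i, ((lam j)⁻¹ * (lam i * (⟪b i, v⟫ * ⟪b i, w⟫)) - ⟪b i, v⟫ * ⟪b i, w⟫)| ≤ δ := by
      intro v w hv hw
      calc |∑ i, ((lam j)⁻¹ * (lam i * (⟪b i, v⟫ * ⟪b i, w⟫)) - ⟪b i, v⟫ * ⟪b i, w⟫)|
          ≤ ∑ i, |(lam j)⁻¹ * (lam i * (⟪b i, v⟫ * ⟪b i, w⟫)) - ⟪b i, v⟫ * ⟪b i, w⟫| :=
            Finset.abs_sum_le_sum_abs _ _
        _ ≤ ∑ i, δ * ((⟪b i, v⟫ ^ 2 + ⟪b i, w⟫ ^ 2) / 2) := by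
            refine Finset.sum_le_sum fun i _ => ?_
            have : (lam j)⁻¹ * (lam i * (⟪b i, v⟫ * ⟪b i, w⟫)) - ⟪b i, v⟫ * ⟪b i, w⟫
              = ((lam j)⁻¹ * lam i - 1) * (⟪b i, v⟫ * ⟪b i, w⟫) := by ring
            rw [this, abs_mul]
            refine mul_le_mul (hratio i) ?_ (abs_nonneg _) hδ.le
            rw [abs_le]
            constructor <;> nlinarith [sq_nonneg (⟪b i, v⟫ + ⟪b i, w⟫),
              sq_nonneg (⟪b i, v⟫ - ⟪b i, w⟫)]
        _ = δ := by
            rw [← Finset.mul_sum, ← Finset.sum_div, Finset.sum_add_distrib, sum_sq_inner_basis,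
              sum_sq_inner_basis, hv, hw]
            norm_num
    exact e3 _ _ (by simp) (by simp)
  have hnear := hchol T₁ hT₁u hclose
  refine ⟨T₁, hT₁u, fun a c => (hnear a c).trans_le (min_le_left _ _), ?_⟩
  refine tylerEq_of_eventually_le hk hu0 hT₁u fun a c hac => ?_
  have hev : ∀ a' c', ∀ᶠ s : ℝ in 𝓝 0,
      |((1 + Matrix.single a c s) * T₁) a' c' - (1 : Matrix (Fin k) (Fin k) ℝ) a' c'| < r := by
    intro a' c'
    have e1 : ∀ s : ℝ, ((1 + Matrix.single a c s) * T₁) a' c'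
        = T₁ a' c' + s * (if a' = a then T₁ c c' else 0) := by
      intro s
      rw [Matrix.add_mul, Matrix.one_mul, Matrix.add_apply]
      by_cases h : a' = a
      · subst h; simp
      · simp [h]
    have hc : Continuous fun s : ℝ =>
        |((1 + Matrix.single a c s) * T₁) a' c' - (1 : Matrix (Fin k) (Fin k) ℝ) a' c'| := by
      simp only [e1]; fun_prop
    refine hc.continuousAt.eventually_lt continuousAt_const ?_
    simpa using hnear a' c'
  -- For small `s` the perturbation of `T₁` remains in the box, where `T₀`, and so `T₁`, attains the
  -- minimum.
  filter_upwards [eventually_all.2 fun a' => eventually_all.2 fun c' => hev a' c'] with s hs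
  rw [hT₁, tylerObj_smul hu0 hT₀u (inv_pos.2 hs0), ← hT₁]
  refine hT₀ ⟨fun a' c' => (hs a' c').le, fun a' c' h => ?_⟩
  rw [Matrix.add_mul, Matrix.one_mul, Matrix.add_apply, hT₁u.1 a' c' h, zero_add]
  by_cases h' : a' = a
  · subst h'; simp [hT₁u.1 c c' (lt_of_lt_of_le h hac)]
  · simp [h']

/-! ### The radial distribution function -/

theorem IsRadialDensity.radialMoment_pos {k : ℕ} {f : ℝ → ℝ} (hf : IsRadialDensity k f) :
    0 < radialMoment (k - 1) f := by
  rw [radialMoment, setIntegral_pos_iff_support_of_nonneg_ae _ hf.integrable]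
  · have h : ∀ᵐ r ∂(volume.restrict (Ioi (0 : ℝ))),
        r ∈ Function.support (fun r => r ^ (k - 1) * f r) := by
      filter_upwards [hf.pos_ae, ae_restrict_mem measurableSet_Ioi] with r hr hr0
      exact (mul_pos (pow_pos hr0 _) hr).ne'
    have h1 : volume.restrict (Ioi (0 : ℝ)) (Function.support (fun r => r ^ (k - 1) * f r))
        = volume.restrict (Ioi (0 : ℝ)) univ :=
      measure_congr (by filter_upwards [h] with r hr; exact eq_true hr)
    rw [Measure.restrict_apply' measurableSet_Ioi] at h1
    rw [h1]
    simp
  · filter_upwards [ae_restrict_mem measurableSet_Ioi] with r hr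
    exact mul_nonneg (pow_nonneg (le_of_lt hr) _) (hf.nonneg r hr)

theorem radialPdf_eq_indicator (k : ℕ) (f : ℝ → ℝ) :
    radialPdf k f = (Ioi (0 : ℝ)).indicator
      fun r => (radialMoment (k - 1) f)⁻¹ * (r ^ (k - 1) * f r) := by
  ext r
  simp [radialPdf, indicator_apply]

theorem IsRadialDensity.integrable_radialPdf {k : ℕ} {f : ℝ → ℝ} (hf : IsRadialDensity k f) :
    Integrable (radialPdf k f) := by
  rw [radialPdf_eq_indicator]
  exact (integrable_indicator_iff measurableSet_Ioi).2 (hf.integrable.const_mul _)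

theorem IsRadialDensity.integral_radialPdf {k : ℕ} {f : ℝ → ℝ} (hf : IsRadialDensity k f) :
    ∫ r, radialPdf k f r = 1 := by
  rw [radialPdf_eq_indicator, integral_indicator measurableSet_Ioi, integral_const_mul]
  exact inv_mul_cancel₀ hf.radialMoment_pos.ne'

theorem IsRadialDensity.radialPdf_nonneg {k : ℕ} {f : ℝ → ℝ} (hf : IsRadialDensity k f) (r : ℝ) :
    0 ≤ radialPdf k f r := by
  rw [radialPdf]
  split_ifs with h
  · exact mul_nonneg (inv_nonneg.2 hf.radialMoment_pos.le)
      (mul_nonneg (pow_nonneg h.le _) (hf.nonneg r h))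
  · exact le_rfl

theorem IsRadialDensity.radialPdf_pos_ae {k : ℕ} {f : ℝ → ℝ} (hf : IsRadialDensity k f) :
    ∀ᵐ r ∂(volume.restrict (Ioi (0 : ℝ))), 0 < radialPdf k f r := by
  filter_upwards [hf.pos_ae, ae_restrict_mem measurableSet_Ioi] with r hr hr0
  rw [radialPdf, if_pos (show 0 < r from hr0)]
  exact mul_pos (inv_pos.2 hf.radialMoment_pos) (mul_pos (pow_pos hr0 _) hr)

theorem radialCdf_zero {k : ℕ} {f : ℝ → ℝ} : radialCdf k f 0 = 0 := by
  rw [radialCdf]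
  refine setIntegral_eq_zero_of_forall_eq_zero fun r hr => ?_
  rw [radialPdf, if_neg (not_lt.2 hr)]

theorem IsRadialDensity.radialCdf_sub {k : ℕ} {f : ℝ → ℝ} (hf : IsRadialDensity k f) (x y : ℝ) :
    radialCdf k f y - radialCdf k f x = ∫ r in x..y, radialPdf k f r :=
  intervalIntegral.integral_Iic_sub_Iic hf.integrable_radialPdf.integrableOn
    hf.integrable_radialPdf.integrableOn

theorem IsRadialDensity.continuous_radialCdf {k : ℕ} {f : ℝ → ℝ} (hf : IsRadialDensity k f) :
    Continuous (radialCdf k f) := by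
  have h : radialCdf k f = fun y => ∫ r in (0 : ℝ)..y, radialPdf k f r := by
    ext y
    rw [← hf.radialCdf_sub, radialCdf_zero, sub_zero]
  rw [h]
  exact intervalIntegral.continuous_primitive
    (fun _ _ => hf.integrable_radialPdf.intervalIntegrable) 0

theorem IsRadialDensity.monotone_radialCdf {k : ℕ} {f : ℝ → ℝ} (hf : IsRadialDensity k f) :
    Monotone (radialCdf k f) := by
  intro x y hxy
  rw [← sub_nonneg, hf.radialCdf_sub]
  exact intervalIntegral.integral_nonneg hxy fun r _ => hf.radialPdf_nonneg r

/-- Almost everywhere positivity of `f` rules out flat stretches. This is what separates the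
quantiles in `rank_close`. -/
theorem IsRadialDensity.strictMonoOn_radialCdf {k : ℕ} {f : ℝ → ℝ} (hf : IsRadialDensity k f) :
    StrictMonoOn (radialCdf k f) (Ici 0) := by
  intro x hx y _ hxy
  rw [← sub_pos, hf.radialCdf_sub, intervalIntegral.integral_of_le hxy.le,
    setIntegral_pos_iff_support_of_nonneg_ae (ae_of_all _ hf.radialPdf_nonneg)
      hf.integrable_radialPdf.integrableOn]
  have hsub : Ioc x y ⊆ Ioi 0 := fun r hr => lt_of_le_of_lt hx hr.1
  have h : ∀ᵐ r ∂(volume.restrict (Ioc x y)), r ∈ Function.support (radialPdf k f) := by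
    filter_upwards [ae_restrict_of_ae_restrict_of_subset hsub hf.radialPdf_pos_ae] with r hr
    exact hr.ne'
  have h1 : volume.restrict (Ioc x y) (Function.support (radialPdf k f))
      = volume.restrict (Ioc x y) univ :=
    measure_congr (by filter_upwards [h] with r hr; exact eq_true hr)
  rw [Measure.restrict_apply' measurableSet_Ioc] at h1
  rw [h1]
  simpa using hxy

theorem IsRadialDensity.tendsto_radialCdf {k : ℕ} {f : ℝ → ℝ} (hf : IsRadialDensity k f) :
    Tendsto (radialCdf k f) atTop (𝓝 1) := by
  rw [← hf.integral_radialPdf]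
  exact (aecover_Iic tendsto_id).integral_tendsto_of_countably_generated hf.integrable_radialPdf

theorem IsRadialDensity.radialCdf_mem {k : ℕ} {f : ℝ → ℝ} (hf : IsRadialDensity k f) {x : ℝ}
    (hx : 0 < x) : radialCdf k f x ∈ Ioo (0 : ℝ) 1 := by
  constructor
  · rw [← radialCdf_zero (k := k) (f := f)]
    exact hf.strictMonoOn_radialCdf self_mem_Ici hx.le hx
  · have h1 : radialCdf k f x < radialCdf k f (x + 1) :=
      hf.strictMonoOn_radialCdf hx.le (by simp; linarith) (by linarith)
    exact h1.trans_le (hf.monotone_radialCdf.ge_of_tendsto hf.tendsto_radialCdf _)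

theorem IsRadialDensity.exists_radialCdf_eq {k : ℕ} {f : ℝ → ℝ} (hf : IsRadialDensity k f) {a : ℝ}
    (ha : a ∈ Ico (0 : ℝ) 1) : ∃ x, 0 ≤ x ∧ radialCdf k f x = a := by
  obtain ⟨y, hy, hy0⟩ := ((hf.tendsto_radialCdf.eventually (lt_mem_nhds ha.2)).and
    (eventually_ge_atTop 0)).exists
  obtain ⟨x, hx, hxa⟩ := intermediate_value_Icc hy0 hf.continuous_radialCdf.continuousOn
    ⟨by rw [radialCdf_zero]; exact ha.1, hy.le⟩
  exact ⟨x, hx.1, hxa⟩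

/-! ### The whitened noise -/

theorem map_withDensity_comp {α β : Type*} [MeasurableSpace α] [MeasurableSpace β]
    (μ : Measure α) {T : α → β} (hT : Measurable T) {g : β → ENNReal} (hg : Measurable g) :
    (μ.withDensity fun x => g (T x)).map T = (μ.map T).withDensity g := by
  ext s hs
  rw [Measure.map_apply hT hs, withDensity_apply _ (hT hs), withDensity_apply _ hs,
    setLIntegral_map hs hg hT]

theorem invSqrt_spec {k : ℕ} {Sig : Matrix (Fin k) (Fin k) ℝ} (hSig : Sig.PosDef) :
    IsUpperPos (invSqrt Sig) ∧ (invSqrt Sig)ᵀ * invSqrt Sig = Sig⁻¹ :=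
  (invSqrt_eq_iff hSig _).1 rfl

theorem dotProduct_transpose_mul_self {k : ℕ} (S : Matrix (Fin k) (Fin k) ℝ)
    (z : EuclideanSpace ℝ (Fin k)) :
    √(z.ofLp ⬝ᵥ ((Sᵀ * S) *ᵥ z.ofLp)) = ‖Matrix.toEuclideanLin S z‖ := by
  rw [← ofLp_toEuclideanLin, ← inner_eq_dotProduct, toEuclideanLin_mul_apply,
    ← inner_toEuclideanLin_left, real_inner_self_eq_norm_sq, Real.sqrt_sq (norm_nonneg _)]

theorem scatterNorm_eq {k : ℕ} {Sig : Matrix (Fin k) (Fin k) ℝ} (hSig : Sig.PosDef)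
    (z : EuclideanSpace ℝ (Fin k)) :
    scatterNorm Sig z = ‖Matrix.toEuclideanLin (invSqrt Sig) z‖ := by
  rw [scatterNorm, ← (invSqrt_spec hSig).2, dotProduct_transpose_mul_self]

theorem measurable_toEuclideanLin {k : ℕ} (M : Matrix (Fin k) (Fin k) ℝ) :
    Measurable fun z : EuclideanSpace ℝ (Fin k) => Matrix.toEuclideanLin M z :=
  (LinearMap.continuous_of_finiteDimensional _).measurable

theorem det_toEuclideanLin {k : ℕ} (M : Matrix (Fin k) (Fin k) ℝ) :
    LinearMap.det (Matrix.toEuclideanLin M) = M.det := by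
  rw [Matrix.toEuclideanLin_eq_toLin_orthonormal, LinearMap.det_toLin]

/-- The part of a radial function that matters. -/
def radialPart (f : ℝ → ℝ) : ℝ → ℝ := (Ioi (0 : ℝ)).indicator f

theorem IsRadialDensity.measurable_radialPart {k : ℕ} {f : ℝ → ℝ} (hf : IsRadialDensity k f) :
    Measurable (radialPart f) := hf.measurable.indicator measurableSet_Ioi

theorem IsRadialDensity.radialPart_nonneg {k : ℕ} {f : ℝ → ℝ} (hf : IsRadialDensity k f) (r : ℝ) :
    0 ≤ radialPart f r := indicator_nonneg (fun _ h => hf.nonneg _ h) r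

theorem ellipticLaw_ac {k : ℕ} (Sig : Matrix (Fin k) (Fin k) ℝ) (f : ℝ → ℝ) :
    ellipticLaw Sig f ≪ volume := withDensity_absolutelyContinuous _ _

/-- The law of the whitened noise is spherical. -/
theorem exists_map_ellipticLaw_eq {k : ℕ} (hk : 1 ≤ k) {Sig : Matrix (Fin k) (Fin k) ℝ}
    (hSig : Sig.PosDef) {f : ℝ → ℝ} (hf : IsRadialDensity k f) :
    ∃ c : ENNReal, (ellipticLaw Sig f).map (fun z => Matrix.toEuclideanLin (invSqrt Sig) z)
      = c • (volume : Measure (EuclideanSpace ℝ (Fin k))).withDensity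
          fun v => ENNReal.ofReal (radialPart f ‖v‖) := by
  have : Nonempty (Fin k) := ⟨⟨0, hk⟩⟩
  have hS := (invSqrt_spec hSig).1.det_pos.ne'
  set S := invSqrt Sig with hSdef
  set C : ℝ := (sphereArea k * radialMoment (k - 1) f)⁻¹ * (√Sig.det)⁻¹ with hC
  have hC0 : 0 ≤ C := by
    refine mul_nonneg (inv_nonneg.2 (mul_nonneg ?_ hf.radialMoment_pos.le))
      (inv_nonneg.2 (Real.sqrt_nonneg _))
    exact ENNReal.toReal_nonneg
  have hg : Measurable fun v : EuclideanSpace ℝ (Fin k) =>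
      ENNReal.ofReal (radialPart f ‖v‖) :=
    (hf.measurable_radialPart.comp measurable_norm).ennreal_ofReal
  have h1 : ellipticLaw Sig f = ENNReal.ofReal C • volume.withDensity
      fun z => ENNReal.ofReal (radialPart f ‖Matrix.toEuclideanLin S z‖) := by
    have hg' : Measurable fun z => ENNReal.ofReal (radialPart f ‖Matrix.toEuclideanLin S z‖) :=
      hg.comp (measurable_toEuclideanLin S)
    rw [ellipticLaw, ← withDensity_smul _ hg']
    refine withDensity_congr_ae ?_
    -- The density at the origin involves `f 0`, about which nothing is assumed; the origin is null
    -- because `k ≥ 1`.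
    filter_upwards [Measure.ae_ne volume (0 : EuclideanSpace ℝ (Fin k))] with z hz
    have hn : 0 < ‖Matrix.toEuclideanLin S z‖ := norm_pos_iff.2 (toEuclideanLin_ne_zero hS hz)
    rw [Pi.smul_apply, smul_eq_mul, ← ENNReal.ofReal_mul hC0, ellipticDensity,
      scatterNorm_eq hSig, ← hSdef, radialPart, indicator_of_mem (by exact hn)]
  refine ⟨ENNReal.ofReal C * ENNReal.ofReal |(LinearMap.det (Matrix.toEuclideanLin S))⁻¹|, ?_⟩
  rw [h1, Measure.map_smul,
    map_withDensity_comp volume (measurable_toEuclideanLin S) hg]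
  have h2 : (volume : Measure (EuclideanSpace ℝ (Fin k))).map
      (fun z => Matrix.toEuclideanLin S z)
      = ENNReal.ofReal |(LinearMap.det (Matrix.toEuclideanLin S))⁻¹| • volume :=
    Measure.map_linearMap_addHaar_eq_smul_addHaar volume (by rwa [det_toEuclideanLin])
  rw [h2, withDensity_smul_measure, smul_smul]

/-- The law of the whitened noise is invariant under linear isometries. -/
theorem map_isometry_map_ellipticLaw {k : ℕ} (hk : 1 ≤ k) {Sig : Matrix (Fin k) (Fin k) ℝ}
    (hSig : Sig.PosDef) {f : ℝ → ℝ} (hf : IsRadialDensity k f)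
    (L : EuclideanSpace ℝ (Fin k) ≃ₗᵢ[ℝ] EuclideanSpace ℝ (Fin k)) :
    ((ellipticLaw Sig f).map (fun z => Matrix.toEuclideanLin (invSqrt Sig) z)).map L
      = (ellipticLaw Sig f).map (fun z => Matrix.toEuclideanLin (invSqrt Sig) z) := by
  obtain ⟨c, hc⟩ := exists_map_ellipticLaw_eq hk hSig hf
  have hg : Measurable fun v : EuclideanSpace ℝ (Fin k) =>
      ENNReal.ofReal (radialPart f ‖v‖) :=
    (hf.measurable_radialPart.comp measurable_norm).ennreal_ofReal
  have h := map_withDensity_comp (volume : Measure (EuclideanSpace ℝ (Fin k)))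
    L.continuous.measurable hg
  simp only [L.norm_map] at h
  rw [hc, Measure.map_smul, h, L.measurePreserving.map_eq]

theorem measurePreserving_neg_ellipticLaw {k : ℕ} (Sig : Matrix (Fin k) (Fin k) ℝ)
    {f : ℝ → ℝ} (hf : IsRadialDensity k f) :
    MeasurePreserving (fun z : EuclideanSpace ℝ (Fin k) => -z)
      (ellipticLaw Sig f) (ellipticLaw Sig f) := by
  refine ⟨measurable_neg, ?_⟩
  have hcont : Continuous fun z : EuclideanSpace ℝ (Fin k) => scatterNorm Sig z := by
    unfold scatterNorm
    refine Real.continuous_sqrt.comp ?_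
    have : Continuous fun z : EuclideanSpace ℝ (Fin k) => z.ofLp := PiLp.continuous_ofLp 2 _
    exact this.dotProduct (continuous_const.matrix_mulVec this)
  have hg : Measurable fun z : EuclideanSpace ℝ (Fin k) =>
      ENNReal.ofReal (ellipticDensity Sig f z) :=
    ((hf.measurable.comp hcont.measurable).const_mul _).ennreal_ofReal
  have h := map_withDensity_comp (volume : Measure (EuclideanSpace ℝ (Fin k)))
    measurable_neg hg
  have e : ∀ z : EuclideanSpace ℝ (Fin k), ellipticDensity Sig f (-z) = ellipticDensity Sig f z := by
    intro z
    simp [ellipticDensity, scatterNorm, Matrix.mulVec_neg]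
  simp only [e] at h
  rw [ellipticLaw, h]
  congr 1
  exact (Measure.measurePreserving_neg volume).map_eq

/-- Polar coordinates give the law of the radius up to a constant factor. The factor need not be
computed: total mass one determines it. -/
theorem ellipticLaw_scatterNorm_le {k : ℕ} (hk : 1 ≤ k) {Sig : Matrix (Fin k) (Fin k) ℝ}
    (hSig : Sig.PosDef) {f : ℝ → ℝ} (hf : IsRadialDensity k f)
    [IsProbabilityMeasure (ellipticLaw Sig f)] (x : ℝ) :
    ellipticLaw Sig f {z | scatterNorm Sig z ≤ x} = ENNReal.ofReal (radialCdf k f x) := by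
  have : Nonempty (Fin k) := ⟨⟨0, hk⟩⟩
  obtain ⟨c, hc⟩ := exists_map_ellipticLaw_eq hk hSig hf
  have hfin : Module.finrank ℝ (EuclideanSpace ℝ (Fin k)) = k := by simp
  set b : ℝ := k * (volume : Measure (EuclideanSpace ℝ (Fin k))).real (Metric.ball 0 1) with hb
  have hb0 : 0 ≤ b := by positivity
  set m := radialMoment (k - 1) f with hm
  have hm0 : 0 < m := hf.radialMoment_pos
  have key : ∀ s : Set ℝ, MeasurableSet s →
      ellipticLaw Sig f {z | scatterNorm Sig z ∈ s}
        = c * ENNReal.ofReal (b * (m * ∫ r in s, radialPdf k f r)) := by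
    intro s hs
    have hs' : MeasurableSet {v : EuclideanSpace ℝ (Fin k) | ‖v‖ ∈ s} := measurable_norm hs
    have e1 : ellipticLaw Sig f {z | scatterNorm Sig z ∈ s}
        = (ellipticLaw Sig f).map (fun z => Matrix.toEuclideanLin (invSqrt Sig) z)
          {v | ‖v‖ ∈ s} := by
      rw [Measure.map_apply (measurable_toEuclideanLin _) hs']
      simp only [preimage_ofPred_eq, scatterNorm_eq hSig]
    have hpos : ∀ r, 0 ≤ s.indicator (radialPart f) r := fun r =>
      indicator_nonneg (fun r _ => hf.radialPart_nonneg r) r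
    have e2 : ∀ y ∈ Ioi (0 : ℝ), y ^ (k - 1) • s.indicator (radialPart f) y
        = m * s.indicator (radialPdf k f) y := by
      intro y hy
      by_cases h : y ∈ s
      · simp only [indicator_of_mem h, radialPart, indicator_of_mem hy, radialPdf, if_pos (show 0 < y from hy),
          smul_eq_mul, ← hm]
        field_simp
      · simp [h]
    have hint : Integrable (fun v : EuclideanSpace ℝ (Fin k) =>
        s.indicator (radialPart f) ‖v‖) := by
      rw [integrable_fun_norm_addHaar volume (f := s.indicator (radialPart f)), hfin]
      refine IntegrableOn.congr_fun ?_ (fun y hy => (e2 y hy).symm) measurableSet_Ioi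
      exact ((hf.integrable_radialPdf.indicator hs).const_mul m).integrableOn
    rw [e1, hc, Measure.smul_apply, smul_eq_mul, withDensity_apply _ hs',
      ← lintegral_indicator hs']
    congr 1
    have e3 : ∀ v : EuclideanSpace ℝ (Fin k),
        {v : EuclideanSpace ℝ (Fin k) | ‖v‖ ∈ s}.indicator
          (fun v => ENNReal.ofReal (radialPart f ‖v‖)) v
        = ENNReal.ofReal (s.indicator (radialPart f) ‖v‖) := by
      intro v
      by_cases h : ‖v‖ ∈ s <;> simp [h]
    simp only [e3]
    rw [← ofReal_integral_eq_lintegral_ofReal hint (ae_of_all _ fun v => hpos _),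
      integral_fun_norm_addHaar volume (s.indicator (radialPart f)), hfin,
      setIntegral_congr_fun measurableSet_Ioi e2, integral_const_mul]
    congr 1
    have e4 : ∫ y in Ioi (0 : ℝ), s.indicator (radialPdf k f) y = ∫ r in s, radialPdf k f r := by
      rw [← integral_indicator hs, setIntegral_eq_integral_of_forall_compl_eq_zero]
      intro y hy
      simp [radialPdf, show ¬ 0 < y from hy]
    rw [e4, nsmul_eq_mul, smul_eq_mul, hb, mul_assoc]
  have h1 := key univ MeasurableSet.univ
  simp only [mem_univ, ofPred_true, measure_univ, Measure.restrict_univ, hf.integral_radialPdf,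
    mul_one] at h1
  have h2 := key (Iic x) measurableSet_Iic
  rw [show b * (m * ∫ r in Iic x, radialPdf k f r) = b * m * radialCdf k f x by
    rw [radialCdf]; ring, ENNReal.ofReal_mul (by positivity), ← mul_assoc, ← h1, one_mul] at h2
  exact h2

theorem measurable_scatterNorm {k : ℕ} {Sig : Matrix (Fin k) (Fin k) ℝ} (hSig : Sig.PosDef) :
    Measurable fun z : EuclideanSpace ℝ (Fin k) => scatterNorm Sig z := by
  simp only [scatterNorm_eq hSig]
  exact (measurable_toEuclideanLin _).norm

/-- The probability integral transform of the radial part of the noise is uniform. -/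
theorem map_radialCdf_ellipticLaw {k : ℕ} (hk : 1 ≤ k) {Sig : Matrix (Fin k) (Fin k) ℝ}
    (hSig : Sig.PosDef) {f : ℝ → ℝ} (hf : IsRadialDensity k f)
    [IsProbabilityMeasure (ellipticLaw Sig f)] :
    (ellipticLaw Sig f).map (fun z => radialCdf k f (scatterNorm Sig z))
      = volume.restrict (Ioo (0 : ℝ) 1) := by
  have hmeas : Measurable fun z => radialCdf k f (scatterNorm Sig z) :=
    hf.continuous_radialCdf.measurable.comp (measurable_scatterNorm hSig)
  have hd0 : ∀ z, 0 ≤ scatterNorm Sig z := fun z => Real.sqrt_nonneg _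
  have : IsProbabilityMeasure ((ellipticLaw Sig f).map
      (fun z => radialCdf k f (scatterNorm Sig z))) :=
    Measure.isProbabilityMeasure_map hmeas.aemeasurable
  refine Measure.ext_of_Iic _ _ fun a => ?_
  rw [Measure.map_apply hmeas measurableSet_Iic, Measure.restrict_apply measurableSet_Iic]
  have hF : ∀ z, radialCdf k f (scatterNorm Sig z) ∈ Ico (0 : ℝ) 1 := by
    intro z
    rcases (hd0 z).eq_or_lt with h | h
    · rw [← h, radialCdf_zero]; simp
    · exact ⟨(hf.radialCdf_mem h).1.le, (hf.radialCdf_mem h).2⟩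
  rcases lt_or_ge a 0 with ha | ha
  · have e1 : (fun z => radialCdf k f (scatterNorm Sig z)) ⁻¹' Iic a = ∅ := by
      ext z
      simp only [mem_preimage, mem_Iic, mem_empty_iff_false, iff_false, not_le]
      exact ha.trans_le (hF z).1
    have e2 : Iic a ∩ Ioo (0 : ℝ) 1 = ∅ := by
      ext z
      simp only [mem_inter_iff, mem_Iic, mem_Ioo, mem_empty_iff_false, iff_false]
      rintro ⟨h1, h2, -⟩
      linarith
    simp [e1, e2]
  rcases lt_or_ge a 1 with ha1 | ha1
  · obtain ⟨x, hx0, hx⟩ := hf.exists_radialCdf_eq ⟨ha, ha1⟩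
    have e1 : (fun z => radialCdf k f (scatterNorm Sig z)) ⁻¹' Iic a
        = {z | scatterNorm Sig z ≤ x} := by
      ext z
      simp only [mem_preimage, mem_Iic, mem_ofPred_eq, ← hx]
      exact hf.strictMonoOn_radialCdf.le_iff_le (hd0 z) hx0
    have e2 : Iic a ∩ Ioo (0 : ℝ) 1 = Ioc 0 a := by
      ext z
      simp only [mem_inter_iff, mem_Iic, mem_Ioo, mem_Ioc]
      constructor
      · rintro ⟨h1, h2, -⟩; exact ⟨h2, h1⟩
      · rintro ⟨h1, h2⟩; exact ⟨h2, h1, h2.trans_lt ha1⟩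
    rw [e1, ellipticLaw_scatterNorm_le hk hSig hf, e2, hx, Real.volume_Ioc, sub_zero]
  · have e1 : (fun z => radialCdf k f (scatterNorm Sig z)) ⁻¹' Iic a = univ := by
      ext z
      simp only [mem_preimage, mem_Iic, mem_univ, iff_true]
      exact (hF z).2.le.trans ha1
    have e2 : Iic a ∩ Ioo (0 : ℝ) 1 = Ioo 0 1 := by
      refine inter_eq_right.2 fun z hz => hz.2.le.trans ha1
    rw [e1, e2, measure_univ, Real.volume_Ioo]
    norm_num

/-! ### Moments of the directions of the noise -/

theorem measurable_direction {k : ℕ} (M : Matrix (Fin k) (Fin k) ℝ) :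
    Measurable fun z : EuclideanSpace ℝ (Fin k) => direction M z :=
  (measurable_toEuclideanLin M).norm.inv.smul (measurable_toEuclideanLin M)

theorem abs_apply_le_norm {k : ℕ} (v : EuclideanSpace ℝ (Fin k)) (a : Fin k) :
    |v.ofLp a| ≤ ‖v‖ := by
  simpa using PiLp.norm_apply_le v a

theorem measurable_ofLp_apply {k : ℕ} (a : Fin k) :
    Measurable fun v : EuclideanSpace ℝ (Fin k) => v.ofLp a := by
  fun_prop

theorem inner_eq_sum {k : ℕ} (x y : EuclideanSpace ℝ (Fin k)) :
    ⟪x, y⟫ = ∑ a, x.ofLp a * y.ofLp a := by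
  rw [inner_eq_dotProduct]; rfl

theorem inner_sq_eq_sum {k : ℕ} (x u : EuclideanSpace ℝ (Fin k)) :
    ⟪x, u⟫ ^ 2 = ∑ a, ∑ b, x.ofLp a * x.ofLp b * (u.ofLp a * u.ofLp b) := by
  rw [inner_eq_sum, sq, Finset.sum_mul_sum]
  exact Finset.sum_congr rfl fun a _ => Finset.sum_congr rfl fun b _ => by ring

theorem inner_sq_mul_inner_sq_eq_sum {k : ℕ} (x y u : EuclideanSpace ℝ (Fin k)) :
    ⟪x, u⟫ ^ 2 * ⟪y, u⟫ ^ 2 = ∑ a, ∑ b, ∑ c, ∑ d,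
      x.ofLp a * x.ofLp b * (y.ofLp c * y.ofLp d)
        * (u.ofLp a * u.ofLp b * (u.ofLp c * u.ofLp d)) := by
  rw [inner_sq_eq_sum, inner_sq_eq_sum, Finset.sum_mul]
  refine Finset.sum_congr rfl fun a _ => ?_
  rw [Finset.sum_mul]
  refine Finset.sum_congr rfl fun b _ => ?_
  rw [Finset.mul_sum]
  refine Finset.sum_congr rfl fun c _ => ?_
  rw [Finset.mul_sum]
  exact Finset.sum_congr rfl fun d _ => by ring

section

variable {k : ℕ} {Sig : Matrix (Fin k) (Fin k) ℝ} {f : ℝ → ℝ}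

theorem abs_direction_apply_le (S : Matrix (Fin k) (Fin k) ℝ) (z : EuclideanSpace ℝ (Fin k))
    (a : Fin k) : |(direction S z).ofLp a| ≤ 1 :=
  (abs_apply_le_norm _ a).trans (norm_direction_le S z)

theorem abs_mul_le_one' {x y : ℝ} (hx : |x| ≤ 1) (hy : |y| ≤ 1) : |x * y| ≤ 1 := by
  rw [abs_mul]; exact mul_le_one₀ hx (abs_nonneg _) hy

theorem integrable_of_abs_le {α : Type*} [MeasurableSpace α] {μ : Measure α} [IsFiniteMeasure μ]
    {g : α → ℝ} (hg : Measurable g) {c : ℝ} (hc : ∀ x, |g x| ≤ c) : Integrable g μ :=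
  Integrable.of_bound hg.aestronglyMeasurable c (ae_of_all _ hc)

theorem measurable_direction_mul (S : Matrix (Fin k) (Fin k) ℝ) (a b : Fin k) :
    Measurable fun z : EuclideanSpace ℝ (Fin k) =>
      (direction S z).ofLp a * (direction S z).ofLp b :=
  ((measurable_ofLp_apply a).comp (measurable_direction S)).mul
    ((measurable_ofLp_apply b).comp (measurable_direction S))

theorem ae_ne_zero_ellipticLaw (hk : 1 ≤ k) : ∀ᵐ z ∂(ellipticLaw Sig f), z ≠ 0 := by
  have : Nonempty (Fin k) := ⟨⟨0, hk⟩⟩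
  exact (ellipticLaw_ac Sig f).ae_le (Measure.ae_ne volume (0 : EuclideanSpace ℝ (Fin k)))

/-- By rotation invariance the quadratic form depends on `‖v‖` only, and its values at the `k`
coordinate vectors sum to `1` because the directions are unit vectors. -/
theorem integral_inner_direction_sq (hk : 1 ≤ k) (hSig : Sig.PosDef) (hf : IsRadialDensity k f)
    [IsProbabilityMeasure (ellipticLaw Sig f)] (v : EuclideanSpace ℝ (Fin k)) :
    ∫ z, ⟪v, direction (invSqrt Sig) z⟫ ^ 2 ∂(ellipticLaw Sig f) = ‖v‖ ^ 2 / k := by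
  have hS := (invSqrt_spec hSig).1.det_pos.ne'
  set S := invSqrt Sig with hSdef
  set μ := ellipticLaw Sig f with hμ
  set q : EuclideanSpace ℝ (Fin k) → ℝ := fun v => ∫ z, ⟪v, direction S z⟫ ^ 2 ∂μ with hq
  have hq' : ∀ v, q v = ∫ w, ⟪v, ‖w‖⁻¹ • w⟫ ^ 2
      ∂(μ.map fun z => Matrix.toEuclideanLin S z) := by
    intro v
    rw [integral_map (measurable_toEuclideanLin S).aemeasurable]
    · rfl
    · refine Measurable.aestronglyMeasurable ?_
      have : Measurable fun w : EuclideanSpace ℝ (Fin k) => ‖w‖⁻¹ • w :=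
        measurable_norm.inv.smul measurable_id
      exact (this.const_inner (𝕜 := ℝ)).pow_const 2
  have hinv : ∀ v w : EuclideanSpace ℝ (Fin k), ‖v‖ = ‖w‖ → q v = q w := by
    intro v w hvw
    -- This reflection exchanges `v` and `w`, which have the same length.
    set L := (ℝ ∙ (v - w))ᗮ.reflection with hL
    have hLv : L v = w := Submodule.reflection_sub hvw
    have hLw : L w = v := by rw [← hLv, hL, Submodule.reflection_reflection]
    rw [hq' v, ← map_isometry_map_ellipticLaw hk hSig hf L, integral_map
      L.continuous.measurable.aemeasurable, hq' w]
    · refine integral_congr_ae (ae_of_all _ fun x => ?_)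
      simp only [L.norm_map, inner_smul_right]
      rw [← hLw, L.inner_map_map]
    · refine Measurable.aestronglyMeasurable ?_
      have : Measurable fun w : EuclideanSpace ℝ (Fin k) => ‖w‖⁻¹ • w :=
        measurable_norm.inv.smul measurable_id
      exact (this.const_inner (𝕜 := ℝ)).pow_const 2
  have hqsmul : ∀ (c : ℝ) v, q (c • v) = c ^ 2 * q v := by
    intro c v
    simp only [hq, inner_smul_left, mul_pow]
    simp [integral_const_mul]
  have hqe : ∀ a : Fin k, q (EuclideanSpace.single a 1)
      = ∫ z, (direction S z).ofLp a * (direction S z).ofLp a ∂μ := by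
    intro a
    simp [hq, inner_eq_dotProduct, sq]
  have hz0 : ∀ᵐ z ∂μ, z ≠ 0 := ae_ne_zero_ellipticLaw hk
  have hsum : ∑ a : Fin k, q (EuclideanSpace.single a 1) = 1 := by
    simp only [hqe]
    rw [← integral_finsetSum]
    · have : ∀ᵐ z ∂μ, ∑ a, (direction S z).ofLp a * (direction S z).ofLp a = 1 := by
        filter_upwards [hz0] with z hz
        rw [← inner_eq_sum, real_inner_self_eq_norm_sq, norm_direction hS hz, one_pow]
      rw [integral_congr_ae this]
      simp
    · intro a _
      exact integrable_of_abs_le (measurable_direction_mul S a a) fun z =>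
        abs_mul_le_one' (abs_direction_apply_le S z a) (abs_direction_apply_le S z a)
  have hk0 : (k : ℝ) ≠ 0 := by positivity
  set a₀ : Fin k := ⟨0, hk⟩
  have hqa : q (EuclideanSpace.single a₀ 1) = 1 / k := by
    have : ∀ a : Fin k, q (EuclideanSpace.single a 1) = q (EuclideanSpace.single a₀ 1) :=
      fun a => hinv _ _ (by simp)
    simp only [this, Finset.sum_const, Finset.card_univ, Fintype.card_fin, nsmul_eq_mul] at hsum
    field_simp
    linarith
  calc q v = q (‖v‖ • EuclideanSpace.single a₀ 1) := hinv _ _ (by simp [norm_smul])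
    _ = ‖v‖ ^ 2 / k := by rw [hqsmul, hqa]; ring

theorem ae_inner_direction_ne_zero (hSig : Sig.PosDef) {x : EuclideanSpace ℝ (Fin k)}
    (hx : x ≠ 0) : ∀ᵐ z ∂(ellipticLaw Sig f), ⟪x, direction (invSqrt Sig) z⟫ ≠ 0 := by
  have hS := (invSqrt_spec hSig).1.det_pos.ne'
  set S := invSqrt Sig
  have hxS : Matrix.toEuclideanLin Sᵀ x ≠ 0 :=
    toEuclideanLin_ne_zero (by rwa [Matrix.det_transpose]) hx
  refine (ellipticLaw_ac Sig f).ae_le ?_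
  have h1 : (volume : Measure (EuclideanSpace ℝ (Fin k)))
      (((ℝ ∙ Matrix.toEuclideanLin Sᵀ x)ᗮ : Submodule ℝ (EuclideanSpace ℝ (Fin k))) :
        Set (EuclideanSpace ℝ (Fin k))) = 0 := by
    refine Measure.addHaar_submodule _ _ fun h => hxS ?_
    have : Matrix.toEuclideanLin Sᵀ x ∈ (ℝ ∙ Matrix.toEuclideanLin Sᵀ x)ᗮ := by
      rw [h]; trivial
    rw [Submodule.mem_orthogonal_singleton_iff_inner_right] at this
    exact inner_self_eq_zero.1 this
  have h2 := measure_eq_zero_iff_ae_notMem.1 h1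
  filter_upwards [h2] with z hz
  intro h
  apply hz
  rw [SetLike.mem_coe, Submodule.mem_orthogonal_singleton_iff_inner_right,
    inner_toEuclideanLin_left, Matrix.transpose_transpose]
  rw [direction, inner_smul_right, mul_eq_zero, inv_eq_zero, norm_eq_zero] at h
  rcases h with h | h
  · rw [h, inner_zero_right]
  · exact h

/-- The second and fourth moments of the finite sample `u` are `δ`-close to those of `U`. -/
def MomentsClose (Sig : Matrix (Fin k) (Fin k) ℝ) (f : ℝ → ℝ) {ι : Type*} [Fintype ι] (δ : ℝ)
    (u : ι → EuclideanSpace ℝ (Fin k)) : Prop :=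
  (∀ a b, |(Fintype.card ι : ℝ)⁻¹ * ∑ t, (u t).ofLp a * (u t).ofLp b
    - ∫ z, (direction (invSqrt Sig) z).ofLp a * (direction (invSqrt Sig) z).ofLp b
      ∂(ellipticLaw Sig f)| ≤ δ) ∧
  ∀ a b c d, |(Fintype.card ι : ℝ)⁻¹ * ∑ t, (u t).ofLp a * (u t).ofLp b *
      ((u t).ofLp c * (u t).ofLp d)
    - ∫ z, (direction (invSqrt Sig) z).ofLp a * (direction (invSqrt Sig) z).ofLp b *
      ((direction (invSqrt Sig) z).ofLp c * (direction (invSqrt Sig) z).ofLp d)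
      ∂(ellipticLaw Sig f)| ≤ δ

theorem integral_inner_sq_eq_sum [IsProbabilityMeasure (ellipticLaw Sig f)]
    (S : Matrix (Fin k) (Fin k) ℝ) (x : EuclideanSpace ℝ (Fin k)) :
    ∫ z, ⟪x, direction S z⟫ ^ 2 ∂(ellipticLaw Sig f)
      = ∑ a, ∑ b, x.ofLp a * x.ofLp b * ∫ z, (direction S z).ofLp a * (direction S z).ofLp b
        ∂(ellipticLaw Sig f) := by
  have hi : ∀ a b, Integrable (fun z => x.ofLp a * x.ofLp b *
      ((direction S z).ofLp a * (direction S z).ofLp b)) (ellipticLaw Sig f) := fun a b =>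
    (integrable_of_abs_le (measurable_direction_mul S a b) fun z =>
      abs_mul_le_one' (abs_direction_apply_le S z a) (abs_direction_apply_le S z b)).const_mul _
  simp only [inner_sq_eq_sum]
  rw [integral_finsetSum _ fun a _ => integrable_finsetSum _ fun b _ => hi a b]
  refine Finset.sum_congr rfl fun a _ => ?_
  rw [integral_finsetSum _ fun b _ => hi a b]
  exact Finset.sum_congr rfl fun b _ => integral_const_mul _ _

theorem integral_inner_sq_mul_inner_sq_eq_sum [IsProbabilityMeasure (ellipticLaw Sig f)]
    (S : Matrix (Fin k) (Fin k) ℝ) (x y : EuclideanSpace ℝ (Fin k)) :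
    ∫ z, ⟪x, direction S z⟫ ^ 2 * ⟪y, direction S z⟫ ^ 2 ∂(ellipticLaw Sig f)
      = ∑ a, ∑ b, ∑ c, ∑ d, x.ofLp a * x.ofLp b * (y.ofLp c * y.ofLp d) *
        ∫ z, (direction S z).ofLp a * (direction S z).ofLp b *
          ((direction S z).ofLp c * (direction S z).ofLp d) ∂(ellipticLaw Sig f) := by
  have hi : ∀ a b c d, Integrable (fun z => x.ofLp a * x.ofLp b * (y.ofLp c * y.ofLp d) *
      ((direction S z).ofLp a * (direction S z).ofLp b *
          ((direction S z).ofLp c * (direction S z).ofLp d))) (ellipticLaw Sig f) :=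
    fun a b c d => (integrable_of_abs_le
      ((measurable_direction_mul S a b).mul (measurable_direction_mul S c d)) fun z =>
      abs_mul_le_one' (abs_mul_le_one' (abs_direction_apply_le S z a)
        (abs_direction_apply_le S z b)) (abs_mul_le_one' (abs_direction_apply_le S z c)
        (abs_direction_apply_le S z d))).const_mul _
  simp only [inner_sq_mul_inner_sq_eq_sum]
  rw [integral_finsetSum _ fun a _ => integrable_finsetSum _ fun b _ =>
    integrable_finsetSum _ fun c _ => integrable_finsetSum _ fun d _ => hi a b c d]
  refine Finset.sum_congr rfl fun a _ => ?_
  rw [integral_finsetSum _ fun b _ =>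
    integrable_finsetSum _ fun c _ => integrable_finsetSum _ fun d _ => hi a b c d]
  refine Finset.sum_congr rfl fun b _ => ?_
  rw [integral_finsetSum _ fun c _ => integrable_finsetSum _ fun d _ => hi a b c d]
  refine Finset.sum_congr rfl fun c _ => ?_
  rw [integral_finsetSum _ fun d _ => hi a b c d]
  exact Finset.sum_congr rfl fun d _ => integral_const_mul _ _

/-- The directions of the noise are not concentrated near any pair of hyperplanes. -/
theorem exists_fourth_moment_lower_bound (hk : 1 ≤ k) (hSig : Sig.PosDef)
    [IsProbabilityMeasure (ellipticLaw Sig f)] :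
    ∃ κ > 0, ∀ x y : EuclideanSpace ℝ (Fin k), κ * (‖x‖ ^ 2 * ‖y‖ ^ 2)
      ≤ ∫ z, ⟪x, direction (invSqrt Sig) z⟫ ^ 2 * ⟪y, direction (invSqrt Sig) z⟫ ^ 2
        ∂(ellipticLaw Sig f) := by
  set S := invSqrt Sig with hS
  -- Expanded into fourth moments, `Q` is a polynomial, hence continuous. It is positive off the
  -- axes because hyperplanes are null, so it has a positive minimum on the product of two unit
  -- spheres; homogeneity does the rest.
  set Q : EuclideanSpace ℝ (Fin k) × EuclideanSpace ℝ (Fin k) → ℝ := fun w =>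
    ∫ z, ⟪w.1, direction S z⟫ ^ 2 * ⟪w.2, direction S z⟫ ^ 2 ∂(ellipticLaw Sig f) with hQ
  have hQc : Continuous Q := by
    simp only [hQ, integral_inner_sq_mul_inner_sq_eq_sum]
    fun_prop
  have hQpos : ∀ x y, x ≠ 0 → y ≠ 0 → 0 < Q (x, y) := by
    intro x y hx hy
    have hnn : ∀ z, 0 ≤ ⟪x, direction S z⟫ ^ 2 * ⟪y, direction S z⟫ ^ 2 := fun z => by positivity
    have hne : Q (x, y) ≠ 0 := by
      intro h0
      have hint : Integrable (fun z => ⟪x, direction S z⟫ ^ 2 * ⟪y, direction S z⟫ ^ 2)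
          (ellipticLaw Sig f) := by
        refine integrable_of_abs_le (c := ‖x‖ ^ 2 * ‖y‖ ^ 2) ?_ fun z => ?_
        · exact (((measurable_direction S).const_inner (𝕜 := ℝ)).pow_const 2).mul
            (((measurable_direction S).const_inner (𝕜 := ℝ)).pow_const 2)
        · rw [abs_of_nonneg (hnn z)]
          have hin : ∀ w : EuclideanSpace ℝ (Fin k), ⟪w, direction S z⟫ ^ 2 ≤ ‖w‖ ^ 2 := by
            intro w
            refine sq_le_sq' ?_ ?_
            · have := neg_le_of_abs_le (abs_real_inner_le_norm w (direction S z))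
              nlinarith [norm_direction_le S z, norm_nonneg w]
            · have := real_inner_le_norm w (direction S z)
              nlinarith [norm_direction_le S z, norm_nonneg w]
          exact mul_le_mul (hin x) (hin y) (sq_nonneg _) (sq_nonneg _)
      have h1 := (integral_eq_zero_iff_of_nonneg hnn hint).1 h0
      have h2 : ∀ᵐ z ∂(ellipticLaw Sig f), False := by
        filter_upwards [h1, ae_inner_direction_ne_zero (f := f) hSig hx,
          ae_inner_direction_ne_zero (f := f) hSig hy] with z hz1 hz2 hz3
        exact (mul_ne_zero (pow_ne_zero 2 hz2) (pow_ne_zero 2 hz3)) hz1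
      exact h2.exists.elim fun _ h => h
    exact (integral_nonneg hnn).lt_of_ne hne.symm
  have : Nonempty (Fin k) := ⟨⟨0, hk⟩⟩
  have hsc : IsCompact (Metric.sphere (0 : EuclideanSpace ℝ (Fin k)) 1 ×ˢ
      Metric.sphere (0 : EuclideanSpace ℝ (Fin k)) 1) :=
    (isCompact_sphere _ _).prod (isCompact_sphere _ _)
  have hsne : (Metric.sphere (0 : EuclideanSpace ℝ (Fin k)) 1 ×ˢ
      Metric.sphere (0 : EuclideanSpace ℝ (Fin k)) 1).Nonempty := by
    have : (Metric.sphere (0 : EuclideanSpace ℝ (Fin k)) 1).Nonempty :=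
      NormedSpace.sphere_nonempty.2 zero_le_one
    exact this.prod this
  obtain ⟨w, hw, hmin⟩ := hsc.exists_isMinOn hsne hQc.continuousOn
  have hsphere : ∀ v ∈ Metric.sphere (0 : EuclideanSpace ℝ (Fin k)) 1, v ≠ 0 := by
    intro v hv h
    simp [h] at hv
  refine ⟨Q w, hQpos w.1 w.2 (hsphere _ hw.1) (hsphere _ hw.2), fun x y => ?_⟩
  by_cases hx : x = 0
  · subst hx; simp
  by_cases hy : y = 0
  · subst hy; simp
  have hx' := norm_pos_iff.2 hx
  have hy' := norm_pos_iff.2 hy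
  have h1 : Q w ≤ Q (‖x‖⁻¹ • x, ‖y‖⁻¹ • y) := by
    refine hmin ⟨?_, ?_⟩
    · simp [norm_smul, hx'.ne']
    · simp [norm_smul, hy'.ne']
  have h2 : Q (‖x‖⁻¹ • x, ‖y‖⁻¹ • y) = (‖x‖ ^ 2 * ‖y‖ ^ 2)⁻¹ * Q (x, y) := by
    simp only [hQ, inner_smul_left]
    rw [← integral_const_mul]
    refine integral_congr_ae (ae_of_all _ fun z => ?_)
    simp
    field_simp
  rw [h2, ← div_eq_inv_mul, le_div_iff₀ (by positivity)] at h1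
  exact h1

theorem abs_sum_sub_le {ι : Type*} (s : Finset ι) {g h : ι → ℝ} {c : ℝ}
    (hgh : ∀ a ∈ s, |g a - h a| ≤ c) : |∑ a ∈ s, g a - ∑ a ∈ s, h a| ≤ s.card * c := by
  rw [← Finset.sum_sub_distrib]
  refine (Finset.abs_sum_le_sum_abs _ _).trans ?_
  simpa using Finset.sum_le_sum hgh

/-- The factor `k ^ 3` combines the `k` in front of the average with the `k²` pairs of coordinates.
-/
theorem MomentsClose.secondMomentsClose (hk : 1 ≤ k) (hSig : Sig.PosDef)
    (hf : IsRadialDensity k f) [IsProbabilityMeasure (ellipticLaw Sig f)]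
    {ι : Type*} [Fintype ι] {δ : ℝ} {u : ι → EuclideanSpace ℝ (Fin k)}
    (h : MomentsClose Sig f δ u) : SecondMomentsClose (k ^ 3 * δ) u := by
  intro v
  have hk0 : (k : ℝ) ≠ 0 := by positivity
  have e1 : (Fintype.card ι : ℝ)⁻¹ * ∑ t, ⟪v, u t⟫ ^ 2
      = ∑ a, ∑ b, v.ofLp a * v.ofLp b *
        ((Fintype.card ι : ℝ)⁻¹ * ∑ t, (u t).ofLp a * (u t).ofLp b) := by
    simp only [inner_sq_eq_sum]
    rw [Finset.sum_comm, Finset.mul_sum]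
    refine Finset.sum_congr rfl fun a _ => ?_
    rw [Finset.sum_comm, Finset.mul_sum]
    refine Finset.sum_congr rfl fun b _ => ?_
    rw [← Finset.mul_sum]; ring
  have e2 : ‖v‖ ^ 2 = k * ∫ z, ⟪v, direction (invSqrt Sig) z⟫ ^ 2 ∂(ellipticLaw Sig f) := by
    rw [integral_inner_direction_sq hk hSig hf]; field_simp
  nth_rewrite 1 [e2]
  rw [e1, integral_inner_sq_eq_sum, ← mul_sub, abs_mul, Nat.abs_cast]
  have h3 : |∑ a, ∑ b, v.ofLp a * v.ofLp b *
        ((Fintype.card ι : ℝ)⁻¹ * ∑ t, (u t).ofLp a * (u t).ofLp b) -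
      ∑ a, ∑ b, v.ofLp a * v.ofLp b * ∫ z, (direction (invSqrt Sig) z).ofLp a *
        (direction (invSqrt Sig) z).ofLp b ∂(ellipticLaw Sig f)|
      ≤ k * (k * (‖v‖ * ‖v‖ * δ)) := by
    have hcard : ((Finset.univ : Finset (Fin k)).card : ℝ) = k := by simp
    rw [← hcard]
    refine abs_sum_sub_le _ fun a _ => abs_sum_sub_le _ fun b _ => ?_
    rw [← mul_sub, abs_mul, abs_mul]
    exact mul_le_mul (mul_le_mul (abs_apply_le_norm v a) (abs_apply_le_norm v b)
        (abs_nonneg _) (norm_nonneg _)) (h.1 a b) (abs_nonneg _) (by positivity)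
  calc (k : ℝ) * _ ≤ k * (k * (k * (‖v‖ * ‖v‖ * δ))) :=
        mul_le_mul_of_nonneg_left h3 (Nat.cast_nonneg k)
    _ = k ^ 3 * δ * ‖v‖ ^ 2 := by ring

theorem MomentsClose.fourthMomentsLarge
    [IsProbabilityMeasure (ellipticLaw Sig f)]
    {ι : Type*} [Fintype ι] {δ κ : ℝ} {u : ι → EuclideanSpace ℝ (Fin k)}
    (hκ : ∀ x y : EuclideanSpace ℝ (Fin k), κ * (‖x‖ ^ 2 * ‖y‖ ^ 2)
      ≤ ∫ z, ⟪x, direction (invSqrt Sig) z⟫ ^ 2 * ⟪y, direction (invSqrt Sig) z⟫ ^ 2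
        ∂(ellipticLaw Sig f))
    (h : MomentsClose Sig f δ u) : FourthMomentsLarge (κ - k ^ 4 * δ) u := by
  intro x y
  set m : Fin k → Fin k → Fin k → Fin k → ℝ := fun a b c d =>
    ∫ z, (direction (invSqrt Sig) z).ofLp a * (direction (invSqrt Sig) z).ofLp b *
      ((direction (invSqrt Sig) z).ofLp c * (direction (invSqrt Sig) z).ofLp d)
      ∂(ellipticLaw Sig f) with hm
  set e : Fin k → Fin k → Fin k → Fin k → ℝ := fun a b c d =>
    (Fintype.card ι : ℝ)⁻¹ * ∑ t, (u t).ofLp a * (u t).ofLp b *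
      ((u t).ofLp c * (u t).ofLp d) with he
  have e1 : (Fintype.card ι : ℝ)⁻¹ * ∑ t, ⟪x, u t⟫ ^ 2 * ⟪y, u t⟫ ^ 2
      = ∑ a, ∑ b, ∑ c, ∑ d, x.ofLp a * x.ofLp b * (y.ofLp c * y.ofLp d) * e a b c d := by
    simp only [inner_sq_mul_inner_sq_eq_sum]
    rw [Finset.sum_comm, Finset.mul_sum]
    refine Finset.sum_congr rfl fun a _ => ?_
    rw [Finset.sum_comm, Finset.mul_sum]
    refine Finset.sum_congr rfl fun b _ => ?_
    rw [Finset.sum_comm, Finset.mul_sum]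
    refine Finset.sum_congr rfl fun c _ => ?_
    rw [Finset.sum_comm, Finset.mul_sum]
    refine Finset.sum_congr rfl fun d _ => ?_
    rw [← Finset.mul_sum]; simp only [he]; ring
  have h3 := hκ x y
  rw [integral_inner_sq_mul_inner_sq_eq_sum] at h3
  set c₀ := ‖x‖ * ‖x‖ * (‖y‖ * ‖y‖) * δ with hc₀
  have h4 : |∑ a, ∑ b, ∑ c, ∑ d, x.ofLp a * x.ofLp b * (y.ofLp c * y.ofLp d) * e a b c d
      - ∑ a, ∑ b, ∑ c, ∑ d, x.ofLp a * x.ofLp b * (y.ofLp c * y.ofLp d) * m a b c d|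
      ≤ k * (k * (k * (k * c₀))) := by
    have hcard : ((Finset.univ : Finset (Fin k)).card : ℝ) = k := by simp
    rw [← hcard]
    refine abs_sum_sub_le _ fun a _ => abs_sum_sub_le _ fun b _ => abs_sum_sub_le _ fun c _ =>
      abs_sum_sub_le _ fun d _ => ?_
    rw [← mul_sub, abs_mul, abs_mul, abs_mul, abs_mul]
    exact mul_le_mul (mul_le_mul (mul_le_mul (abs_apply_le_norm x a) (abs_apply_le_norm x b)
      (abs_nonneg _) (norm_nonneg _)) (mul_le_mul (abs_apply_le_norm y c) (abs_apply_le_norm y d)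
      (abs_nonneg _) (norm_nonneg _)) (by positivity) (by positivity)) (h.2 a b c d)
      (abs_nonneg _) (by positivity)
  have h5 := (abs_le.1 h4).1
  rw [e1]
  have : k * (k * (k * (k * c₀))) = k ^ 4 * δ * (‖x‖ ^ 2 * ‖y‖ ^ 2) := by rw [hc₀]; ring
  linarith

end

/-! ### Score functions -/

/-- The part of `]0, 1[` at distance less than `τ` from the end points. -/
def tailSet (τ : ℝ) : Set ℝ := Ioo 0 1 ∩ (Iio τ ∪ Ioi (1 - τ))

theorem measurableSet_tailSet (τ : ℝ) : MeasurableSet (tailSet τ) :=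
  measurableSet_Ioo.inter (measurableSet_Iio.union measurableSet_Ioi)

theorem tailSet_subset (τ : ℝ) : tailSet τ ⊆ Ioo 0 1 := inter_subset_left

theorem tendsto_integral_tailSet {g : ℝ → ℝ} (hg : IntegrableOn g (Ioo 0 1)) :
    Tendsto (fun τ => ∫ u in tailSet τ, g u) (𝓝[>] 0) (𝓝 0) := by
  have h1 : ∀ τ, ∫ u in tailSet τ, g u = ∫ u in tailSet τ, g u ∂(volume.restrict (Ioo 0 1)) := by
    intro τ
    rw [Measure.restrict_restrict (measurableSet_tailSet τ), inter_eq_left.2 (tailSet_subset τ)]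
  simp only [h1]
  refine hg.integrable.tendsto_setIntegral_nhds_zero ?_
  have h2 : ∀ τ, (volume.restrict (Ioo (0 : ℝ) 1)) (tailSet τ)
      ≤ ENNReal.ofReal τ + ENNReal.ofReal τ := by
    intro τ
    refine (Measure.restrict_apply_le _ _).trans ?_
    have : tailSet τ ⊆ Ioo 0 τ ∪ Ioo (1 - τ) 1 := by
      rintro x ⟨hx, h | h⟩
      · exact Or.inl ⟨hx.1, h⟩
      · exact Or.inr ⟨h, hx.2⟩
    refine (measure_mono this).trans ((measure_union_le _ _).trans ?_)
    simp
  have h3 : Tendsto (fun τ : ℝ => ENNReal.ofReal τ + ENNReal.ofReal τ) (𝓝[>] 0) (𝓝 0) := by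
    have : Tendsto (fun τ : ℝ => ENNReal.ofReal τ + ENNReal.ofReal τ) (𝓝 0)
        (𝓝 (ENNReal.ofReal 0 + ENNReal.ofReal 0)) :=
      (ENNReal.continuous_ofReal.add ENNReal.continuous_ofReal).tendsto 0
    simpa using this.mono_left nhdsWithin_le_nhds
  exact tendsto_of_tendsto_of_tendsto_of_le_of_le tendsto_const_nhds h3 (fun _ => zero_le) h2

theorem disjoint_grid_Ioo {h : ℝ} (hh : 0 < h) (c : ℝ) {a b : ℕ} (hab : a ≠ b) :
    Disjoint (Ioo ((a + c) * h) ((a + c + 1) * h)) (Ioo ((b + c) * h) ((b + c + 1) * h)) := by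
  rw [Set.disjoint_left]
  rintro x ⟨hx1, hx2⟩ ⟨hy1, hy2⟩
  rcases lt_or_gt_of_ne hab with hlt | hlt
  · have : (a : ℝ) + 1 ≤ b := by exact_mod_cast hlt
    nlinarith
  · have : (b : ℝ) + 1 ≤ a := by exact_mod_cast hlt
    nlinarith

/-- The offset `c` will be `-1` and `0`, for the cells to the left and to the right of the grid
points. -/
theorem sum_setIntegral_grid_le {φ : ℝ → ℝ} (hφ0 : ∀ x, 0 ≤ φ x) {A : Set ℝ}
    (hφ : IntegrableOn φ A) {h : ℝ} (hh : 0 < h) (c : ℝ) (s : Finset ℕ)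
    (hs : ∀ a ∈ s, Ioo ((a + c) * h) ((a + c + 1) * h) ⊆ A) :
    ∑ a ∈ s, ∫ u in Ioo ((a + c) * h) ((a + c + 1) * h), φ u ≤ ∫ u in A, φ u := by
  rw [← integral_biUnion_finset s (fun a _ => measurableSet_Ioo)
    (fun a _ b _ hab => disjoint_grid_Ioo hh c hab) fun a ha => hφ.mono_set (hs a ha)]
  exact setIntegral_mono_set hφ (ae_of_all _ hφ0)
    (LE.le.eventuallyLE (iUnion₂_subset hs))

/-- Although `g²` need not be monotone, its value at a grid point is a lower bound for `g²` on the
cell to the right if `g ≥ 0` there, and on the cell to the left if `g ≤ 0`. Allowing both cells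
costs the factor `2`. -/
theorem sum_sq_monotoneOn_le {g : ℝ → ℝ} (hg : MonotoneOn g (Ioo 0 1))
    (hint : IntegrableOn (fun u => g u ^ 2) (Ioo 0 1)) {A : Set ℝ}
    (hA1 : A ⊆ Ioo 0 1) {n : ℕ} (s : Finset ℕ) (hs1 : s ⊆ Finset.Icc 1 n)
    (hs : ∀ a ∈ s, Ioo (((a : ℝ) - 1) / (n + 1)) (((a : ℝ) + 1) / (n + 1)) ⊆ A) :
    ∑ a ∈ s, g ((a : ℝ) / (n + 1)) ^ 2 ≤ 2 * (n + 1) * ∫ u in A, g u ^ 2 := by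
  set h : ℝ := ((n : ℝ) + 1)⁻¹ with hh
  have hn : (0 : ℝ) < (n : ℝ) + 1 := by positivity
  have hh0 : 0 < h := inv_pos.2 hn
  have hnh : ((n : ℝ) + 1) * h = 1 := mul_inv_cancel₀ hn.ne'
  simp only [div_eq_mul_inv, ← hh] at hs ⊢
  have hsub1 : ∀ a ∈ s, Ioo (((a : ℝ) + -1) * h) (((a : ℝ) + -1 + 1) * h) ⊆ A := by
    intro a ha
    refine (Ioo_subset_Ioo (le_of_eq (by ring)) ?_).trans (hs a ha)
    nlinarith
  have hsub2 : ∀ a ∈ s, Ioo (((a : ℝ) + 0) * h) (((a : ℝ) + 0 + 1) * h) ⊆ A := by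
    intro a ha
    refine (Ioo_subset_Ioo ?_ (le_of_eq (by ring))).trans (hs a ha)
    nlinarith
  have hterm : ∀ a ∈ s, g ((a : ℝ) * h) ^ 2 ≤ ((n : ℝ) + 1) *
      ((∫ u in Ioo (((a : ℝ) + -1) * h) (((a : ℝ) + -1 + 1) * h), g u ^ 2)
        + ∫ u in Ioo (((a : ℝ) + 0) * h) (((a : ℝ) + 0 + 1) * h), g u ^ 2) := by
    intro a ha
    have ha1 := Finset.mem_Icc.1 (hs1 ha)
    have h1 : (1 : ℝ) ≤ a := by exact_mod_cast ha1.1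
    have h2 : (a : ℝ) ≤ n := by exact_mod_cast ha1.2
    have hmem : (a : ℝ) * h ∈ Ioo (0 : ℝ) 1 := ⟨by positivity, by nlinarith⟩
    have hp1 : 0 ≤ ∫ u in Ioo (((a : ℝ) + -1) * h) (((a : ℝ) + -1 + 1) * h), g u ^ 2 :=
      setIntegral_nonneg measurableSet_Ioo fun u _ => sq_nonneg _
    have hp2 : 0 ≤ ∫ u in Ioo (((a : ℝ) + 0) * h) (((a : ℝ) + 0 + 1) * h), g u ^ 2 :=
      setIntegral_nonneg measurableSet_Ioo fun u _ => sq_nonneg _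
    have hlow : ∀ x y : ℝ, x ≤ y → y - x = h → Ioo x y ⊆ A →
        (∀ u ∈ Ioo x y, g ((a : ℝ) * h) ^ 2 ≤ g u ^ 2) →
        g ((a : ℝ) * h) ^ 2 ≤ ((n : ℝ) + 1) * ∫ u in Ioo x y, g u ^ 2 := by
      intro x y hxy hd hsubA hle
      have h3 := setIntegral_mono_on (μ := volume) (s := Ioo x y)
        (f := fun _ => g ((a : ℝ) * h) ^ 2) (g := fun u => g u ^ 2) (by simp)
        (hint.mono_set (hsubA.trans hA1)) measurableSet_Ioo hle
      rw [setIntegral_const, Real.volume_real_Ioo_of_le hxy, hd, smul_eq_mul] at h3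
      calc g ((a : ℝ) * h) ^ 2 = ((n : ℝ) + 1) * (h * g ((a : ℝ) * h) ^ 2) := by
            rw [← mul_assoc, hnh, one_mul]
        _ ≤ _ := mul_le_mul_of_nonneg_left h3 hn.le
    rcases le_total 0 (g ((a : ℝ) * h)) with h0 | h0
    · refine (hlow _ _ (by nlinarith) (by ring) (hsub2 a ha) fun u hu => ?_).trans
        (mul_le_mul_of_nonneg_left (le_add_of_nonneg_left hp1) hn.le)
      exact pow_le_pow_left₀ h0 (hg hmem (hA1 (hsub2 a ha hu)) (by linarith [hu.1])) 2
    · refine (hlow _ _ (by nlinarith) (by ring) (hsub1 a ha) fun u hu => ?_).trans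
        (mul_le_mul_of_nonneg_left (le_add_of_nonneg_right hp2) hn.le)
      have := hg (hA1 (hsub1 a ha hu)) hmem (by linarith [hu.2])
      nlinarith
  refine (Finset.sum_le_sum hterm).trans ?_
  rw [← Finset.mul_sum, Finset.sum_add_distrib]
  have hi := hint.mono_set hA1
  have b1 := sum_setIntegral_grid_le (fun x => sq_nonneg (g x)) hi hh0 (-1) s hsub1
  have b2 := sum_setIntegral_grid_le (fun x => sq_nonneg (g x)) hi hh0 0 s hsub2
  nlinarith

theorem IsScore.measurable_indicator {K : ℝ → ℝ} (hK : IsScore K) :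
    Measurable ((Ioo (0 : ℝ) 1).indicator K) := by
  have := hK.continuousOn.measurable_piecewise (continuousOn_const (c := (0 : ℝ)))
    measurableSet_Ioo
  rwa [← piecewise_eq_indicator]

theorem IsScore.integrableOn_sq {K : ℝ → ℝ} (hK : IsScore K) :
    IntegrableOn (fun u => K u ^ 2) (Ioo 0 1) := by
  obtain ⟨g, h, -, -, hg, hh, hgh⟩ := hK.exists_sub
  refine Integrable.mono' ((hg.integrable.const_mul 2).add (hh.integrable.const_mul 2))
    ((hK.continuousOn.pow 2).aestronglyMeasurable measurableSet_Ioo) ?_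
  filter_upwards [ae_restrict_mem measurableSet_Ioo] with u hu
  rw [hgh u hu, Real.norm_of_nonneg (sq_nonneg _)]
  simp only [Pi.add_apply]
  nlinarith [sq_nonneg (g u + h u)]

/-- The dominating function is `4 g² + 4 h²` for the decomposition `K = g - h`. Because `s` and `A`
are arbitrary, this yields both boundedness of the average squared score and smallness of the part
near `0` and `1`. -/
theorem IsScore.exists_sum_sq_le {K : ℝ → ℝ} (hK : IsScore K) :
    ∃ φ : ℝ → ℝ, (∀ u, 0 ≤ φ u) ∧ IntegrableOn φ (Ioo 0 1) ∧
      ∀ (A : Set ℝ), A ⊆ Ioo 0 1 → ∀ (n : ℕ) (s : Finset ℕ),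
        s ⊆ Finset.Icc 1 n →
        (∀ a ∈ s, Ioo (((a : ℝ) - 1) / (n + 1)) (((a : ℝ) + 1) / (n + 1)) ⊆ A) →
        ∑ a ∈ s, K ((a : ℝ) / (n + 1)) ^ 2 ≤ (n + 1) * ∫ u in A, φ u := by
  obtain ⟨g, h, hgm, hhm, hg, hh, hgh⟩ := hK.exists_sub
  have hint : IntegrableOn (fun u => 4 * g u ^ 2 + 4 * h u ^ 2) (Ioo 0 1) := by
    rw [IntegrableOn]
    exact (hg.integrable.const_mul 4).fun_add (hh.integrable.const_mul 4)
  refine ⟨fun u => 4 * g u ^ 2 + 4 * h u ^ 2, fun u => by positivity, hint, fun A hA1 n s hs1 hs => ?_⟩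
  have b1 := sum_sq_monotoneOn_le hgm hg hA1 s hs1 hs
  have b2 := sum_sq_monotoneOn_le hhm hh hA1 s hs1 hs
  rw [integral_add ((hg.mono_set hA1).integrable.const_mul 4)
    ((hh.mono_set hA1).integrable.const_mul 4), integral_const_mul, integral_const_mul]
  have b3 : ∑ a ∈ s, K ((a : ℝ) / (n + 1)) ^ 2
      ≤ ∑ a ∈ s, (2 * g ((a : ℝ) / (n + 1)) ^ 2 + 2 * h ((a : ℝ) / (n + 1)) ^ 2) := by
    refine Finset.sum_le_sum fun a ha => ?_
    have ha1 := Finset.mem_Icc.1 (hs1 ha)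
    have h1 : (1 : ℝ) ≤ a := by exact_mod_cast ha1.1
    have h2 : (a : ℝ) ≤ n := by exact_mod_cast ha1.2
    rw [hgh _ ⟨by positivity, by rw [div_lt_one (by positivity)]; linarith⟩]
    nlinarith [sq_nonneg (g ((a : ℝ) / (n + 1)) + h ((a : ℝ) / (n + 1)))]
  rw [Finset.sum_add_distrib, ← Finset.mul_sum, ← Finset.mul_sum] at b3
  nlinarith

theorem IsScore.exists_avg_sq_bound {K : ℝ → ℝ} (hK : IsScore K) :
    ∃ M, 0 ≤ M ∧ ∀ n : ℕ, 0 < n → (n : ℝ)⁻¹ * ∑ a ∈ Finset.Icc 1 n,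
      K ((a : ℝ) / (n + 1)) ^ 2 ≤ M := by
  obtain ⟨φ, hφ0, hφ, h⟩ := hK.exists_sum_sq_le
  have hI : 0 ≤ ∫ u in Ioo (0 : ℝ) 1, φ u := integral_nonneg hφ0
  refine ⟨2 * ∫ u in Ioo (0 : ℝ) 1, φ u, by positivity, fun n hn => ?_⟩
  have h1 := h (Ioo 0 1) le_rfl n (Finset.Icc 1 n) le_rfl fun a ha => by
    have ha1 := Finset.mem_Icc.1 ha
    have h1 : (1 : ℝ) ≤ a := by exact_mod_cast ha1.1
    have h2 : (a : ℝ) ≤ n := by exact_mod_cast ha1.2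
    refine Ioo_subset_Ioo (div_nonneg (by linarith) (by positivity)) ?_
    rw [div_le_one (by positivity)]; linarith
  have hn1 : (1 : ℝ) ≤ n := by exact_mod_cast hn
  rw [inv_mul_le_iff₀ (by positivity)]
  nlinarith

theorem IsScore.exists_tail_le {K : ℝ → ℝ} (hK : IsScore K) {ε : ℝ} (hε : 0 < ε) :
    ∃ τ > 0, τ < 1 / 4 ∧ ∫ u in tailSet (2 * τ), K u ^ 2 ≤ ε ∧ ∃ N : ℕ, ∀ n ≥ N,
      (n : ℝ)⁻¹ * ∑ a ∈ (Finset.Icc 1 n).filter fun a : ℕ => (a : ℝ) / (n + 1) ∉ Icc τ (1 - τ),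
        K ((a : ℝ) / (n + 1)) ^ 2 ≤ ε := by
  obtain ⟨φ, hφ0, hφ, h⟩ := hK.exists_sum_sq_le
  have e1 := (tendsto_integral_tailSet hφ).eventually (gt_mem_nhds (half_pos hε))
  have e2 := (tendsto_integral_tailSet hK.integrableOn_sq).eventually (gt_mem_nhds hε)
  have e3 : ∀ᶠ τ : ℝ in 𝓝[>] 0, τ < 1 / 2 :=
    nhdsWithin_le_nhds (gt_mem_nhds (by norm_num))
  obtain ⟨τ', ⟨⟨h1, h2⟩, h3⟩, h4⟩ := (((e1.and e2).and e3).and self_mem_nhdsWithin).exists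
  have h4 : 0 < τ' := h4
  have e4 : 2 * (τ' / 2) = τ' := by ring
  refine ⟨τ' / 2, by positivity, by linarith, by rw [e4]; exact h2.le, ?_⟩
  obtain ⟨N, hN⟩ := exists_nat_gt (2 / τ')
  refine ⟨max N 1, fun n hn => ?_⟩
  have hn1 : (1 : ℝ) ≤ n := by exact_mod_cast (le_max_right N 1).trans hn
  have hnN : (N : ℝ) ≤ n := by exact_mod_cast (le_max_left N 1).trans hn
  have hn' : (0 : ℝ) < (n : ℝ) + 1 := by positivity
  -- The two cells around a grid point within `τ' / 2` of an end point then lie in `tailSet τ'`.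
  have hsmall : 1 / ((n : ℝ) + 1) ≤ τ' / 2 := by
    rw [div_le_iff₀ hn']
    rw [div_lt_iff₀ h4] at hN
    nlinarith
  have hb := h (tailSet τ') (tailSet_subset _) n
    ((Finset.Icc 1 n).filter fun a : ℕ => (a : ℝ) / (n + 1) ∉ Icc (τ' / 2) (1 - τ' / 2))
    (Finset.filter_subset _ _) fun a ha => by
      obtain ⟨ha, hat⟩ := Finset.mem_filter.1 ha
      have ha1 := Finset.mem_Icc.1 ha
      have g1 : (1 : ℝ) ≤ a := by exact_mod_cast ha1.1
      have g2 : (a : ℝ) ≤ n := by exact_mod_cast ha1.2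
      rintro x ⟨hx1, hx2⟩
      rw [add_div] at hx2
      rw [sub_div] at hx1
      refine ⟨⟨?_, ?_⟩, ?_⟩
      · have : 0 ≤ (a : ℝ) / (n + 1) - 1 / (n + 1) := by
          rw [← sub_div]; exact div_nonneg (by linarith) hn'.le
        linarith
      · have : (a : ℝ) / (n + 1) + 1 / (n + 1) ≤ 1 := by
          rw [← add_div, div_le_one hn']; linarith
        linarith
      · rw [mem_Icc, not_and_or, not_le, not_le] at hat
        rcases hat with hat | hat
        · left; rw [mem_Iio]; linarith
        · right; rw [mem_Ioi]; linarith
  rw [inv_mul_le_iff₀ (by positivity)]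
  nlinarith

/-- In the absence of ties the ranks are a permutation of `1, …, n`, so averages over rank scores
are not random. -/
theorem sum_comp_rank {n : ℕ} {R : Fin n → ℕ} (hR : Function.Injective R)
    (hR1 : ∀ s, R s ∈ Finset.Icc 1 n) (φ : ℕ → ℝ) :
    ∑ s, φ (R s) = ∑ a ∈ Finset.Icc 1 n, φ a := by
  have himg : Finset.univ.image R = Finset.Icc 1 n := by
    refine Finset.eq_of_subset_of_card_le (fun a ha => ?_) ?_
    · obtain ⟨s, -, rfl⟩ := Finset.mem_image.1 ha
      exact hR1 s
    · rw [Finset.card_image_of_injective _ hR]; simp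
  rw [← himg, Finset.sum_image fun _ _ _ _ h => hR h]

/-- Scores evaluated at ranks approximate the scores at the corresponding uniform variables. -/
theorem IsScore.avg_sq_sub_le {K : ℝ → ℝ} (hK : IsScore K) {ε : ℝ} (hε : 0 < ε) :
    ∃ τ : ℝ, ∃ η > 0, ∫ u in tailSet τ, K u ^ 2 ≤ ε ∧ ∃ N : ℕ, ∀ n ≥ N,
      ∀ (R : Fin n → ℕ) (y : Fin n → ℝ), Function.Injective R → (∀ s, R s ∈ Finset.Icc 1 n) →
      (∀ s, y s ∈ Ioo (0 : ℝ) 1) → (∀ s, |(R s : ℝ) / (n + 1) - y s| ≤ η) →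
      (n : ℝ)⁻¹ * ∑ s, (K ((R s : ℝ) / (n + 1)) - K (y s)) ^ 2
        ≤ 3 * ε + 2 * ((n : ℝ)⁻¹ * ∑ s, (tailSet τ).indicator (fun u => K u ^ 2) (y s)) := by
  obtain ⟨τ, hτ0, hτ4, hint, N, hN⟩ := hK.exists_tail_le hε
  have hsub : Icc (τ / 2) (1 - τ / 2) ⊆ Ioo (0 : ℝ) 1 := fun x hx =>
    ⟨by linarith [hx.1], by linarith [hx.2]⟩
  have huc := isCompact_Icc.uniformContinuousOn_of_continuous (hK.continuousOn.mono hsub)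
  rw [Metric.uniformContinuousOn_iff_le] at huc
  obtain ⟨η₀, hη₀, huc⟩ := huc (√ε) (Real.sqrt_pos.2 hε)
  refine ⟨2 * τ, min η₀ (τ / 2), lt_min hη₀ (by positivity), hint, max N 1,
    fun n hn R y hR hR1 hy hRy => ?_⟩
  have hnN := hN n ((le_max_left N 1).trans hn)
  have hn0 : (0 : ℝ) < n := by exact_mod_cast (le_max_right N 1).trans hn
  -- Uniform continuity handles arguments away from the end points. Otherwise both arguments are
  -- near an end point and the two squares are bounded separately. The rank part averages to at most
  -- `ε`, which accounts for `3 * ε`; the part in `y s` stays random.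
  have hterm : ∀ s, (K ((R s : ℝ) / (n + 1)) - K (y s)) ^ 2 ≤ ε
      + 2 * (if (R s : ℝ) / (n + 1) ∉ Icc τ (1 - τ) then K ((R s : ℝ) / (n + 1)) ^ 2 else 0)
      + 2 * (tailSet (2 * τ)).indicator (fun u => K u ^ 2) (y s) := by
    intro s
    have h1 := hRy s
    have h2 := abs_le.1 (h1.trans (min_le_right _ _))
    have hind : 0 ≤ (tailSet (2 * τ)).indicator (fun u => K u ^ 2) (y s) :=
      indicator_nonneg (fun u _ => sq_nonneg _) _
    by_cases hx : (R s : ℝ) / (n + 1) ∈ Icc τ (1 - τ)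
    · have h3 := huc _ (show (R s : ℝ) / (n + 1) ∈ Icc (τ / 2) (1 - τ / 2) from
        ⟨by linarith [hx.1], by linarith [hx.2]⟩) (y s)
        ⟨by linarith [hx.1, h2.2], by linarith [hx.2, h2.1]⟩
        (by rw [Real.dist_eq]; exact h1.trans (min_le_left _ _))
      rw [Real.dist_eq] at h3
      have h4 : (K ((R s : ℝ) / (n + 1)) - K (y s)) ^ 2 ≤ ε := by
        rw [← sq_abs, ← Real.sq_sqrt hε.le]
        exact pow_le_pow_left₀ (abs_nonneg _) h3 2
      simp only [hx, not_true_eq_false, if_false]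
      linarith
    · have hyt : y s ∈ tailSet (2 * τ) := by
        refine ⟨hy s, ?_⟩
        rw [mem_Icc, not_and_or, not_le, not_le] at hx
        rcases hx with hx | hx
        · left; rw [mem_Iio]; linarith [h2.1]
        · right; rw [mem_Ioi]; linarith [h2.2]
      rw [if_pos hx, indicator_of_mem hyt]
      nlinarith [sq_nonneg (K ((R s : ℝ) / (n + 1)) + K (y s))]
  have hsum := Finset.sum_le_sum fun s (_ : s ∈ Finset.univ) => hterm s
  rw [Finset.sum_add_distrib, Finset.sum_add_distrib, ← Finset.mul_sum, ← Finset.mul_sum,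
    sum_comp_rank hR hR1 (fun a => if (a : ℝ) / (n + 1) ∉ Icc τ (1 - τ) then
      K ((a : ℝ) / (n + 1)) ^ 2 else 0), ← Finset.sum_filter] at hsum
  have h5 := mul_le_mul_of_nonneg_left hsum (inv_nonneg.2 hn0.le)
  refine h5.trans ?_
  rw [mul_add, mul_add]
  have h6 : (n : ℝ)⁻¹ * ∑ _s : Fin n, ε = ε := by
    simp; field_simp
  rw [h6]
  linarith

/-! ### Ranks of perturbed radii -/

/-- On a grid of `m`-quantiles, relative perturbations of size `e` cannot carry a radius beyond a
neighbouring cell: `x_j (1 + e) ≤ x_{j+1} (1 - e)`. A rank is thus squeezed between empirical counts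
at nearby grid points, with total error at most `4 / m`. Only finitely many values of the empirical
distribution function matter, so no uniform convergence theorem is needed. -/
theorem IsRadialDensity.rank_close {k : ℕ} {f : ℝ → ℝ} (hf : IsRadialDensity k f) {η : ℝ}
    (hη : 0 < η) : ∃ J : Finset ℝ, ∃ e > 0, ∃ η' > 0, ∃ N : ℕ, ∀ n ≥ N, ∀ d ρ : Fin n → ℝ,
      (∀ t, 0 < d t) → (∀ t, |ρ t - 1| ≤ e) →
      (∀ x ∈ J, |(n : ℝ)⁻¹ * ∑ t, (if d t ≤ x then (1 : ℝ) else 0) - radialCdf k f x| ≤ η') →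
      ∀ s, |((Finset.univ.filter fun t => d t * ρ t ≤ d s * ρ s).card : ℝ) / (n + 1)
        - radialCdf k f (d s)| ≤ η := by
  set F := radialCdf k f with hF
  obtain ⟨m, hm⟩ := exists_nat_gt (4 / η)
  have hm0 : (0 : ℝ) < m := lt_trans (by positivity) hm
  have hm4 : 4 / (m : ℝ) ≤ η := by
    rw [div_lt_iff₀ hη] at hm
    rw [div_le_iff₀ hm0]; linarith
  have hex : ∀ j : ℕ, ∃ x : ℝ, j < m → 0 ≤ x ∧ F x = (j : ℝ) / m := by
    intro j
    by_cases hj : j < m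
    · obtain ⟨x, hx⟩ := hf.exists_radialCdf_eq (a := (j : ℝ) / m)
        ⟨by positivity, by rw [div_lt_one hm0]; exact_mod_cast hj⟩
      exact ⟨x, fun _ => hx⟩
    · exact ⟨0, fun h => absurd h hj⟩
  choose x hx using hex
  have hsm := hf.strictMonoOn_radialCdf
  have hlt : ∀ j, j + 1 < m → x j < x (j + 1) := by
    intro j hj
    refine (hsm.lt_iff_lt (hx j (by omega)).1 (hx (j + 1) hj).1).1 ?_
    rw [← hF, (hx j (by omega)).2, (hx (j + 1) hj).2]
    push_cast
    gcongr
    linarith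
  have hev : ∀ᶠ e : ℝ in 𝓝[>] 0, ∀ j ∈ Finset.range m, j + 1 < m →
      x j * (1 + e) ≤ x (j + 1) * (1 - e) := by
    rw [Filter.eventually_all_finset]
    intro j _
    by_cases hj : j + 1 < m
    · have h1 : Continuous fun e : ℝ => x j * (1 + e) := by fun_prop
      have h2 : Continuous fun e : ℝ => x (j + 1) * (1 - e) := by fun_prop
      have := h1.continuousAt.eventually_lt h2.continuousAt (x₀ := 0) (by simpa using hlt j hj)
      filter_upwards [nhdsWithin_le_nhds this] with e he _
      exact he.le
    · exact Eventually.of_forall fun _ h => absurd h hj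
  have hev1 : ∀ᶠ e : ℝ in 𝓝[>] 0, e < 1 := nhdsWithin_le_nhds (gt_mem_nhds (by norm_num))
  obtain ⟨e, ⟨he, he1⟩, he0⟩ := ((hev.and hev1).and self_mem_nhdsWithin).exists
  have he0 : 0 < e := he0
  have hgap : ∀ j, j + 1 < m → x j * (1 + e) ≤ x (j + 1) * (1 - e) := fun j hj =>
    he j (Finset.mem_range.2 (by omega)) hj
  refine ⟨(Finset.range m).image x, e, he0, 1 / m, by positivity, max m 1,
    fun n hn d ρ hd hρ hemp s => ?_⟩
  have hnm : (m : ℝ) ≤ n := by exact_mod_cast (le_max_left m 1).trans hn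
  have hn0 : (0 : ℝ) < n := by linarith
  have hN0 : (0 : ℝ) < (n : ℝ) + 1 := by linarith
  have hρ1 : ∀ t, 1 - e ≤ ρ t := fun t => by linarith [(abs_le.1 (hρ t)).1]
  have hρ2 : ∀ t, ρ t ≤ 1 + e := fun t => by linarith [(abs_le.1 (hρ t)).2]
  set R : ℝ := ((Finset.univ.filter fun t => d t * ρ t ≤ d s * ρ s).card : ℝ) with hR
  have hcard : ∀ y : ℝ, ∑ t, (if d t ≤ y then (1 : ℝ) else 0)
      = ((Finset.univ.filter fun t => d t ≤ y).card : ℝ) := by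
    intro y; simp
  have hemp' : ∀ j, j < m → |(n : ℝ)⁻¹ * ((Finset.univ.filter fun t => d t ≤ x j).card : ℝ)
      - (j : ℝ) / m| ≤ 1 / m := by
    intro j hj
    have := hemp (x j) (Finset.mem_image_of_mem x (Finset.mem_range.2 hj))
    rwa [hcard, (hx j hj).2] at this
  have hRn : R ≤ n := by
    rw [hR]
    have := Finset.card_filter_le (Finset.univ : Finset (Fin n))
      (fun t => d t * ρ t ≤ d s * ρ s)
    simp only [Finset.card_univ, Fintype.card_fin] at this
    exact_mod_cast this
  have hR0 : 0 ≤ R := Nat.cast_nonneg _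
  set p := F (d s) with hp
  have hp01 : p ∈ Ioo (0 : ℝ) 1 := hf.radialCdf_mem (hd s)
  have hm1 : 1 / (m : ℝ) = (m : ℝ)⁻¹ := one_div _
  have hi0 : 0 < (m : ℝ)⁻¹ := by positivity
  have hmi : (m : ℝ) * (m : ℝ)⁻¹ = 1 := mul_inv_cancel₀ hm0.ne'
  have hη4 : 4 * (m : ℝ)⁻¹ ≤ η := by rwa [← div_eq_mul_inv]
  rw [abs_le]
  constructor
  · set j := ⌊(m : ℝ) * p⌋₊ with hj
    have hj1 : (j : ℝ) ≤ m * p := Nat.floor_le (mul_nonneg hm0.le hp01.1.le)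
    have hj2 : (m : ℝ) * p < j + 1 := Nat.lt_floor_add_one _
    have hjm : j < m := by
      have : (j : ℝ) < m := by nlinarith [hp01.2]
      exact_mod_cast this
    have hpj : p ≤ (j + 1) * (m : ℝ)⁻¹ := by
      rw [← div_eq_mul_inv, le_div_iff₀ hm0]; linarith
    -- For `d s` in the lowest cell the lower bound is trivial, since `p ≤ 1 / m`.
    rcases Nat.eq_zero_or_pos j with h0 | h0
    · rw [h0] at hpj
      have : 0 ≤ R / ((n : ℝ) + 1) := by positivity
      push_cast at hpj
      linarith
    · obtain ⟨l, hl⟩ : ∃ l, j = l + 1 := ⟨j - 1, by omega⟩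
      have hxj : x j ≤ d s := by
        refine (hsm.le_iff_le (hx j hjm).1 (hd s).le).1 ?_
        rw [← hF, (hx j hjm).2, div_le_iff₀ hm0]; linarith
      have hsub : (Finset.univ.filter fun t => d t ≤ x l)
          ⊆ Finset.univ.filter fun t => d t * ρ t ≤ d s * ρ s := by
        intro t ht
        rw [Finset.mem_filter] at ht ⊢
        refine ⟨ht.1, ?_⟩
        calc d t * ρ t ≤ x l * (1 + e) := mul_le_mul ht.2 (hρ2 t)
              (by linarith [hρ1 t]) (hx l (by omega)).1
          _ ≤ x (l + 1) * (1 - e) := hgap l (by omega)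
          _ ≤ d s * ρ s := by
            rw [← hl]
            exact mul_le_mul hxj (hρ1 s) (by linarith) (hd s).le
      have hc : ((Finset.univ.filter fun t => d t ≤ x l).card : ℝ) ≤ R := by
        rw [hR]
        exact_mod_cast Finset.card_le_card hsub
      have h2 := (abs_le.1 (hemp' l (by omega))).1
      rw [hm1, div_eq_mul_inv] at h2
      have hl' : (j : ℝ) = l + 1 := by rw [hl]; push_cast; ring
      have h3 : ((l : ℝ) - 1) * (m : ℝ)⁻¹ ≤ (n : ℝ)⁻¹ * R :=
        le_trans (by linarith) (mul_le_mul_of_nonneg_left hc (inv_nonneg.2 hn0.le))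
      -- Dividing by `n + 1` instead of `n` costs at most `1 / (n + 1)`, which is why `n ≥ m` is
      -- required.
      have h4 : (n : ℝ)⁻¹ * R - (m : ℝ)⁻¹ ≤ R / ((n : ℝ) + 1) := by
        have e1 : (n : ℝ)⁻¹ * R - R / ((n : ℝ) + 1) = (R / n) * (1 / ((n : ℝ) + 1)) := by
          field_simp; ring
        have e2 : R / n ≤ 1 := by rw [div_le_one hn0]; exact hRn
        have e3 : 1 / ((n : ℝ) + 1) ≤ (m : ℝ)⁻¹ := by
          rw [← hm1]; exact one_div_le_one_div_of_le hm0 (by linarith)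
        have e4 : (R / n) * (1 / ((n : ℝ) + 1)) ≤ 1 * (m : ℝ)⁻¹ :=
          mul_le_mul e2 e3 (by positivity) zero_le_one
        linarith
      rw [hl'] at hpj
      linarith
  · set j := ⌈(m : ℝ) * p⌉₊ with hj
    have hj1 : (m : ℝ) * p ≤ j := Nat.le_ceil _
    have hj2 : (j : ℝ) < m * p + 1 := Nat.ceil_lt_add_one (mul_nonneg hm0.le hp01.1.le)
    have hpj : (j - 1) * (m : ℝ)⁻¹ ≤ p := by
      rw [← div_eq_mul_inv, div_le_iff₀ hm0]; linarith
    have hRN : R / ((n : ℝ) + 1) ≤ (n : ℝ)⁻¹ * R := by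
      rw [div_eq_inv_mul]
      exact mul_le_mul_of_nonneg_right (inv_anti₀ hn0 (by linarith)) hR0
    -- In the last cells there is no grid point to the right, but then `p ≥ 1 - 2 / m` and the
    -- normalised rank is at most `1`.
    by_cases hjm : j + 1 < m
    · have hxj : d s ≤ x j := by
        refine (hsm.le_iff_le (hd s).le (hx j (by omega)).1).1 ?_
        rw [← hF, (hx j (by omega)).2, le_div_iff₀ hm0]; linarith
      have hsub : (Finset.univ.filter fun t => d t * ρ t ≤ d s * ρ s)
          ⊆ Finset.univ.filter fun t => d t ≤ x (j + 1) := by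
        intro t ht
        rw [Finset.mem_filter] at ht ⊢
        refine ⟨ht.1, ?_⟩
        have : d t * (1 - e) ≤ x (j + 1) * (1 - e) := by
          calc d t * (1 - e) ≤ d t * ρ t := mul_le_mul_of_nonneg_left (hρ1 t) (hd t).le
            _ ≤ d s * ρ s := ht.2
            _ ≤ x j * (1 + e) := mul_le_mul hxj (hρ2 s) (by linarith [hρ1 s])
                (hx j (by omega)).1
            _ ≤ x (j + 1) * (1 - e) := hgap j hjm
        exact le_of_mul_le_mul_right this (by linarith)
      have hc : R ≤ ((Finset.univ.filter fun t => d t ≤ x (j + 1)).card : ℝ) := by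
        rw [hR]
        exact_mod_cast Finset.card_le_card hsub
      have h2 := (abs_le.1 (hemp' (j + 1) hjm)).2
      rw [hm1, div_eq_mul_inv] at h2
      push_cast at h2
      have h3 := mul_le_mul_of_nonneg_left hc (inv_nonneg.2 hn0.le)
      linarith
    · have h1 : (m : ℝ) ≤ j + 1 := by
        have : m ≤ j + 1 := by omega
        exact_mod_cast this
      have h2 : R / ((n : ℝ) + 1) ≤ 1 := by rw [div_le_one hN0]; linarith
      have h3 : 1 - 2 * (m : ℝ)⁻¹ ≤ (j - 1) * (m : ℝ)⁻¹ := by nlinarith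
      linarith

/-! ### Weak law of large numbers for product measures -/

theorem tendsto_measure_avg_sub {E : Type*} [MeasurableSpace E] (μ : Measure E)
    [IsProbabilityMeasure μ] {g : E → ℝ} (hg : Measurable g) {c : ℝ} (hc : ∀ x, |g x| ≤ c)
    {δ : ℝ} (hδ : 0 < δ) :
    Tendsto (fun n : ℕ => (Measure.pi fun _ : Fin n => μ)
      {y | δ < |(n : ℝ)⁻¹ * ∑ t, g (y t) - ∫ x, g x ∂μ|}) atTop (𝓝 0) := by
  have hint : Integrable g μ := integrable_of_abs_le hg hc
  have hmem : MemLp g 2 μ := MemLp.of_bound hg.aestronglyMeasurable c (ae_of_all _ hc)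
  set V := variance g μ with hV
  have hb : ∀ n : ℕ, 0 < n → (Measure.pi fun _ : Fin n => μ)
      {y | δ < |(n : ℝ)⁻¹ * ∑ t, g (y t) - ∫ x, g x ∂μ|} ≤ ENNReal.ofReal (V / δ ^ 2 / n) := by
    intro n hn
    have hn0 : (0 : ℝ) < n := by exact_mod_cast hn
    set X : (Fin n → E) → ℝ := ∑ t : Fin n, fun y => g (y t) with hX
    have hXm : MemLp X 2 (Measure.pi fun _ : Fin n => μ) := by
      refine memLp_finsetSum' _ fun t _ => ?_
      exact hmem.comp_measurePreserving (measurePreserving_eval _ t)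
    have hEX : ∫ y, X y ∂(Measure.pi fun _ : Fin n => μ) = n * ∫ x, g x ∂μ := by
      simp only [hX, Finset.sum_apply]
      rw [integral_finsetSum]
      · simp [integral_comp_eval (μ := fun _ : Fin n => μ) hint.aestronglyMeasurable]
      · exact fun t _ => (measurePreserving_eval (fun _ : Fin n => μ) t).integrable_comp_of_integrable hint
    have hVX : variance X (Measure.pi fun _ : Fin n => μ) = n * V := by
      rw [hX, variance_sum_pi (X := fun _ => g) fun _ => hmem]
      simp [hV]
    have h := meas_ge_le_variance_div_sq hXm (c := n * δ) (by positivity)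
    rw [hEX, hVX] at h
    refine (measure_mono fun y hy => ?_).trans (h.trans_eq ?_)
    · have hy : δ < |(n : ℝ)⁻¹ * ∑ t, g (y t) - ∫ x, g x ∂μ| := hy
      change n * δ ≤ |X y - n * ∫ x, g x ∂μ|
      have e : X y - n * ∫ x, g x ∂μ
          = n * ((n : ℝ)⁻¹ * ∑ t, g (y t) - ∫ x, g x ∂μ) := by
        simp only [hX, Finset.sum_apply]
        field_simp
      rw [e, abs_mul, abs_of_pos hn0]
      exact mul_le_mul_of_nonneg_left hy.le hn0.le
    · congr 1
      field_simp
  have hlim : Tendsto (fun n : ℕ => ENNReal.ofReal (V / δ ^ 2 / n)) atTop (𝓝 0) := by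
    have h := ENNReal.tendsto_ofReal (tendsto_const_div_atTop_nhds_zero_nat (V / δ ^ 2))
    rwa [ENNReal.ofReal_zero] at h
  refine tendsto_of_tendsto_of_tendsto_of_le_of_le' tendsto_const_nhds hlim
    (Eventually.of_forall fun _ => zero_le) ?_
  filter_upwards [eventually_gt_atTop 0] with n hn using hb n hn

/-! ### Sign flips and permutations -/

theorem measurePreserving_flip {E : Type*} [MeasurableSpace E] [Neg E] {μ : Measure E}
    [IsProbabilityMeasure μ] (hμ : MeasurePreserving (fun z : E => -z) μ μ) {n : ℕ} (r : Fin n) :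
    MeasurePreserving (fun (y : Fin n → E) t => if t = r then -y t else y t)
      (Measure.pi fun _ : Fin n => μ) (Measure.pi fun _ : Fin n => μ) := by
  have := measurePreserving_pi (fun _ : Fin n => μ) (fun _ : Fin n => μ)
    (f := fun t z => if t = r then -z else z) fun t => by
      by_cases h : t = r
      · simpa [h] using hμ
      · simp only [h, if_false]
        exact MeasurePreserving.id μ
  exact this

theorem measurePreserving_comp_perm {E : Type*} [MeasurableSpace E] (μ : Measure E)
    [IsProbabilityMeasure μ] {n : ℕ} (π : Equiv.Perm (Fin n)) :
    MeasurePreserving (fun (y : Fin n → E) => y ∘ π)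
      (Measure.pi fun _ : Fin n => μ) (Measure.pi fun _ : Fin n => μ) := by
  have h := measurePreserving_piCongrLeft (fun _ : Fin n => μ) π.symm
  convert h using 1
  funext y t
  have := MeasurableEquiv.piCongrLeft_apply_apply (β := fun _ : Fin n => E) π.symm y (π t)
  simpa using this.symm

theorem exists_perm_map_pair {α : Type*} [DecidableEq α] {s u s' u' : α} (h : s ≠ u)
    (h' : s' ≠ u') : ∃ π : Equiv.Perm α, π s = s' ∧ π u = u' := by
  refine ⟨Equiv.swap (Equiv.swap s s' u) u' * Equiv.swap s s', ?_, by simp⟩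
  rw [Equiv.Perm.mul_apply, Equiv.swap_apply_left]
  refine Equiv.swap_apply_of_ne_of_ne (fun h1 => h ?_) h'
  have := congrArg (Equiv.swap s s') h1
  simpa using this

/-- The pairs of indices at distance `i`. -/
def lagPairs (i n : ℕ) : Finset (Fin n × Fin n) :=
  Finset.univ.filter fun p => (p.1 : ℕ) = p.2 + i

theorem card_lagPairs_le (i n : ℕ) : (lagPairs i n).card ≤ n := by
  have := Finset.card_le_card_of_injOn (s := lagPairs i n) (t := (Finset.univ : Finset (Fin n)))
    Prod.snd (fun _ _ => Finset.mem_univ _) (by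
      rintro ⟨a, b⟩ h1 ⟨c, d⟩ h2 (h : b = d)
      have h1 := (Finset.mem_filter.1 h1).2
      have h2 := (Finset.mem_filter.1 h2).2
      simp only at h1 h2
      subst h
      exact Prod.ext (Fin.ext (h1.trans h2.symm)) rfl)
  simpa using this

/-- Second moment bound for a sum over lagged pairs of an array that is odd with respect to the
sign of each observation and equivariant with respect to permutations of the observations. -/
theorem integral_sq_sum_lagPairs_le {E : Type*} [MeasurableSpace E] [Neg E] {μ : Measure E}
    [IsProbabilityMeasure μ] (hμ : MeasurePreserving (fun z : E => -z) μ μ) {i n : ℕ} (hi : 1 ≤ i)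
    (hn : 2 ≤ n) {B : (Fin n → E) → Fin n → Fin n → ℝ} {c q : ℝ}
    (hB : ∀ s u, Measurable fun y => B y s u) (hBc : ∀ y s u, |B y s u| ≤ c)
    (hflip : ∀ y r s u, B (fun t => if t = r then -y t else y t) s u
      = (if s = r then -1 else 1) * (if u = r then -1 else 1) * B y s u)
    (hperm : ∀ (π : Equiv.Perm (Fin n)) y s u, B (y ∘ π) s u = B y (π s) (π u))
    (hq : ∀ y, ∑ s, ∑ u, B y s u ^ 2 ≤ (n : ℝ) ^ 2 * q) :
    ∫ y, (∑ p ∈ lagPairs i n, B y p.1 p.2) ^ 2 ∂(Measure.pi fun _ : Fin n => μ) ≤ 2 * n * q := by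
  set ν := Measure.pi fun _ : Fin n => μ with hν
  have hint : ∀ s u s' u', Integrable (fun y => B y s u * B y s' u') ν := fun s u s' u' =>
    integrable_of_abs_le ((hB s u).mul (hB s' u')) (c := c * c) fun y => by
      rw [abs_mul]
      exact mul_le_mul (hBc y s u) (hBc y s' u') (abs_nonneg _) ((abs_nonneg _).trans (hBc y s u))
  -- Since `i ≥ 1`, the larger of the two first indices occurs only once among the four indices.
  -- Flipping the sign of that observation preserves the law and negates the product.
  have hcross : ∀ p ∈ lagPairs i n, ∀ p' ∈ lagPairs i n, p ≠ p' →
      ∫ y, B y p.1 p.2 * B y p'.1 p'.2 ∂ν = 0 := by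
    have key : ∀ p ∈ lagPairs i n, ∀ p' ∈ lagPairs i n, (p'.1 : ℕ) < p.1 →
        ∫ y, B y p.1 p.2 * B y p'.1 p'.2 ∂ν = 0 := by
      intro p hp p' hp' hlt
      have h1 := (Finset.mem_filter.1 hp).2
      have h2 := (Finset.mem_filter.1 hp').2
      have e := (measurePreserving_flip hμ p.1).map_eq
      have e1 : ∫ y, B y p.1 p.2 * B y p'.1 p'.2 ∂ν
          = ∫ y, -(B y p.1 p.2 * B y p'.1 p'.2) ∂ν := by
        rw [hν]
        nth_rewrite 1 [← e]
        rw [integral_map (measurePreserving_flip hμ p.1).measurable.aemeasurable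
          (show Measurable fun y => B y p.1 p.2 * B y p'.1 p'.2 from
            (hB _ _).mul (hB _ _)).aestronglyMeasurable]
        refine integral_congr_ae (ae_of_all _ fun y => ?_)
        have n1 : p.2 ≠ p.1 := fun h => by have := congrArg Fin.val h; omega
        have n2 : p'.1 ≠ p.1 := fun h => by have := congrArg Fin.val h; omega
        have n3 : p'.2 ≠ p.1 := fun h => by have := congrArg Fin.val h; omega
        simp only [hflip, n1, n2, n3, if_true, if_false]
        ring
      rw [integral_neg] at e1
      linarith
    intro p hp p' hp' hne
    rcases lt_trichotomy (p'.1 : ℕ) p.1 with h | h | h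
    · exact key p hp p' hp' h
    · exfalso
      have h1 := (Finset.mem_filter.1 hp).2
      have h2 := (Finset.mem_filter.1 hp').2
      exact hne (Prod.ext (Fin.ext h.symm) (Fin.ext (by omega)))
    · simp only [mul_comm (B _ p.1 p.2)]
      exact key p' hp' p hp h
  -- Permutations act transitively on ordered pairs of distinct indices. A second moment at lag `i`
  -- is therefore an average over all off-diagonal pairs, which `hq` controls.
  have hsame : ∀ s u s' u' : Fin n, s ≠ u → s' ≠ u' →
      ∫ y, B y s u * B y s u ∂ν = ∫ y, B y s' u' * B y s' u' ∂ν := by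
    intro s u s' u' h h'
    obtain ⟨π, rfl, rfl⟩ := exists_perm_map_pair h h'
    have e := (measurePreserving_comp_perm μ π).map_eq
    rw [hν]
    nth_rewrite 1 [← e]
    rw [integral_map (measurePreserving_comp_perm μ π).measurable.aemeasurable
      (show Measurable fun y => B y s u * B y s u from
        (hB _ _).mul (hB _ _)).aestronglyMeasurable]
    simp only [hperm]
  have hn0 : (2 : ℝ) ≤ n := by exact_mod_cast hn
  have hq0 : 0 ≤ q := by
    obtain ⟨y⟩ : Nonempty (Fin n → E) := ν.nonempty_of_neZero
    have h1 := hq y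
    have h2 : 0 ≤ ∑ s, ∑ u, B y s u ^ 2 :=
      Finset.sum_nonneg fun _ _ => Finset.sum_nonneg fun _ _ => sq_nonneg _
    by_contra! h
    have h3 : (n : ℝ) ^ 2 * q < 0 := mul_neg_of_pos_of_neg (by positivity) h
    linarith
  have hv : ∀ p ∈ lagPairs i n, ∫ y, B y p.1 p.2 * B y p.1 p.2 ∂ν ≤ 2 * q := by
    intro p hp
    have hpne : p.1 ≠ p.2 := fun h => by
      have h1 := (Finset.mem_filter.1 hp).2
      have := congrArg Fin.val h; omega
    set v := ∫ y, B y p.1 p.2 * B y p.1 p.2 ∂ν with hv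
    have hv0 : 0 ≤ v := integral_nonneg fun y => mul_self_nonneg _
    have h1 : ∑ s : Fin n, ∑ u : Fin n, (if s = u then 0 else v) ≤ (n : ℝ) ^ 2 * q := by
      calc ∑ s : Fin n, ∑ u : Fin n, (if s = u then 0 else v)
          ≤ ∑ s : Fin n, ∑ u : Fin n, ∫ y, B y s u * B y s u ∂ν := by
            refine Finset.sum_le_sum fun s _ => Finset.sum_le_sum fun u _ => ?_
            split_ifs with h
            · exact integral_nonneg fun y => mul_self_nonneg _
            · exact (hsame _ _ _ _ hpne h).le
        _ = ∫ y, ∑ s : Fin n, ∑ u : Fin n, B y s u * B y s u ∂ν := by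
            rw [integral_finsetSum _ fun s _ => integrable_finsetSum _ fun u _ => hint s u s u]
            refine Finset.sum_congr rfl fun s _ => ?_
            rw [integral_finsetSum _ fun u _ => hint s u s u]
        _ ≤ ∫ y, (n : ℝ) ^ 2 * q ∂ν := by
            refine integral_mono (integrable_finsetSum _ fun s _ =>
              integrable_finsetSum _ fun u _ => hint s u s u) (integrable_const _) fun y => ?_
            simpa only [sq] using hq y
        _ = (n : ℝ) ^ 2 * q := by simp
    -- So `n (n - 1) v ≤ n² q`, and `n / (n - 1) ≤ 2` for `n ≥ 2`.
    have h2 : ∑ s : Fin n, ∑ u : Fin n, (if s = u then 0 else v) = n * ((n - 1) * v) := by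
      have : ∀ s : Fin n, ∑ u : Fin n, (if s = u then 0 else v) = (n - 1) * v := by
        intro s
        have e1 : ∀ u : Fin n, (if s = u then 0 else v) = v - if s = u then v else 0 := by
          intro u; split_ifs <;> simp
        simp only [e1, Finset.sum_sub_distrib]
        simp; ring
      simp [this]
    rw [h2, sq, mul_assoc] at h1
    have h3 := le_of_mul_le_mul_left h1 (by linarith)
    have h4 : ((n : ℝ) - 1) * v ≤ (n - 1) * (2 * q) := by nlinarith
    exact le_of_mul_le_mul_left h4 (by linarith)
  calc ∫ y, (∑ p ∈ lagPairs i n, B y p.1 p.2) ^ 2 ∂ν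
      = ∑ p ∈ lagPairs i n, ∑ p' ∈ lagPairs i n, ∫ y, B y p.1 p.2 * B y p'.1 p'.2 ∂ν := by
        simp only [sq, Finset.sum_mul_sum]
        rw [integral_finsetSum _ fun p _ => integrable_finsetSum _ fun p' _ => hint _ _ _ _]
        refine Finset.sum_congr rfl fun p _ => ?_
        rw [integral_finsetSum _ fun p' _ => hint _ _ _ _]
    _ = ∑ p ∈ lagPairs i n, ∫ y, B y p.1 p.2 * B y p.1 p.2 ∂ν := by
        refine Finset.sum_congr rfl fun p hp => ?_
        exact Finset.sum_eq_single p (fun p' hp' hne => hcross p hp p' hp' hne.symm)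
          fun h => absurd hp h
    _ ≤ ∑ _p ∈ lagPairs i n, 2 * q := Finset.sum_le_sum hv
    _ = (lagPairs i n).card * (2 * q) := by simp
    _ ≤ n * (2 * q) := mul_le_mul_of_nonneg_right (by exact_mod_cast card_lagPairs_le i n)
        (by positivity)
    _ = 2 * n * q := by ring

/-! ### Tyler's root of a finite sample -/

theorem IsUpperPos.mul_diag {k : ℕ} {S T : Matrix (Fin k) (Fin k) ℝ} (hS : IsUpperPos S)
    (hT : IsUpperPos T) (a : Fin k) : (S * T) a a = S a a * T a a := by
  rw [Matrix.mul_apply, Finset.sum_eq_single a]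
  · intro j _ hj
    rcases lt_or_gt_of_ne hj with h | h
    · rw [hS.1 a j h, zero_mul]
    · rw [hT.1 j a h, mul_zero]
  · simp

theorem IsUpperPos.mul {k : ℕ} {S T : Matrix (Fin k) (Fin k) ℝ} (hS : IsUpperPos S)
    (hT : IsUpperPos T) : IsUpperPos (S * T) :=
  ⟨fun _ _ hab => (hS.bt.mul hT.bt) hab, fun a => by
    rw [hS.mul_diag hT]; exact mul_pos (hS.2 a) (hT.2 a)⟩

theorem IsUpperPos.smul {k : ℕ} {S : Matrix (Fin k) (Fin k) ℝ} (hS : IsUpperPos S) {c : ℝ}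
    (hc : 0 < c) : IsUpperPos (c • S) :=
  ⟨fun a b hab => by simp [hS.1 a b hab], fun a => by simpa using mul_pos hc (hS.2 a)⟩

theorem isUpperPos_one (k : ℕ) : IsUpperPos (1 : Matrix (Fin k) (Fin k) ℝ) :=
  ⟨fun _ _ hab => Matrix.one_apply_ne hab.ne', fun a => by simp⟩

/-- Tyler roots of a sample indexed by `Fin n`. -/
def IsSampleRoot {k n : ℕ} (y : Fin n → EuclideanSpace ℝ (Fin k))
    (C : Matrix (Fin k) (Fin k) ℝ) : Prop :=
  IsUpperPos C ∧ (∀ a : Fin k, (a : ℕ) = 0 → C a a = 1) ∧ TylerEq y C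

open Classical in
/-- The choice function underlying `tylerRoot`. -/
def chosenRoot {k : ℕ} (p : Matrix (Fin k) (Fin k) ℝ → Prop) : Matrix (Fin k) (Fin k) ℝ :=
  if h : ∃ C, p C then h.choose else 1

/-- Tyler's root of a sample indexed by `Fin n`. -/
def sampleRoot {k n : ℕ} (y : Fin n → EuclideanSpace ℝ (Fin k)) : Matrix (Fin k) (Fin k) ℝ :=
  chosenRoot (IsSampleRoot y)

theorem sum_Icc_one_eq {M : Type*} [AddCommMonoid M] (n : ℕ) (g : ℕ → M) :
    ∑ t ∈ Finset.Icc 1 n, g t = ∑ s : Fin n, g (s + 1) := by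
  rw [Fin.sum_univ_eq_sum_range fun s => g (s + 1), Finset.range_eq_Ico,
    Finset.sum_Ico_add' g 0 n 1]
  rfl

theorem isTylerRoot_iff {k n : ℕ} (z : ℕ → EuclideanSpace ℝ (Fin k))
    (C : Matrix (Fin k) (Fin k) ℝ) :
    IsTylerRoot n z C ↔ IsSampleRoot (fun s : Fin n => z (s + 1)) C := by
  rw [IsTylerRoot, IsSampleRoot, TylerEq, sum_Icc_one_eq, Fintype.card_fin]

theorem tylerRoot_eq {k n : ℕ} (z : ℕ → EuclideanSpace ℝ (Fin k)) :
    tylerRoot n z = sampleRoot (fun s : Fin n => z (s + 1)) := by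
  have h : IsTylerRoot n z = IsSampleRoot (fun s : Fin n => z (s + 1)) :=
    funext fun C => propext (isTylerRoot_iff z C)
  rw [sampleRoot, ← h]
  rfl

theorem chosenRoot_spec {k : ℕ} {p : Matrix (Fin k) (Fin k) ℝ → Prop} (h : ∃ C, p C) :
    p (chosenRoot p) := by
  rw [chosenRoot, dif_pos h]
  exact h.choose_spec

theorem isUpperPos_sampleRoot {k n : ℕ} (y : Fin n → EuclideanSpace ℝ (Fin k)) :
    IsUpperPos (sampleRoot y) := by
  by_cases h : ∃ C, IsSampleRoot y C
  · exact (chosenRoot_spec h).1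
  · rw [sampleRoot, chosenRoot, dif_neg h]
    exact isUpperPos_one k

/-- The choice depends on the predicate alone, so samples with the same set of solutions have the
same chosen root. The invariances below thus hold even where the solution is not unique or does not
exist. -/
theorem sampleRoot_congr {k n m : ℕ} {y : Fin n → EuclideanSpace ℝ (Fin k)}
    {y' : Fin m → EuclideanSpace ℝ (Fin k)} (h : ∀ C, TylerEq y C ↔ TylerEq y' C) :
    sampleRoot y = sampleRoot y' := by
  have : IsSampleRoot y = IsSampleRoot y' :=
    funext fun C => propext (by rw [IsSampleRoot, IsSampleRoot, h])
  rw [sampleRoot, sampleRoot, this]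

theorem outer_neg_neg {k : ℕ} (u v : EuclideanSpace ℝ (Fin k)) : outer (-u) (-v) = outer u v := by
  ext a b
  simp [outer, Matrix.vecMulVec_apply]

theorem sampleRoot_flip {k n : ℕ} (y : Fin n → EuclideanSpace ℝ (Fin k)) (r : Fin n) :
    sampleRoot (fun t => if t = r then -y t else y t) = sampleRoot y := by
  refine sampleRoot_congr fun C => ?_
  have : ∀ t, outer (direction C (if t = r then -y t else y t))
      (direction C (if t = r then -y t else y t)) = outer (direction C (y t)) (direction C (y t)) := by
    intro t
    split_ifs
    · rw [direction_neg, outer_neg_neg]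
    · rfl
  simp only [TylerEq, this]

theorem sampleRoot_perm {k n : ℕ} (y : Fin n → EuclideanSpace ℝ (Fin k))
    (π : Equiv.Perm (Fin n)) : sampleRoot (y ∘ π) = sampleRoot y := by
  refine sampleRoot_congr fun C => ?_
  rw [TylerEq, TylerEq]
  have := Equiv.sum_comp π fun t => outer (direction C (y t)) (direction C (y t))
  simp only [Function.comp_apply, this]

theorem sampleRoot_update_smul {k n : ℕ} (y : Fin n → EuclideanSpace ℝ (Fin k)) (s : Fin n)
    (x : EuclideanSpace ℝ (Fin k)) {c : ℝ} (hc : 0 < c) :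
    sampleRoot (Function.update y s (c • x)) = sampleRoot (Function.update y s x) := by
  refine sampleRoot_congr fun C => ?_
  have : ∀ t, direction C (Function.update y s (c • x) t)
      = direction C (Function.update y s x t) := by
    intro t
    by_cases h : t = s
    · subst h; simp [direction_smul_right _ hc]
    · simp [h]
  simp only [TylerEq, this]

/-! ### The event on which Tyler's root exists, is unique, and is close to the truth -/

/-- Samples without zeros whose directions have approximately correct moments. -/
def goodSet {k : ℕ} (Sig : Matrix (Fin k) (Fin k) ℝ) (f : ℝ → ℝ) (δ : ℝ) (n : ℕ) :
    Set (Fin n → EuclideanSpace ℝ (Fin k)) :=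
  {y | (∀ t, y t ≠ 0) ∧ MomentsClose Sig f δ fun t => direction (invSqrt Sig) (y t)}

theorem inner_inv_transpose {k : ℕ} {S : Matrix (Fin k) (Fin k) ℝ} (hS : S.det ≠ 0)
    (x z : EuclideanSpace ℝ (Fin k)) :
    ⟪Matrix.toEuclideanLin (S⁻¹)ᵀ x, Matrix.toEuclideanLin S z⟫ = ⟪x, z⟫ := by
  rw [inner_toEuclideanLin_left, Matrix.transpose_transpose, ← toEuclideanLin_mul_apply,
    Matrix.nonsing_inv_mul _ hS.isUnit, toEuclideanLin_one_apply]

theorem FourthMomentsLarge.exists_inner_ne_zero {k : ℕ} {ι : Type*} [Fintype ι]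
    {z : ι → EuclideanSpace ℝ (Fin k)} {S : Matrix (Fin k) (Fin k) ℝ} (hS : S.det ≠ 0) {κ : ℝ}
    (hκ : 0 < κ) (h : FourthMomentsLarge κ fun t => direction S (z t))
    {x y : EuclideanSpace ℝ (Fin k)} (hx : x ≠ 0) (hy : y ≠ 0) :
    ∃ t, ⟪x, z t⟫ ≠ 0 ∧ ⟪y, z t⟫ ≠ 0 := by
  by_contra! hcon
  have hSi : ((S⁻¹)ᵀ).det ≠ 0 := by
    rw [Matrix.det_transpose, Matrix.det_nonsing_inv, Ring.inverse_eq_inv]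
    exact inv_ne_zero hS
  have hx' := norm_pos_iff.2 (toEuclideanLin_ne_zero hSi hx)
  have hy' := norm_pos_iff.2 (toEuclideanLin_ne_zero hSi hy)
  have h1 := h (Matrix.toEuclideanLin (S⁻¹)ᵀ x) (Matrix.toEuclideanLin (S⁻¹)ᵀ y)
  have h2 : ∀ t, ⟪Matrix.toEuclideanLin (S⁻¹)ᵀ x, direction S (z t)⟫ ^ 2
      * ⟪Matrix.toEuclideanLin (S⁻¹)ᵀ y, direction S (z t)⟫ ^ 2 = 0 := by
    intro t
    simp only [direction, inner_smul_right, inner_inv_transpose hS]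
    by_cases h3 : ⟪x, z t⟫ = 0
    · simp [h3]
    · simp [hcon t h3]
  simp only [h2, Finset.sum_const_zero, mul_zero] at h1
  have : 0 < κ * (‖Matrix.toEuclideanLin (S⁻¹)ᵀ x‖ ^ 2
      * ‖Matrix.toEuclideanLin (S⁻¹)ᵀ y‖ ^ 2) := by positivity
  linarith

/-- The whitened directions have a Tyler root `T` near the identity; equivariance makes `T * S` a
solution for `y`, and rescaling puts a `1` in its corner. Uniqueness comes from the fourth moments,
which exclude samples contained in two hyperplanes. -/
theorem exists_goodSet_root {k : ℕ} (hk : 1 ≤ k) {Sig : Matrix (Fin k) (Fin k) ℝ}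
    (hSig : Sig.PosDef) {f : ℝ → ℝ} (hf : IsRadialDensity k f)
    [IsProbabilityMeasure (ellipticLaw Sig f)] {ρ : ℝ} (hρ : 0 < ρ) :
    ∃ δ > 0, ∀ n : ℕ, 0 < n → ∀ y ∈ goodSet Sig f δ n,
      (∀ C, IsSampleRoot y C ↔ C = sampleRoot y) ∧
      ∃ T, IsUpperPos T ∧ (∀ a b, |T a b - (1 : Matrix (Fin k) (Fin k) ℝ) a b| < ρ) ∧
        invSqrt Sig ⟨0, hk⟩ ⟨0, hk⟩ • sampleRoot y = T * invSqrt Sig := by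
  have hSu := (invSqrt_spec hSig).1
  set S := invSqrt Sig with hS
  set o : Fin k := ⟨0, hk⟩
  obtain ⟨κ₀, hκ₀, hκ⟩ := exists_fourth_moment_lower_bound (f := f) hk hSig
  -- Dividing `T` by its corner entry, which exceeds `1/2`, turns an error `r` into at most `4 r ≤ ρ
  -- / 2`.
  set r : ℝ := min (ρ / 8) (1 / 2) with hr
  have hr0 : 0 < r := lt_min (by positivity) (by norm_num)
  obtain ⟨η, hη, hex⟩ := exists_tylerEq_near_one hk (half_pos hκ₀) hr0
  have hk0 : (0 : ℝ) < k := by positivity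
  -- These bounds absorb the factors `k³` and `k⁴` lost in passing from entrywise moments to
  -- quadratic forms; half of `κ₀` survives.
  refine ⟨min (η / k ^ 3) (κ₀ / 2 / k ^ 4), lt_min (by positivity) (by positivity),
    fun n hn y hy => ?_⟩
  have : Nonempty (Fin n) := ⟨⟨0, hn⟩⟩
  have h2 : SecondMomentsClose η fun t => direction S (y t) := by
    intro v
    refine (hy.2.secondMomentsClose hk hSig hf v).trans
      (mul_le_mul_of_nonneg_right ?_ (sq_nonneg _))
    calc (k : ℝ) ^ 3 * min (η / k ^ 3) (κ₀ / 2 / k ^ 4) ≤ k ^ 3 * (η / k ^ 3) :=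
          mul_le_mul_of_nonneg_left (min_le_left _ _) (by positivity)
      _ = η := by field_simp
  have h4 : FourthMomentsLarge (κ₀ / 2) fun t => direction S (y t) := by
    intro v w
    refine le_trans (mul_le_mul_of_nonneg_right ?_ (by positivity))
      (hy.2.fourthMomentsLarge hκ v w)
    have : (k : ℝ) ^ 4 * min (η / k ^ 3) (κ₀ / 2 / k ^ 4) ≤ κ₀ / 2 := by
      calc (k : ℝ) ^ 4 * min (η / k ^ 3) (κ₀ / 2 / k ^ 4) ≤ k ^ 4 * (κ₀ / 2 / k ^ 4) :=
            mul_le_mul_of_nonneg_left (min_le_right _ _) (by positivity)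
        _ = κ₀ / 2 := by field_simp
    linarith
  obtain ⟨T, hT, hTn, hTe⟩ := hex n hn _ (fun t => norm_direction hSu.det_pos.ne' (hy.1 t)) h2 h4
  have hTo := abs_lt.1 (hTn o o)
  rw [Matrix.one_apply_eq] at hTo
  have hr12 : r ≤ 1 / 2 := min_le_right _ _
  have hr8 : r ≤ ρ / 8 := min_le_left _ _
  have hTo0 : 1 / 2 < T o o := by linarith [hTo.1]
  have hTi : 0 < (T o o)⁻¹ := inv_pos.2 (by linarith)
  have hSo : 0 < S o o := hSu.2 o
  set T₁ := (T o o)⁻¹ • T with hT₁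
  have hT₁u : IsUpperPos T₁ := hT.smul hTi
  have hT₁o : T₁ o o = 1 := by simp [hT₁, (by linarith : (0 : ℝ) < T o o).ne']
  have hroot : IsSampleRoot y ((S o o)⁻¹ • (T₁ * S)) := by
    refine ⟨(hT₁u.mul hSu).smul (inv_pos.2 hSo), fun a ha => ?_, ?_⟩
    · have : a = o := Fin.ext ha
      rw [this, Matrix.smul_apply, hT₁u.mul_diag hSu, hT₁o, smul_eq_mul, one_mul,
        inv_mul_cancel₀ hSo.ne']
    · exact ((hTe.smul hTi).mul_of_direction).smul (inv_pos.2 hSo)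
  have huniq : ∀ C, IsSampleRoot y C ↔ C = sampleRoot y := by
    have hspec : IsSampleRoot y (sampleRoot y) := chosenRoot_spec ⟨_, hroot⟩
    refine fun C => ⟨fun hC => ?_, fun hC => hC ▸ hspec⟩
    exact TylerEq.unique hy.1
      (fun v w hv hw => h4.exists_inner_ne_zero hSu.det_pos.ne' (half_pos hκ₀) hv hw)
      hC.1 hspec.1 hC.2.2 hspec.2.2 o ((hC.2.1 o rfl).trans (hspec.2.1 o rfl).symm)
  refine ⟨huniq, T₁, hT₁u, fun a b => ?_, ?_⟩
  · have e1 : T₁ a b - (1 : Matrix (Fin k) (Fin k) ℝ) a b = (T o o)⁻¹ *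
        ((T a b - (1 : Matrix (Fin k) (Fin k) ℝ) a b)
          - (1 : Matrix (Fin k) (Fin k) ℝ) a b * (T o o - 1)) := by
      rw [hT₁, Matrix.smul_apply, smul_eq_mul]
      have : T o o ≠ 0 := by linarith
      field_simp
      ring
    have hone : |(1 : Matrix (Fin k) (Fin k) ℝ) a b| ≤ 1 := by
      rw [Matrix.one_apply]; split_ifs <;> simp
    have e2 : (T o o)⁻¹ ≤ 2 := by
      rw [inv_le_comm₀ (by linarith) (by norm_num)]; linarith
    rw [e1, abs_mul, abs_of_pos hTi]
    calc (T o o)⁻¹ * |(T a b - (1 : Matrix (Fin k) (Fin k) ℝ) a b)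
          - (1 : Matrix (Fin k) (Fin k) ℝ) a b * (T o o - 1)|
        ≤ 2 * (r + 1 * r) := by
          refine mul_le_mul e2 ?_ (abs_nonneg _) (by norm_num)
          refine (abs_sub _ _).trans (add_le_add (hTn a b).le ?_)
          rw [abs_mul]
          exact mul_le_mul hone (abs_le.2 ⟨by linarith [hTo.1], by linarith [hTo.2]⟩)
            (abs_nonneg _) zero_le_one
      _ < ρ := by linarith
  · rw [← (huniq _).1 hroot, smul_smul, mul_inv_cancel₀ hSo.ne', one_smul]

/-! ### Measurable equivariant root maps -/

theorem measurable_toEuclideanLin_apply {k : ℕ} {α : Type*} [MeasurableSpace α]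
    {M : α → Matrix (Fin k) (Fin k) ℝ} {z : α → EuclideanSpace ℝ (Fin k)}
    (hM : ∀ a b, Measurable fun ω => M ω a b) (hz : Measurable z) :
    Measurable fun ω => Matrix.toEuclideanLin (M ω) (z ω) := by
  refine (WithLp.measurable_toLp 2 (Fin k → ℝ)).comp (f := fun ω => M ω *ᵥ (z ω).ofLp) ?_
  refine measurable_pi_iff.2 fun a => ?_
  simp only [Matrix.mulVec, dotProduct]
  exact Finset.measurable_fun_sum _ fun b _ =>
    (hM a b).mul ((measurable_ofLp_apply b).comp hz)

theorem measurable_direction_apply {k : ℕ} {α : Type*} [MeasurableSpace α]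
    {M : α → Matrix (Fin k) (Fin k) ℝ} {z : α → EuclideanSpace ℝ (Fin k)}
    (hM : ∀ a b, Measurable fun ω => M ω a b) (hz : Measurable z) :
    Measurable fun ω => direction (M ω) (z ω) :=
  (measurable_toEuclideanLin_apply hM hz).norm.inv.smul (measurable_toEuclideanLin_apply hM hz)

theorem measurableSet_goodSet {k : ℕ} (Sig : Matrix (Fin k) (Fin k) ℝ) (f : ℝ → ℝ) (δ : ℝ)
    (n : ℕ) : MeasurableSet (goodSet Sig f δ n) := by
  have hd : ∀ (t : Fin n) (a : Fin k), Measurable fun y : Fin n → EuclideanSpace ℝ (Fin k) =>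
      (direction (invSqrt Sig) (y t)).ofLp a := fun t a =>
    (measurable_ofLp_apply a).comp ((measurable_direction _).comp (measurable_pi_apply t))
  have hle : ∀ {g : (Fin n → EuclideanSpace ℝ (Fin k)) → ℝ} (c e : ℝ), Measurable g →
      Measurable fun y => |(Fintype.card (Fin n) : ℝ)⁻¹ * g y - c| ≤ e := fun c e hg =>
    measurableSet_setOfPred.1 (measurableSet_le ((hg.const_mul _).sub_const c).abs measurable_const)
  refine measurableSet_setOfPred.2 (Measurable.and ?_ (Measurable.and ?_ ?_))
  · exact Measurable.forall fun t => (measurableSet_setOfPred.1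
      (measurableSet_eq_fun (measurable_pi_apply t) measurable_const)).not
  · exact Measurable.forall fun a => Measurable.forall fun b => hle _ _
      (Finset.measurable_fun_sum _ fun t _ => (hd t a).mul (hd t b))
  · exact Measurable.forall fun a => Measurable.forall fun b => Measurable.forall fun c =>
      Measurable.forall fun d => hle _ _ (Finset.measurable_fun_sum _ fun t _ =>
        ((hd t a).mul (hd t b)).mul ((hd t c).mul (hd t d)))

theorem goodSet_flip {k : ℕ} {Sig : Matrix (Fin k) (Fin k) ℝ} {f : ℝ → ℝ} {δ : ℝ} {n : ℕ}
    (y : Fin n → EuclideanSpace ℝ (Fin k)) (r : Fin n) :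
    (fun t => if t = r then -y t else y t) ∈ goodSet Sig f δ n ↔ y ∈ goodSet Sig f δ n := by
  have e : ∀ t, ∃ c : ℝ, c * c = 1 ∧ ∀ a, (direction (invSqrt Sig) (if t = r then -y t else y t)).ofLp a
      = c * (direction (invSqrt Sig) (y t)).ofLp a := by
    intro t
    split_ifs
    · exact ⟨-1, by norm_num, fun a => by simp [direction_neg]⟩
    · exact ⟨1, by norm_num, fun a => by simp⟩
  choose c hc he using e
  have e2 : ∀ t a b, c t * (direction (invSqrt Sig) (y t)).ofLp a
      * (c t * (direction (invSqrt Sig) (y t)).ofLp b) = (direction (invSqrt Sig) (y t)).ofLp a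
        * (direction (invSqrt Sig) (y t)).ofLp b := fun t a b => by
    rw [mul_mul_mul_comm, hc, one_mul]
  have e3 : ∀ t, (if t = r then -y t else y t) ≠ 0 ↔ y t ≠ 0 := by
    intro t; split_ifs <;> simp
  simp only [goodSet, mem_ofPred_eq, MomentsClose, he, e2, e3]

theorem goodSet_perm {k : ℕ} {Sig : Matrix (Fin k) (Fin k) ℝ} {f : ℝ → ℝ} {δ : ℝ} {n : ℕ}
    (y : Fin n → EuclideanSpace ℝ (Fin k)) (π : Equiv.Perm (Fin n)) :
    y ∘ π ∈ goodSet Sig f δ n ↔ y ∈ goodSet Sig f δ n := by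
  have e : ∀ g : EuclideanSpace ℝ (Fin k) → ℝ, ∑ t, g (y (π t)) = ∑ t, g (y t) := fun g =>
    Equiv.sum_comp π fun t => g (y t)
  have e1 : (∀ t, y (π t) ≠ 0) ↔ ∀ t, y t ≠ 0 := π.forall_congr_right (q := fun t => y t ≠ 0)
  simp only [goodSet, mem_ofPred_eq, MomentsClose, Function.comp_apply, e1]
  have e2 := fun a b => e fun z => (direction (invSqrt Sig) z).ofLp a
    * (direction (invSqrt Sig) z).ofLp b
  have e4 := fun a b c d => e fun z => (direction (invSqrt Sig) z).ofLp a
    * (direction (invSqrt Sig) z).ofLp b * ((direction (invSqrt Sig) z).ofLp c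
    * (direction (invSqrt Sig) z).ofLp d)
  simp only [e2, e4]

theorem goodSet_update {k : ℕ} {Sig : Matrix (Fin k) (Fin k) ℝ} {f : ℝ → ℝ} {δ : ℝ} {n : ℕ}
    (y : Fin n → EuclideanSpace ℝ (Fin k)) (s : Fin n) {c : ℝ} (hc : 0 < c) :
    Function.update y s (c • y s) ∈ goodSet Sig f δ n ↔ y ∈ goodSet Sig f δ n := by
  have e : ∀ t, direction (invSqrt Sig) (Function.update y s (c • y s) t)
      = direction (invSqrt Sig) (y t) := by
    intro t
    by_cases h : t = s
    · subst h; simp [direction_smul_right _ hc]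
    · simp [h]
  have e1 : ∀ t, Function.update y s (c • y s) t ≠ 0 ↔ y t ≠ 0 := by
    intro t
    by_cases h : t = s
    · subst h; simp [hc.ne']
    · simp [h]
  simp only [goodSet, mem_ofPred_eq, e, e1]

/-- Where the solution is unique, the graph of the root is the Borel set cut out by Tyler's
equation, and the projection to the sample is injective on it. By the Lusin–Souslin theorem
injective Borel images of Borel sets are Borel. -/
theorem measurable_sampleRoot_of_unique {k n : ℕ} {H : Set (Fin n → EuclideanSpace ℝ (Fin k))}
    (hH : MeasurableSet H) (huniq : ∀ y ∈ H, ∀ C, IsSampleRoot y C ↔ C = sampleRoot y)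
    {V : Set ℝ} (hV : MeasurableSet V) (a b : Fin k) :
    MeasurableSet {y | y ∈ H ∧ sampleRoot y a b ∈ V} := by
  set Γ : Set ((Fin n → EuclideanSpace ℝ (Fin k)) × (Fin k → Fin k → ℝ)) :=
    {p | p.1 ∈ H ∧ IsSampleRoot p.1 (Matrix.of p.2) ∧ p.2 a b ∈ V} with hΓ
  have hme : ∀ c d, Measurable fun p : (Fin n → EuclideanSpace ℝ (Fin k)) × (Fin k → Fin k → ℝ) =>
      Matrix.of p.2 c d := fun c d =>
    (measurable_pi_apply d).comp ((measurable_pi_apply c).comp measurable_snd)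
  have hdir : ∀ t c, Measurable fun p : (Fin n → EuclideanSpace ℝ (Fin k)) × (Fin k → Fin k → ℝ) =>
      (direction (Matrix.of p.2) (p.1 t)).ofLp c := fun t c =>
    (measurable_ofLp_apply c).comp
      (measurable_direction_apply hme ((measurable_pi_apply t).comp measurable_fst))
  have hT : ∀ p : (Fin n → EuclideanSpace ℝ (Fin k)) × (Fin k → Fin k → ℝ),
      TylerEq p.1 (Matrix.of p.2) ↔ ∀ c d, (Fintype.card (Fin n) : ℝ)⁻¹ * ∑ t,
        (direction (Matrix.of p.2) (p.1 t)).ofLp c * (direction (Matrix.of p.2) (p.1 t)).ofLp d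
        = (k : ℝ)⁻¹ * (1 : Matrix (Fin k) (Fin k) ℝ) c d := by
    intro p
    rw [TylerEq, ← Matrix.ext_iff]
    simp only [Matrix.smul_apply, Matrix.sum_apply, outer, Matrix.vecMulVec_apply, smul_eq_mul]
  have hΓm : MeasurableSet Γ := by
    refine MeasurableSet.inter (measurable_fst hH) (MeasurableSet.inter ?_ (hme a b hV))
    refine measurableSet_setOfPred.2 (Measurable.and (Measurable.and ?_ ?_) (Measurable.and ?_ ?_))
    · exact Measurable.forall fun c => Measurable.forall fun d => Measurable.imp measurable_const
        (measurableSet_setOfPred.1 (measurableSet_eq_fun (hme c d) measurable_const))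
    · exact Measurable.forall fun c =>
        measurableSet_setOfPred.1 (measurableSet_lt measurable_const (hme c c))
    · exact Measurable.forall fun c => Measurable.imp measurable_const
        (measurableSet_setOfPred.1 (measurableSet_eq_fun (hme c c) measurable_const))
    · simp only [hT]
      exact Measurable.forall fun c => Measurable.forall fun d =>
        measurableSet_setOfPred.1 (measurableSet_eq_fun ((Finset.measurable_fun_sum _ fun t _ =>
          (hdir t c).mul (hdir t d)).const_mul _) measurable_const)
  have hinj : InjOn Prod.fst Γ := by
    rintro ⟨y, M⟩ ⟨hy, hM, -⟩ ⟨y', M'⟩ ⟨hy', hM', -⟩ (rfl : y = y')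
    have := ((huniq y hy _).1 hM).trans ((huniq y hy _).1 hM').symm
    exact Prod.ext rfl (Matrix.of.injective this)
  convert hΓm.image_of_measurable_injOn measurable_fst hinj using 1
  ext y
  constructor
  · rintro ⟨hy, hyV⟩
    exact ⟨(y, sampleRoot y), ⟨hy, (huniq y hy _).2 rfl, hyV⟩, rfl⟩
  · rintro ⟨⟨y, M⟩, ⟨hy, hM, hMV⟩, rfl⟩
    refine ⟨hy, ?_⟩
    rw [← (huniq y hy _).1 hM]
    exact hMV

/-- A measurable map which assigns to a sample a matrix `T * S` with `T` upper triangular and close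
to the identity, and which is invariant under sign changes, permutations and positive rescalings of
the observations. -/
structure IsNearRoot {k n : ℕ} (S : Matrix (Fin k) (Fin k) ℝ) (ρ : ℝ)
    (R : (Fin n → EuclideanSpace ℝ (Fin k)) → Matrix (Fin k) (Fin k) ℝ) : Prop where
  measurable : ∀ a b, Measurable fun y => R y a b
  flip : ∀ y r, R (fun t => if t = r then -y t else y t) = R y
  perm : ∀ y (π : Equiv.Perm (Fin n)), R (y ∘ π) = R y
  update : ∀ y s (c : ℝ), 0 < c → R (Function.update y s (c • y s)) = R y
  near : ∀ y, ∃ T, IsUpperPos T ∧ (∀ a b, |T a b - (1 : Matrix (Fin k) (Fin k) ℝ) a b| < ρ) ∧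
    R y = T * S

-- Outside the good event the root is replaced by `Σ^{-1/2}` itself, so that measurability,
-- invariance and closeness hold for every sample. On the event it is rescaled by the corner entry
-- of `Σ^{-1/2}`, since Tyler's root estimates `Σ^{-1/2}` only up to scale.
open Classical in
theorem exists_isNearRoot {k : ℕ} (hk : 1 ≤ k) {Sig : Matrix (Fin k) (Fin k) ℝ}
    (hSig : Sig.PosDef) {f : ℝ → ℝ} (hf : IsRadialDensity k f)
    [IsProbabilityMeasure (ellipticLaw Sig f)] {ρ : ℝ} (hρ : 0 < ρ) :
    ∃ δ > 0, ∀ n : ℕ, 0 < n → ∃ R : (Fin n → EuclideanSpace ℝ (Fin k)) → Matrix (Fin k) (Fin k) ℝ,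
      IsNearRoot (invSqrt Sig) ρ R ∧ ∀ y ∈ goodSet Sig f δ n, ∃ c : ℝ, 0 < c ∧ R y = c • sampleRoot y := by
  obtain ⟨δ, hδ, h⟩ := exists_goodSet_root hk hSig hf hρ
  refine ⟨δ, hδ, fun n hn => ⟨fun y => if y ∈ goodSet Sig f δ n then
    invSqrt Sig ⟨0, hk⟩ ⟨0, hk⟩ • sampleRoot y else invSqrt Sig, ⟨?_, ?_, ?_, ?_, ?_⟩, ?_⟩⟩
  · intro a b
    have hH := measurableSet_goodSet Sig f δ n
    have e : (fun y : Fin n → EuclideanSpace ℝ (Fin k) => (if y ∈ goodSet Sig f δ n then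
        invSqrt Sig ⟨0, hk⟩ ⟨0, hk⟩ • sampleRoot y else invSqrt Sig) a b) = fun y =>
        if y ∈ goodSet Sig f δ n then invSqrt Sig ⟨0, hk⟩ ⟨0, hk⟩ * 
          (goodSet Sig f δ n).indicator (fun y => sampleRoot y a b) y else invSqrt Sig a b := by
      funext y
      split_ifs with hy
      · simp [hy]
      · rfl
    rw [e]
    refine Measurable.ite hH (Measurable.const_mul ?_ _) measurable_const
    refine measurable_of_restrict_of_restrict_compl hH ?_ ?_
    · intro V hV
      have := measurable_sampleRoot_of_unique hH (fun y hy => (h n hn y hy).1) hV a b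
      convert measurable_subtype_coe this using 1
      ext y
      simp
    · convert measurable_const (a := (0 : ℝ)) using 1
      funext y
      exact Set.indicator_of_notMem y.2 _
  · intro y r
    simp only [goodSet_flip, sampleRoot_flip]
  · intro y π
    simp only [goodSet_perm, sampleRoot_perm]
  · intro y s c hc
    simp only [goodSet_update y s hc, sampleRoot_update_smul y s _ hc, Function.update_eq_self]
  · intro y
    split_ifs with hy
    · exact (h n hn y hy).2
    · exact ⟨1, isUpperPos_one k, fun a b => by simpa using hρ, by rw [one_mul]⟩
  · intro y hy
    exact ⟨invSqrt Sig ⟨0, hk⟩ ⟨0, hk⟩, (invSqrt_spec hSig).1.2 _, if_pos hy⟩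

/-! ### Absence of ties -/

-- A set meeting every open ray at most once has pairwise disjoint dilates `c A`, `c > 0`. If `A`
-- had positive measure, these would be uncountably many disjoint sets of positive measure,
-- contradicting σ-finiteness.
open scoped Pointwise in
theorem addHaar_eq_zero_of_disjoint_dilates {E : Type*} [NormedAddCommGroup E] [NormedSpace ℝ E]
    [MeasurableSpace E] [BorelSpace E] [FiniteDimensional ℝ E] (μ : Measure E)
    [μ.IsAddHaarMeasure] {A : Set E} (hA : MeasurableSet A)
    (h : ∀ x ∈ A, ∀ c : ℝ, 0 < c → c • x ∈ A → c = 1) : μ A = 0 := by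
  by_contra h0
  have hdis : Pairwise (Function.onFun Disjoint fun c : Ioi (0 : ℝ) => (c : ℝ) • A) := by
    rintro ⟨c, hc : 0 < c⟩ ⟨d, hd : 0 < d⟩ hcd
    refine Set.disjoint_left.2 ?_
    rintro _ ⟨x, hx, rfl⟩ ⟨x', hx', hxx⟩
    simp only at hxx
    have e : x' = (d⁻¹ * c) • x := by
      rw [mul_smul, ← hxx, smul_smul, inv_mul_cancel₀ hd.ne', one_smul]
    have := h x hx (d⁻¹ * c) (by positivity) (e ▸ hx')
    apply hcd
    rw [inv_mul_eq_one₀ hd.ne'] at this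
    exact Subtype.ext this.symm
  have hc := Measure.countable_meas_pos_of_disjoint_iUnion (μ := μ)
    (fun c : Ioi (0 : ℝ) => hA.const_smul_of_ne_zero (ne_of_gt (mem_Ioi.1 c.2))) hdis
  have hu : {c : Ioi (0 : ℝ) | 0 < μ ((c : ℝ) • A)} = univ := by
    refine eq_univ_of_forall fun c => ?_
    rw [mem_ofPred_eq, Measure.addHaar_smul]
    refine ENNReal.mul_pos ?_ h0
    simpa using fun h => absurd h (ne_of_gt (mem_Ioi.1 c.2))
  rw [hu] at hc
  have h2 : (Ioi (0 : ℝ)).Countable := by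
    rw [Set.countable_univ_iff] at hc
    exact hc
  exact absurd (h2.measure_zero volume) (by simp)

theorem pi_null_of_forall_update {E : Type*} [MeasurableSpace E] {n : ℕ} {μ : Measure E}
    [SigmaFinite μ] {A : Set (Fin n → E)} (hA : MeasurableSet A) (s : Fin n)
    (h : ∀ y, μ {x | Function.update y s x ∈ A} = 0) : (Measure.pi fun _ : Fin n => μ) A = 0 := by
  classical
  rcases isEmpty_or_nonempty (Fin n → E) with he | ⟨⟨y₀⟩⟩
  · rw [Set.eq_empty_of_isEmpty A, measure_empty]
  have hm : Measurable (A.indicator (1 : (Fin n → E) → ENNReal)) := measurable_one.indicator hA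
  rw [← lintegral_indicator_one hA, lintegral_eq_lmarginal_univ y₀,
    lmarginal_erase' _ hm (Finset.mem_univ s)]
  have e : (fun y : Fin n → E => ∫⁻ x, A.indicator 1 (Function.update y s x) ∂μ) = fun _ => 0 := by
    funext y
    rw [← h y]
    exact lintegral_indicator_one (measurable_update y hA)
  rw [e]
  simp [lmarginal]

theorem IsNearRoot.det_ne_zero {k n : ℕ} {S : Matrix (Fin k) (Fin k) ℝ} (hS : IsUpperPos S) {ρ : ℝ}
    {R : (Fin n → EuclideanSpace ℝ (Fin k)) → Matrix (Fin k) (Fin k) ℝ} (hR : IsNearRoot S ρ R)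
    (y : Fin n → EuclideanSpace ℝ (Fin k)) : (R y).det ≠ 0 := by
  obtain ⟨T, hT, -, e⟩ := hR.near y
  rw [e, Matrix.det_mul]
  exact mul_ne_zero hT.det_pos.ne' hS.det_pos.ne'

/-- `R` does not change when `y s` is multiplied by `c > 0`. Along a ray of values of `y s` one norm
is thus proportional to `c` while the other is constant, so they agree at most once. -/
theorem IsNearRoot.measure_tie {k n : ℕ} (hk : 1 ≤ k) {S : Matrix (Fin k) (Fin k) ℝ}
    (hS : IsUpperPos S) {ρ : ℝ}
    {R : (Fin n → EuclideanSpace ℝ (Fin k)) → Matrix (Fin k) (Fin k) ℝ} (hR : IsNearRoot S ρ R)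
    {μ : Measure (EuclideanSpace ℝ (Fin k))} [SigmaFinite μ] (hμ : μ ≪ volume) {s t : Fin n}
    (hst : s ≠ t) :
    (Measure.pi fun _ : Fin n => μ) {y | ‖Matrix.toEuclideanLin (R y) (y s)‖
      = ‖Matrix.toEuclideanLin (R y) (y t)‖} = 0 := by
  have hm : ∀ s, Measurable fun y : Fin n → EuclideanSpace ℝ (Fin k) =>
      ‖Matrix.toEuclideanLin (R y) (y s)‖ := fun s =>
    (measurable_toEuclideanLin_apply hR.measurable (measurable_pi_apply s)).norm
  have hA := measurableSet_eq_fun (hm s) (hm t)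
  refine pi_null_of_forall_update hA s fun y => hμ ?_
  have hne : Nonempty (Fin k) := ⟨⟨0, hk⟩⟩
  have hAy := measurable_update y (a := s) hA
  rw [← measure_sdiff_null (measure_singleton (μ := volume) (0 : EuclideanSpace ℝ (Fin k)))]
  refine addHaar_eq_zero_of_disjoint_dilates volume (hAy.diff (measurableSet_singleton _)) ?_
  rintro x ⟨hx, hx0 : x ≠ 0⟩ c hc ⟨hcx, -⟩
  have e := hR.update (Function.update y s x) s c hc
  simp only [Function.update_self, Function.update_idem] at e
  simp only [mem_ofPred_eq, e, Function.update_self, map_smul, norm_smul,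
    Function.update_of_ne hst.symm] at hx hcx
  rw [← hx, Real.norm_of_nonneg hc.le] at hcx
  have := norm_pos_iff.2 (toEuclideanLin_ne_zero
    (hR.det_ne_zero hS (Function.update y s x)) hx0)
  exact mul_right_cancel₀ this.ne' (hcx.trans (one_mul _).symm)

/-! ### Rank-based and exact score statistics -/

/-- The rank of `‖C y_s‖` among `‖C y_1‖, …, ‖C y_n‖`. -/
def normRank {k n : ℕ} (C : Matrix (Fin k) (Fin k) ℝ) (y : Fin n → EuclideanSpace ℝ (Fin k))
    (s : Fin n) : ℕ :=
  (Finset.univ.filter fun t =>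
    ‖Matrix.toEuclideanLin C (y t)‖ ≤ ‖Matrix.toEuclideanLin C (y s)‖).card

/-- The score of the rank of `y_s`, times the coordinate of its direction along `l`. -/
def rankStat {k n : ℕ} (K : ℝ → ℝ) (l : Fin k → ℝ) (C : Matrix (Fin k) (Fin k) ℝ)
    (y : Fin n → EuclideanSpace ℝ (Fin k)) (s : Fin n) : ℝ :=
  K ((normRank C y s : ℝ) / (n + 1)) * (l ⬝ᵥ (direction C (y s)).ofLp)

/-- The exact counterpart of `rankStat`. -/
def exactStat {k : ℕ} (K : ℝ → ℝ) (l : Fin k → ℝ) (Sig : Matrix (Fin k) (Fin k) ℝ) (f : ℝ → ℝ)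
    (z : EuclideanSpace ℝ (Fin k)) : ℝ :=
  K (radialCdf k f (scatterNorm Sig z)) * (l ⬝ᵥ (direction (invSqrt Sig) z).ofLp)

section

variable {k n : ℕ} (C : Matrix (Fin k) (Fin k) ℝ) (y : Fin n → EuclideanSpace ℝ (Fin k))

theorem normRank_mem (s : Fin n) : normRank C y s ∈ Finset.Icc 1 n := by
  rw [Finset.mem_Icc]
  constructor
  · exact Finset.card_pos.2 ⟨s, by simp⟩
  · exact (Finset.card_filter_le _ _).trans (by simp)

theorem normRank_div_mem (s : Fin n) : (normRank C y s : ℝ) / (n + 1) ∈ Ioo (0 : ℝ) 1 := by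
  have h := Finset.mem_Icc.1 (normRank_mem C y s)
  have h1 : (1 : ℝ) ≤ normRank C y s := by exact_mod_cast h.1
  have h2 : (normRank C y s : ℝ) ≤ n := by exact_mod_cast h.2
  exact ⟨by positivity, by rw [div_lt_one (by positivity)]; linarith⟩

variable {C y} in
theorem normRank_injective (h : ∀ s t, s ≠ t →
    ‖Matrix.toEuclideanLin C (y s)‖ ≠ ‖Matrix.toEuclideanLin C (y t)‖) :
    Function.Injective (normRank C y) := by
  have key : ∀ s t, ‖Matrix.toEuclideanLin C (y s)‖ < ‖Matrix.toEuclideanLin C (y t)‖ →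
      normRank C y s < normRank C y t := by
    intro s t hst
    refine Finset.card_lt_card ((Finset.ssubset_iff_of_subset ?_).2 ⟨t, by simp, by simpa using hst⟩)
    intro r hr
    simp only [Finset.mem_filter, Finset.mem_univ, true_and] at hr ⊢
    exact hr.trans hst.le
  intro s t hst
  by_contra hne
  rcases lt_or_gt_of_ne (h s t hne) with h1 | h1
  · exact absurd hst (key _ _ h1).ne
  · exact absurd hst (key _ _ h1).ne'

theorem norm_flip (r t : Fin n) : ‖Matrix.toEuclideanLin C (if t = r then -y t else y t)‖
    = ‖Matrix.toEuclideanLin C (y t)‖ := by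
  split_ifs <;> simp

theorem rankStat_flip (K : ℝ → ℝ) (l : Fin k → ℝ) (r s : Fin n) :
    rankStat K l C (fun t => if t = r then -y t else y t) s
      = (if s = r then -1 else 1) * rankStat K l C y s := by
  have h : normRank C (fun t => if t = r then -y t else y t) s = normRank C y s := by
    simp only [normRank, norm_flip]
  rw [rankStat, rankStat, h]
  split_ifs <;> simp [direction_neg]

theorem exactStat_neg (K : ℝ → ℝ) (l : Fin k → ℝ) (Sig : Matrix (Fin k) (Fin k) ℝ) (f : ℝ → ℝ)
    (z : EuclideanSpace ℝ (Fin k)) : exactStat K l Sig f (-z) = -exactStat K l Sig f z := by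
  have : scatterNorm Sig (-z) = scatterNorm Sig z := by
    simp [scatterNorm, Matrix.mulVec_neg]
  rw [exactStat, exactStat, this]
  simp [direction_neg]

theorem rankStat_perm (K : ℝ → ℝ) (l : Fin k → ℝ) (π : Equiv.Perm (Fin n)) (s : Fin n) :
    rankStat K l C (y ∘ π) s = rankStat K l C y (π s) := by
  have h : normRank C (y ∘ π) s = normRank C y (π s) := by
    refine Finset.card_bij' (fun t _ => π t) (fun t _ => π.symm t) ?_ ?_ ?_ ?_ <;> simp
  rw [rankStat, rankStat, h]
  rfl

theorem abs_dotProduct_le {l v : Fin k → ℝ} {L m : ℝ} (hl : ∀ c, |l c| ≤ L) (hv : ∀ c, |v c| ≤ m) :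
    |l ⬝ᵥ v| ≤ k * (L * m) := by
  refine (Finset.abs_sum_le_sum_abs _ _).trans ?_
  refine (Finset.sum_le_card_nsmul _ _ (L * m) fun c _ => ?_).trans (by simp)
  rw [abs_mul]
  exact mul_le_mul (hl c) (hv c) (abs_nonneg _) ((abs_nonneg _).trans (hl c))

theorem norm_direction_mul_sub_le {S T : Matrix (Fin k) (Fin k) ℝ} (hS : S.det ≠ 0) {ρ : ℝ}
    (hT : ∀ a b, |T a b - (1 : Matrix (Fin k) (Fin k) ℝ) a b| ≤ ρ) (z : EuclideanSpace ℝ (Fin k))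
    (hz : z ≠ 0) (hTd : T.det ≠ 0) :
    ‖direction (T * S) z - direction S z‖ ≤ 2 * (k * ρ) := by
  set u := direction S z with hu
  have hu1 : ‖u‖ = 1 := norm_direction hS hz
  have h1 := abs_norm_toEuclideanLin_sub_le hT u
  have h2 : ‖Matrix.toEuclideanLin T u - u‖ ≤ k * ρ * ‖u‖ := by
    have : Matrix.toEuclideanLin T u - u = Matrix.toEuclideanLin (T - 1) u := by
      rw [map_sub, LinearMap.sub_apply, toEuclideanLin_one_apply]
    rw [this]
    exact norm_toEuclideanLin_le (fun a b => by simpa using hT a b) u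
  rw [hu1, mul_one] at h1 h2
  have hu0 : u ≠ 0 := by
    intro h; rw [h, norm_zero] at hu1; exact zero_ne_one hu1
  have hTu := norm_pos_iff.2 (toEuclideanLin_ne_zero hTd hu0)
  rw [direction_mul, ← hu]
  have h3 : ‖direction T u - Matrix.toEuclideanLin T u‖ ≤ k * ρ := by
    have : direction T u - Matrix.toEuclideanLin T u
        = (‖Matrix.toEuclideanLin T u‖⁻¹ - 1) • Matrix.toEuclideanLin T u := by
      rw [sub_smul, one_smul, direction]
    rw [this, norm_smul, Real.norm_eq_abs, ← abs_of_pos hTu, ← abs_mul, sub_mul,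
      abs_of_pos hTu, inv_mul_cancel₀ hTu.ne', one_mul, abs_sub_comm]
    exact h1
  calc ‖direction T u - u‖ ≤ ‖direction T u - Matrix.toEuclideanLin T u‖
        + ‖Matrix.toEuclideanLin T u - u‖ := norm_sub_le_norm_sub_add_norm_sub _ _ _
    _ ≤ 2 * (k * ρ) := by linarith

end

theorem measurable_rankStat {k n : ℕ} {K : ℝ → ℝ} (hK : Measurable K)
    {R : (Fin n → EuclideanSpace ℝ (Fin k)) → Matrix (Fin k) (Fin k) ℝ}
    (hR : ∀ a b, Measurable fun y => R y a b)
    {l : (Fin n → EuclideanSpace ℝ (Fin k)) → Fin k → ℝ} (hl : ∀ c, Measurable fun y => l y c)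
    (s : Fin n) : Measurable fun y => rankStat K (l y) (R y) y s := by
  refine Measurable.mul ?_ ?_
  · refine hK.comp (Measurable.div_const ?_ _)
    have : ∀ y : Fin n → EuclideanSpace ℝ (Fin k), (normRank (R y) y s : ℝ)
        = ∑ t, if ‖Matrix.toEuclideanLin (R y) (y t)‖ ≤ ‖Matrix.toEuclideanLin (R y) (y s)‖
          then (1 : ℝ) else 0 := by
      intro y
      rw [normRank, Finset.sum_boole]
    simp only [this]
    have hm : ∀ s, Measurable fun y : Fin n → EuclideanSpace ℝ (Fin k) =>
        ‖Matrix.toEuclideanLin (R y) (y s)‖ := fun s =>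
      (measurable_toEuclideanLin_apply hR (measurable_pi_apply s)).norm
    exact Finset.measurable_fun_sum _ fun t _ =>
      Measurable.ite (measurableSet_le (hm t) (hm s)) measurable_const measurable_const
  · exact Finset.measurable_fun_sum _ fun c _ => (hl c).mul
      ((measurable_ofLp_apply c).comp (measurable_direction_apply hR (measurable_pi_apply s)))

theorem IsRadialDensity.measurable_radialCdf_scatterNorm {k : ℕ} {f : ℝ → ℝ}
    (hf : IsRadialDensity k f) {Sig : Matrix (Fin k) (Fin k) ℝ} (hSig : Sig.PosDef) :
    Measurable fun z => radialCdf k f (scatterNorm Sig z) :=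
  hf.continuous_radialCdf.measurable.comp (measurable_scatterNorm hSig)

theorem measurable_exactStat {k : ℕ} {K : ℝ → ℝ} (hK : Measurable K) (l : Fin k → ℝ)
    {Sig : Matrix (Fin k) (Fin k) ℝ} (hSig : Sig.PosDef) {f : ℝ → ℝ} (hf : IsRadialDensity k f) :
    Measurable fun z => exactStat K l Sig f z :=
  (hK.comp (hf.measurable_radialCdf_scatterNorm hSig)).mul
    (Finset.measurable_fun_sum _ fun c _ =>
      ((measurable_ofLp_apply c).comp (measurable_direction _)).const_mul _)

/-! ### Probability bounds for averages -/

/-- Markov's inequality for empirical averages. -/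
theorem measure_avg_gt_le {E : Type*} [MeasurableSpace E] (μ : Measure E) [IsProbabilityMeasure μ]
    {g : E → ℝ} (hg : Integrable g μ) (hg0 : ∀ x, 0 ≤ g x) {c : ℝ} (hc : 0 < c) (n : ℕ) :
    (Measure.pi fun _ : Fin n => μ) {y | c < (n : ℝ)⁻¹ * ∑ t, g (y t)}
      ≤ ENNReal.ofReal ((∫ x, g x ∂μ) / c) := by
  rcases Nat.eq_zero_or_pos n with rfl | hn
  · have : {y : Fin 0 → E | c < ((0 : ℕ) : ℝ)⁻¹ * ∑ t, g (y t)} = ∅ := by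
      ext y; simp [hc.le]
    rw [this, measure_empty]; exact zero_le
  have hn0 : (0 : ℝ) < n := by exact_mod_cast hn
  have hint : ∀ t : Fin n, Integrable (fun y : Fin n → E => g (y t))
      (Measure.pi fun _ : Fin n => μ) := fun t =>
    (measurePreserving_eval (fun _ : Fin n => μ) t).integrable_comp_of_integrable hg
  have hE : ∫ y, (n : ℝ)⁻¹ * ∑ t, g (y t) ∂(Measure.pi fun _ : Fin n => μ) = ∫ x, g x ∂μ := by
    rw [integral_const_mul, integral_finsetSum _ fun t _ => hint t]
    simp [integral_comp_eval (μ := fun _ : Fin n => μ) hg.aestronglyMeasurable, hn0.ne']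
  have hI := (integrable_finsetSum Finset.univ fun t _ => hint t).const_mul ((n : ℝ)⁻¹)
  have := mul_meas_ge_le_integral_of_nonneg (μ := Measure.pi fun _ : Fin n => μ)
    (f := fun y => (n : ℝ)⁻¹ * ∑ t, g (y t))
    (ae_of_all _ fun y => mul_nonneg (by positivity) (Finset.sum_nonneg fun t _ => hg0 _)) hI c
  rw [hE] at this
  refine (measure_mono (t := {y : Fin n → E | c ≤ (n : ℝ)⁻¹ * ∑ t, g (y t)}) fun y (hy : c < _) => hy.le).trans ?_
  rw [← ofReal_measureReal]
  exact ENNReal.ofReal_le_ofReal (by rw [le_div_iff₀' hc]; exact this)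

section

variable {k : ℕ} {Sig : Matrix (Fin k) (Fin k) ℝ} {f : ℝ → ℝ}

theorem integral_comp_radialCdf (hk : 1 ≤ k) (hSig : Sig.PosDef) (hf : IsRadialDensity k f)
    [IsProbabilityMeasure (ellipticLaw Sig f)] {g : ℝ → ℝ} (hg : Measurable g) :
    ∫ z, g (radialCdf k f (scatterNorm Sig z)) ∂(ellipticLaw Sig f) = ∫ u in Ioo (0 : ℝ) 1, g u := by
  rw [← map_radialCdf_ellipticLaw hk hSig hf, integral_map
    (hf.measurable_radialCdf_scatterNorm hSig).aemeasurable hg.aestronglyMeasurable]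

theorem integrable_comp_radialCdf (hk : 1 ≤ k) (hSig : Sig.PosDef) (hf : IsRadialDensity k f)
    [IsProbabilityMeasure (ellipticLaw Sig f)] {g : ℝ → ℝ} (hg : IntegrableOn g (Ioo 0 1)) :
    Integrable (fun z => g (radialCdf k f (scatterNorm Sig z))) (ellipticLaw Sig f) := by
  rw [IntegrableOn, ← map_radialCdf_ellipticLaw hk hSig hf] at hg
  exact hg.comp_measurable (hf.measurable_radialCdf_scatterNorm hSig)

/-- The averages of the squares of the exact statistics are bounded in probability. -/
theorem exists_measure_avg_exactStat_sq_le (hk : 1 ≤ k) (hSig : Sig.PosDef)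
    (hf : IsRadialDensity k f) [IsProbabilityMeasure (ellipticLaw Sig f)] {K : ℝ → ℝ}
    (hK : IsScore K) (hKm : Measurable K) (l : Fin k → ℝ) {tol : ℝ} (htol : 0 < tol) :
    ∃ M > 0, ∀ n : ℕ, (Measure.pi fun _ : Fin n => ellipticLaw Sig f)
      {y | M < (n : ℝ)⁻¹ * ∑ t, exactStat K l Sig f (y t) ^ 2} ≤ ENNReal.ofReal tol := by
  have hI : Integrable (fun z => exactStat K l Sig f z ^ 2) (ellipticLaw Sig f) := by
    have hl : ∀ c, |l c| ≤ ∑ c, |l c| := fun c =>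
      Finset.single_le_sum (f := fun c => |l c|) (fun c _ => abs_nonneg _) (Finset.mem_univ c)
    refine Integrable.mono' ((integrable_comp_radialCdf hk hSig hf hK.integrableOn_sq).const_mul
      ((k * ((∑ c, |l c|) * 1)) ^ 2))
      ((measurable_exactStat hKm l hSig hf).pow_const 2).aestronglyMeasurable
      (ae_of_all _ fun z => ?_)
    rw [Real.norm_of_nonneg (sq_nonneg _), exactStat, mul_pow, mul_comm]
    refine mul_le_mul_of_nonneg_right ?_ (sq_nonneg _)
    rw [← sq_abs (l ⬝ᵥ _)]
    exact pow_le_pow_left₀ (abs_nonneg _) (abs_dotProduct_le hl fun c =>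
      abs_direction_apply_le _ _ c) 2
  set I := ∫ z, exactStat K l Sig f z ^ 2 ∂(ellipticLaw Sig f) with hIdef
  have hI0 : 0 ≤ I := integral_nonneg fun z => sq_nonneg _
  refine ⟨(I + 1) / tol, by positivity, fun n => ?_⟩
  refine (measure_avg_gt_le _ hI (fun z => sq_nonneg _) (by positivity) n).trans
    (ENNReal.ofReal_le_ofReal ?_)
  rw [← hIdef, div_div_eq_mul_div, div_le_iff₀ (by positivity)]
  nlinarith

end

/-! ### Approximation of exact statistics by rank statistics -/

theorem IsNearRoot.mono {k n : ℕ} {S : Matrix (Fin k) (Fin k) ℝ} {ρ ρ' : ℝ} (h : ρ ≤ ρ')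
    {R : (Fin n → EuclideanSpace ℝ (Fin k)) → Matrix (Fin k) (Fin k) ℝ} (hR : IsNearRoot S ρ R) :
    IsNearRoot S ρ' R :=
  ⟨hR.measurable, hR.flip, hR.perm, hR.update, fun y => by
    obtain ⟨T, h1, h2, h3⟩ := hR.near y
    exact ⟨T, h1, fun a b => (h2 a b).trans_le h, h3⟩⟩

theorem avg_sq_mul_sub_mul_le {n : ℕ} (x x' w w' : Fin n → ℝ) {η L : ℝ}
    (hw : ∀ s, |w s - w' s| ≤ η) (hL : ∀ s, |w' s| ≤ L) :
    (n : ℝ)⁻¹ * ∑ s, (x s * w s - x' s * w' s) ^ 2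
      ≤ 2 * η ^ 2 * ((n : ℝ)⁻¹ * ∑ s, x s ^ 2)
        + 2 * L ^ 2 * ((n : ℝ)⁻¹ * ∑ s, (x s - x' s) ^ 2) := by
  have h : ∀ s, (x s * w s - x' s * w' s) ^ 2
      ≤ 2 * η ^ 2 * x s ^ 2 + 2 * L ^ 2 * (x s - x' s) ^ 2 := by
    intro s
    have h1 : (w s - w' s) ^ 2 ≤ η ^ 2 := sq_le_sq' (abs_le.1 (hw s)).1 (abs_le.1 (hw s)).2
    have h2 : w' s ^ 2 ≤ L ^ 2 := sq_le_sq' (abs_le.1 (hL s)).1 (abs_le.1 (hL s)).2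
    calc (x s * w s - x' s * w' s) ^ 2
        = (x s * (w s - w' s) + (x s - x' s) * w' s) ^ 2 := by ring
      _ ≤ 2 * (x s * (w s - w' s)) ^ 2 + 2 * ((x s - x' s) * w' s) ^ 2 := by
          nlinarith [sq_nonneg (x s * (w s - w' s) - (x s - x' s) * w' s)]
      _ = 2 * (w s - w' s) ^ 2 * x s ^ 2 + 2 * w' s ^ 2 * (x s - x' s) ^ 2 := by ring
      _ ≤ _ := add_le_add
          (mul_le_mul_of_nonneg_right (by linarith) (sq_nonneg _))
          (mul_le_mul_of_nonneg_right (by linarith) (sq_nonneg _))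
  calc (n : ℝ)⁻¹ * ∑ s, (x s * w s - x' s * w' s) ^ 2
      ≤ (n : ℝ)⁻¹ * ∑ s, (2 * η ^ 2 * x s ^ 2 + 2 * L ^ 2 * (x s - x' s) ^ 2) :=
        mul_le_mul_of_nonneg_left (Finset.sum_le_sum fun s _ => h s) (by positivity)
    _ = _ := by
        rw [Finset.sum_add_distrib, ← Finset.mul_sum, ← Finset.mul_sum]; ring

section

variable {k : ℕ} {Sig : Matrix (Fin k) (Fin k) ℝ} {f : ℝ → ℝ}

theorem pi_ae_ne_zero (hk : 1 ≤ k) [IsProbabilityMeasure (ellipticLaw Sig f)] (n : ℕ) :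
    ∀ᵐ y ∂(Measure.pi fun _ : Fin n => ellipticLaw Sig f), ∀ t, y t ≠ 0 :=
  ae_all_iff.2 fun t =>
    (measurePreserving_eval (fun _ : Fin n => ellipticLaw Sig f) t).quasiMeasurePreserving.ae
      (ae_ne_zero_ellipticLaw hk)

theorem IsNearRoot.ae_no_tie (hk : 1 ≤ k) (hSig : Sig.PosDef)
    [IsProbabilityMeasure (ellipticLaw Sig f)] {n : ℕ} {ρ : ℝ}
    {R : (Fin n → EuclideanSpace ℝ (Fin k)) → Matrix (Fin k) (Fin k) ℝ}
    (hR : IsNearRoot (invSqrt Sig) ρ R) :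
    ∀ᵐ y ∂(Measure.pi fun _ : Fin n => ellipticLaw Sig f), ∀ s t, s ≠ t →
      ‖Matrix.toEuclideanLin (R y) (y s)‖ ≠ ‖Matrix.toEuclideanLin (R y) (y t)‖ := by
  refine ae_all_iff.2 fun s => ae_all_iff.2 fun t => ?_
  by_cases hst : s = t
  · exact ae_of_all _ fun y h => absurd hst h
  have := hR.measure_tie hk (invSqrt_spec hSig).1 (ellipticLaw_ac Sig f) hst
  filter_upwards [measure_eq_zero_iff_ae_notMem.1 this] with y hy _ using hy

/-- In the application `l C` is a row of `Cᵀ` or of `C⁻¹`; `hl` is its continuity at `Σ^{-1/2}`. -/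
theorem exists_rankStat_close (hk : 1 ≤ k) (hSig : Sig.PosDef)
    {l : Matrix (Fin k) (Fin k) ℝ → Fin k → ℝ}
    (hl : ∀ η > 0, ∃ ρ > 0, ∀ T : Matrix (Fin k) (Fin k) ℝ, IsUpperPos T →
      (∀ a b, |T a b - (1 : Matrix (Fin k) (Fin k) ℝ) a b| < ρ) →
      ∀ c, |l (T * invSqrt Sig) c - l (invSqrt Sig) c| ≤ η) {η : ℝ} (hη : 0 < η) :
    ∃ ρ > 0, ∀ T : Matrix (Fin k) (Fin k) ℝ, IsUpperPos T →
      (∀ a b, |T a b - (1 : Matrix (Fin k) (Fin k) ℝ) a b| < ρ) → ∀ z ≠ 0,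
      |l (T * invSqrt Sig) ⬝ᵥ (direction (T * invSqrt Sig) z).ofLp
        - l (invSqrt Sig) ⬝ᵥ (direction (invSqrt Sig) z).ofLp| ≤ η := by
  have hk0 : (0 : ℝ) < k := by positivity
  set S := invSqrt Sig with hS
  have hSd := (invSqrt_spec hSig).1.det_pos.ne'
  set L : ℝ := ∑ c, |l S c| with hL
  have hL0 : 0 ≤ L := Finset.sum_nonneg fun c _ => abs_nonneg _
  have hlL : ∀ c, |l S c| ≤ L := fun c =>
    Finset.single_le_sum (f := fun c => |l S c|) (fun c _ => abs_nonneg _) (Finset.mem_univ c)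
  obtain ⟨ρ₁, hρ₁, h1⟩ := hl (η / (2 * k)) (by positivity)
  refine ⟨min ρ₁ (η / (4 * k ^ 2 * (L + 1))), lt_min hρ₁ (by positivity), fun T hTu hT z hz => ?_⟩
  set ρ := min ρ₁ (η / (4 * k ^ 2 * (L + 1))) with hρ
  have hρ2 : 4 * k ^ 2 * (L + 1) * ρ ≤ η := by
    have := min_le_right ρ₁ (η / (4 * k ^ 2 * (L + 1)))
    rw [← hρ, le_div_iff₀ (by positivity)] at this
    linarith
  have hρ0 : 0 ≤ ρ := le_min hρ₁.le (by positivity)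
  have hd := norm_direction_mul_sub_le hSd (fun a b => (hT a b).le) z hz hTu.det_pos.ne'
  have hlT := h1 T hTu fun a b => (hT a b).trans_le (min_le_left _ _)
  set v := (direction (T * S) z).ofLp with hv
  set u := (direction S z).ofLp with hu
  have e : l (T * S) ⬝ᵥ v - l S ⬝ᵥ u = (l (T * S) - l S) ⬝ᵥ v + l S ⬝ᵥ (v - u) := by
    rw [sub_dotProduct, dotProduct_sub]; ring
  have b1 : |(l (T * S) - l S) ⬝ᵥ v| ≤ k * (η / (2 * k) * 1) :=
    abs_dotProduct_le (fun c => hlT c) fun c => abs_direction_apply_le _ _ c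
  have b2 : |l S ⬝ᵥ (v - u)| ≤ k * (L * (2 * (k * ρ))) :=
    abs_dotProduct_le hlL fun c => (abs_apply_le_norm (direction (T * S) z - direction S z) c).trans hd
  rw [e]
  refine (abs_add_le _ _).trans ((add_le_add b1 b2).trans ?_)
  have : k * (η / (2 * k) * 1) = η / 2 := by field_simp
  rw [this]
  nlinarith [mul_nonneg (sq_nonneg (k : ℝ)) hρ0]

theorem IsRadialDensity.radialCdf_nonneg {f : ℝ → ℝ} (hf : IsRadialDensity k f) (x : ℝ) :
    0 ≤ radialCdf k f x := by
  rcases le_or_gt x 0 with hx | hx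
  · exact (setIntegral_eq_zero_of_forall_eq_zero fun r hr => if_neg (not_lt.2 (le_trans hr hx))).ge
  · exact (hf.radialCdf_mem hx).1.le

theorem tendsto_measure_empiricalCdf (hk : 1 ≤ k) (hSig : Sig.PosDef)
    (hf : IsRadialDensity k f) [IsProbabilityMeasure (ellipticLaw Sig f)] (x : ℝ) {η : ℝ}
    (hη : 0 < η) :
    Tendsto (fun n : ℕ => (Measure.pi fun _ : Fin n => ellipticLaw Sig f)
      {y | η < |(n : ℝ)⁻¹ * ∑ t, (if scatterNorm Sig (y t) ≤ x then (1 : ℝ) else 0)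
        - radialCdf k f x|}) atTop (𝓝 0) := by
  have hm := measurableSet_le (measurable_scatterNorm hSig) (measurable_const (a := x))
  have hgI : ∫ z, (if scatterNorm Sig z ≤ x then (1 : ℝ) else 0) ∂(ellipticLaw Sig f)
      = radialCdf k f x := by
    have : (fun z => if scatterNorm Sig z ≤ x then (1 : ℝ) else 0)
        = {z | scatterNorm Sig z ≤ x}.indicator 1 := by
      funext z; simp [Set.indicator_apply]
    rw [this, integral_indicator_one hm, measureReal_def, ellipticLaw_scatterNorm_le hk hSig hf,
      ENNReal.toReal_ofReal (hf.radialCdf_nonneg x)]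
  have := tendsto_measure_avg_sub (ellipticLaw Sig f)
    (g := fun z => if scatterNorm Sig z ≤ x then (1 : ℝ) else 0)
    (Measurable.ite hm measurable_const measurable_const) (c := 1)
    (fun z => by split_ifs <;> simp) hη
  simpa only [hgI] using this

theorem measure_le_sum_add {α ι : Type*} [MeasurableSpace α] {ν : Measure α} {A D : Set α}
    {J : Finset ι} {B : ι → Set α}
    (h : ∀ᵐ y ∂ν, y ∈ A → (∃ x ∈ J, y ∈ B x) ∨ y ∈ D) : ν A ≤ ∑ x ∈ J, ν (B x) + ν D := by
  refine (measure_mono_ae (t := (⋃ x ∈ J, B x) ∪ D) ?_).trans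
    ((measure_union_le _ _).trans (add_le_add (measure_biUnion_finset_le J B) le_rfl))
  filter_upwards [h] with y hy hA
  exact (hy hA).imp (fun ⟨x, hx, hxB⟩ => mem_iUnion₂.2 ⟨x, hx, hxB⟩) id

/-- The square of the score in the tails. -/
def tailScore (K : ℝ → ℝ) (τ : ℝ) : ℝ → ℝ := (tailSet τ).indicator fun u => K u ^ 2

/-- The deterministic half of the consistency proof: closeness of the root, a finite grid of
empirical frequencies and one tail average control everything. The bound `c₀ * tol` is shaped for
Markov's inequality at level `c₀`. -/
theorem exists_avg_rankStat_sub_le (hk : 1 ≤ k) (hSig : Sig.PosDef)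
    (hf : IsRadialDensity k f) {K : ℝ → ℝ}
    (hK : IsScore K) {l : Matrix (Fin k) (Fin k) ℝ → Fin k → ℝ}
    (hl : ∀ η > 0, ∃ ρ > 0, ∀ T : Matrix (Fin k) (Fin k) ℝ, IsUpperPos T →
      (∀ a b, |T a b - (1 : Matrix (Fin k) (Fin k) ℝ) a b| < ρ) →
      ∀ c, |l (T * invSqrt Sig) c - l (invSqrt Sig) c| ≤ η) {ε tol : ℝ} (hε : 0 < ε)
    (htol : 0 < tol) :
    ∃ c₀ > 0, ∃ τ, ∫ u in tailSet τ, K u ^ 2 ≤ c₀ * tol ∧ ∃ J : Finset ℝ, ∃ η > 0,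
      ∃ ρ > 0, ∃ N, ∀ n ≥ N, ∀ (C T : Matrix (Fin k) (Fin k) ℝ)
      (y : Fin n → EuclideanSpace ℝ (Fin k)), C = T * invSqrt Sig → IsUpperPos T →
      (∀ a b, |T a b - (1 : Matrix (Fin k) (Fin k) ℝ) a b| < ρ) → (∀ t, y t ≠ 0) →
      (∀ s t, s ≠ t → ‖Matrix.toEuclideanLin C (y s)‖ ≠ ‖Matrix.toEuclideanLin C (y t)‖) →
      (∀ x ∈ J, |(n : ℝ)⁻¹ * ∑ t, (if scatterNorm Sig (y t) ≤ x then (1 : ℝ) else 0)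
        - radialCdf k f x| ≤ η) →
      (n : ℝ)⁻¹ * ∑ t, tailScore K τ (radialCdf k f (scatterNorm Sig (y t))) ≤ c₀ →
      (n : ℝ)⁻¹ * ∑ t, (rankStat K (l C) C y t
          - exactStat K (l (invSqrt Sig)) Sig f (y t)) ^ 2 ≤ ε := by
  have hk0 : (0 : ℝ) < k := by positivity
  have hSd := (invSqrt_spec hSig).1.det_pos.ne'
  obtain ⟨L', hL'0, hwL⟩ : ∃ L' : ℝ, 0 < L' ∧ ∀ z : EuclideanSpace ℝ (Fin k),
      |l (invSqrt Sig) ⬝ᵥ (direction (invSqrt Sig) z).ofLp| ≤ L' := by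
    have hlL : ∀ c, |l (invSqrt Sig) c| ≤ ∑ c, |l (invSqrt Sig) c| := fun c =>
      Finset.single_le_sum (f := fun c => |l (invSqrt Sig) c|) (fun c _ => abs_nonneg _)
        (Finset.mem_univ c)
    have : 0 ≤ ∑ c, |l (invSqrt Sig) c| := Finset.sum_nonneg fun c _ => abs_nonneg _
    exact ⟨k * ((∑ c, |l (invSqrt Sig) c|) * 1) + 1, by positivity, fun z =>
      (abs_dotProduct_le hlL fun c => abs_direction_apply_le _ _ c).trans (by linarith)⟩
  -- `5 c₀` bounds `3 ε' + 2 c₀`, the error of the scores. This takes half of `ε`; the error of the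
  -- directions, through `η₂`, takes the other half.
  obtain ⟨c₀, hc₀0, hc₀L⟩ : ∃ c₀ : ℝ, 0 < c₀ ∧ 2 * L' ^ 2 * (5 * c₀) = ε / 2 :=
    ⟨ε / (20 * L' ^ 2), by positivity, by field_simp; ring⟩
  obtain ⟨ε', hε'0, hε'c, hε't⟩ : ∃ ε' : ℝ, 0 < ε' ∧ ε' ≤ c₀ ∧ ε' ≤ c₀ * tol :=
    ⟨min c₀ (c₀ * tol), lt_min hc₀0 (by positivity), min_le_left _ _, min_le_right _ _⟩
  obtain ⟨τ, η, hη, hτ, N₁, hN₁⟩ := hK.avg_sq_sub_le hε'0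
  obtain ⟨J, e, he, η', hη', N₂, hN₂⟩ := hf.rank_close hη
  obtain ⟨M, hM0, hM⟩ := hK.exists_avg_sq_bound
  obtain ⟨η₂, hη₂0, hη₂M⟩ : ∃ η₂ : ℝ, 0 < η₂ ∧ 2 * η₂ ^ 2 * M ≤ ε / 2 := by
    refine ⟨√(ε / (4 * (M + 1))), Real.sqrt_pos.2 (by positivity), ?_⟩
    rw [Real.sq_sqrt (by positivity)]
    have : ε / (4 * (M + 1)) * (M + 1) = ε / 4 := by field_simp
    nlinarith [show 0 ≤ ε / (4 * (M + 1)) by positivity]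
  obtain ⟨ρ₁, hρ₁, hclose⟩ := exists_rankStat_close hk hSig hl hη₂0
  refine ⟨c₀, hc₀0, τ, hτ.trans hε't, J, η', hη', min ρ₁ (e / k), lt_min hρ₁ (by positivity),
    max (max N₁ N₂) 1, fun n hn C T y hC hTu hT hy0 hyt hyJ hytail => ?_⟩
  have hn1 : n ≥ N₁ := (le_max_left _ _).trans ((le_max_left _ _).trans hn)
  have hn2 : n ≥ N₂ := (le_max_right _ _).trans ((le_max_left _ _).trans hn)
  have hn4 : 0 < n := (le_max_right _ _).trans hn
  have hd0 : ∀ t, 0 < scatterNorm Sig (y t) := fun t => by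
    rw [scatterNorm_eq hSig]
    exact norm_pos_iff.2 (toEuclideanLin_ne_zero hSd (hy0 t))
  -- The estimated distance is the true radius times a factor near `1`, as `rank_close` requires.
  have hdρ : ∀ t, scatterNorm Sig (y t)
      * ‖Matrix.toEuclideanLin T (direction (invSqrt Sig) (y t))‖
      = ‖Matrix.toEuclideanLin C (y t)‖ := by
    intro t
    have h := (hd0 t).ne'
    rw [scatterNorm_eq hSig] at h ⊢
    rw [hC, toEuclideanLin_mul_apply, direction, map_smul, norm_smul, norm_inv, norm_norm,
      mul_inv_cancel_left₀ h]
  have hρ1 : ∀ t, |‖Matrix.toEuclideanLin T (direction (invSqrt Sig) (y t))‖ - 1| ≤ e := by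
    intro t
    have h1 := abs_norm_toEuclideanLin_sub_le (fun a b => (hT a b).le)
      (direction (invSqrt Sig) (y t))
    rw [norm_direction hSd (hy0 t), mul_one] at h1
    refine h1.trans ?_
    calc (k : ℝ) * min ρ₁ (e / k) ≤ k * (e / k) :=
          mul_le_mul_of_nonneg_left (min_le_right _ _) hk0.le
      _ = e := by field_simp
  have hrk := hN₂ n hn2 _ _ hd0 hρ1 hyJ
  simp only [hdρ] at hrk
  have hinj := normRank_injective hyt
  have hav := hN₁ n hn1 (normRank C y) _ hinj (normRank_mem _ _)
    (fun s => hf.radialCdf_mem (hd0 s)) hrk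
  have hMR := hM n hn4
  rw [← sum_comp_rank hinj (normRank_mem _ _) fun a => K ((a : ℝ) / (n + 1)) ^ 2] at hMR
  have hfin := avg_sq_mul_sub_mul_le (fun s => K ((normRank C y s : ℝ) / (n + 1)))
    (fun s => K (radialCdf k f (scatterNorm Sig (y s))))
    (fun s => l C ⬝ᵥ (direction C (y s)).ofLp)
    (fun s => l (invSqrt Sig) ⬝ᵥ (direction (invSqrt Sig) (y s)).ofLp) (η := η₂) (L := L')
    (fun s => by
      rw [hC]
      exact hclose T hTu (fun a b => (hT a b).trans_le (min_le_left _ _)) _ (hy0 s))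
    (fun s => hwL _)
  have h5 : (n : ℝ)⁻¹ * ∑ s, (K ((normRank C y s : ℝ) / (n + 1))
      - K (radialCdf k f (scatterNorm Sig (y s)))) ^ 2 ≤ 5 * c₀ := by
    refine hav.trans ?_
    simp only [tailScore] at hytail
    linarith
  have h6 := mul_le_mul_of_nonneg_left h5 (show 0 ≤ 2 * L' ^ 2 by positivity)
  have h7 := mul_le_mul_of_nonneg_left hMR (show 0 ≤ 2 * η₂ ^ 2 by positivity)
  refine hfin.trans ?_
  linarith

theorem measure_avg_tailScore_gt_le (hk : 1 ≤ k) (hSig : Sig.PosDef)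
    (hf : IsRadialDensity k f) [IsProbabilityMeasure (ellipticLaw Sig f)] {K : ℝ → ℝ}
    (hK : IsScore K) (hKm : Measurable K) {τ c tol : ℝ} (hc : 0 < c)
    (hτ : ∫ u in tailSet τ, K u ^ 2 ≤ c * tol) (n : ℕ) :
    (Measure.pi fun _ : Fin n => ellipticLaw Sig f)
      {y | c < (n : ℝ)⁻¹ * ∑ t, tailScore K τ (radialCdf k f (scatterNorm Sig (y t)))}
      ≤ ENNReal.ofReal tol := by
  have hφi := integrable_comp_radialCdf hk hSig hf (g := tailScore K τ)
    (hK.integrableOn_sq.indicator (measurableSet_tailSet τ))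
  refine (measure_avg_gt_le _ hφi
    (fun z => Set.indicator_nonneg (fun u _ => sq_nonneg _) _) hc n).trans
    (ENNReal.ofReal_le_ofReal ?_)
  rw [div_le_iff₀ hc, integral_comp_radialCdf hk hSig hf
    (g := tailScore K τ) ((hKm.pow_const 2).indicator (measurableSet_tailSet τ)), tailScore,
    setIntegral_indicator (measurableSet_tailSet τ), inter_eq_right.2 (tailSet_subset τ), mul_comm]
  exact hτ

/-- The empirical frequencies obey the weak law of large numbers at finitely many points, and the
tail average obeys Markov's inequality. Neither event involves `R`, so the bound is uniform over
near roots. -/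
theorem exists_measure_avg_rankStat_sub_le (hk : 1 ≤ k) (hSig : Sig.PosDef)
    (hf : IsRadialDensity k f) [IsProbabilityMeasure (ellipticLaw Sig f)] {K : ℝ → ℝ}
    (hK : IsScore K) (hKm : Measurable K) {l : Matrix (Fin k) (Fin k) ℝ → Fin k → ℝ}
    (hl : ∀ η > 0, ∃ ρ > 0, ∀ T : Matrix (Fin k) (Fin k) ℝ, IsUpperPos T →
      (∀ a b, |T a b - (1 : Matrix (Fin k) (Fin k) ℝ) a b| < ρ) →
      ∀ c, |l (T * invSqrt Sig) c - l (invSqrt Sig) c| ≤ η) {ε tol : ℝ} (hε : 0 < ε)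
    (htol : 0 < tol) :
    ∃ ρ > 0, ∃ N, ∀ n ≥ N, ∀ R : (Fin n → EuclideanSpace ℝ (Fin k)) → Matrix (Fin k) (Fin k) ℝ,
      IsNearRoot (invSqrt Sig) ρ R → (Measure.pi fun _ : Fin n => ellipticLaw Sig f)
        {y | ε < (n : ℝ)⁻¹ * ∑ t, (rankStat K (l (R y)) (R y) y t
          - exactStat K (l (invSqrt Sig)) Sig f (y t)) ^ 2} ≤ ENNReal.ofReal tol := by
  obtain ⟨c₀, hc₀, τ, hτ, J, η, hη, ρ, hρ, N₁, hN₁⟩ :=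
    exists_avg_rankStat_sub_le hk hSig hf hK hl hε (half_pos htol)
  have hJ := tendsto_finsetSum J fun x _ => tendsto_measure_empiricalCdf hk hSig hf x hη
  rw [Finset.sum_const_zero] at hJ
  obtain ⟨N₃, hN₃⟩ := eventually_atTop.1
    (hJ.eventually (gt_mem_nhds (ENNReal.ofReal_pos.2 (half_pos htol))))
  refine ⟨ρ, hρ, max N₁ N₃, fun n hn R hR => ?_⟩
  have hn1 := hN₁ n ((le_max_left _ _).trans hn)
  have hB := measure_avg_tailScore_gt_le hk hSig hf hK hKm hc₀ hτ n
  refine (measure_le_sum_add ?_).trans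
    ((add_le_add (hN₃ n ((le_max_right _ _).trans hn)).le hB).trans ?_)
  · filter_upwards [pi_ae_ne_zero hk n, hR.ae_no_tie hk hSig] with y hy0 hyt hbad
    by_contra hnot
    obtain ⟨h1, h2⟩ := not_or.1 hnot
    obtain ⟨T, hTu, hT, hRy⟩ := hR.near y
    exact absurd (hn1 (R y) T y hRy hTu hT hy0 hyt
      (fun x hx => not_lt.1 fun h => h1 ⟨x, hx, h⟩) (not_lt.1 h2)) (not_le.2 hbad)
  · rw [← ENNReal.ofReal_add (by positivity) (by positivity), add_halves]

end

/-! ### Lagged sums of products of equivariant statistics -/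

/-- A statistic, indexed by the observations, which is odd with respect to the sign of each
observation and equivariant with respect to permutations. -/
structure IsSignPermEquivariant {E : Type*} [MeasurableSpace E] [Neg E] {n : ℕ}
    (α : (Fin n → E) → Fin n → ℝ) : Prop where
  measurable : ∀ s, Measurable fun y => α y s
  flip : ∀ y r s, α (fun t => if t = r then -y t else y t) s = (if s = r then -1 else 1) * α y s
  perm : ∀ (π : Equiv.Perm (Fin n)) y s, α (y ∘ π) s = α y (π s)

theorem IsSignPermEquivariant.sub {E : Type*} [MeasurableSpace E] [Neg E] {n : ℕ}
    {α β : (Fin n → E) → Fin n → ℝ} (hα : IsSignPermEquivariant α)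
    (hβ : IsSignPermEquivariant β) : IsSignPermEquivariant fun y s => α y s - β y s where
  measurable s := (hα.measurable s).sub (hβ.measurable s)
  flip y r s := by rw [hα.flip, hβ.flip]; ring
  perm π y s := by rw [hα.perm, hβ.perm]

/-- The average of the squares of a statistic. -/
def avgSq {n : ℕ} (x : Fin n → ℝ) : ℝ := (n : ℝ)⁻¹ * ∑ s, x s ^ 2

theorem IsSignPermEquivariant.measurable_avgSq {E : Type*} [MeasurableSpace E] [Neg E] {n : ℕ}
    {α : (Fin n → E) → Fin n → ℝ} (hα : IsSignPermEquivariant α) :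
    Measurable fun y => avgSq (α y) :=
  (Finset.measurable_fun_sum _ fun s _ => (hα.measurable s).pow_const 2).const_mul _

theorem IsSignPermEquivariant.avgSq_flip {E : Type*} [MeasurableSpace E] [Neg E] {n : ℕ}
    {α : (Fin n → E) → Fin n → ℝ} (hα : IsSignPermEquivariant α) (y : Fin n → E) (r : Fin n) :
    avgSq (α fun t => if t = r then -y t else y t) = avgSq (α y) := by
  rw [avgSq, avgSq]
  congr 1
  refine Finset.sum_congr rfl fun s _ => ?_
  rw [hα.flip]
  split_ifs <;> ring

theorem IsSignPermEquivariant.avgSq_perm {E : Type*} [MeasurableSpace E] [Neg E] {n : ℕ}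
    {α : (Fin n → E) → Fin n → ℝ} (hα : IsSignPermEquivariant α) (π : Equiv.Perm (Fin n))
    (y : Fin n → E) : avgSq (α (y ∘ π)) = avgSq (α y) := by
  simp only [avgSq, hα.perm]
  rw [Equiv.sum_comp π fun s => α y s ^ 2]

/-- Write `a b - a₀ b₀ = (a - a₀) b + a₀ (b - b₀)`. Over all pairs, unlike over lagged pairs, the
sums of squares factorise into averages of single statistics. -/
theorem sum_sum_sq_sub_le {n : ℕ} (hn : 0 < n) {a b a₀ b₀ : Fin n → ℝ} {ε M : ℝ} (hε : 0 ≤ ε)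
    (hM : 0 ≤ M) (ha : avgSq (fun s => a s - a₀ s) ≤ ε) (hb : avgSq (fun s => b s - b₀ s) ≤ ε)
    (ha₀ : avgSq a₀ ≤ M) (hb₀ : avgSq b₀ ≤ M) :
    ∑ s, ∑ u, (a s * b u - a₀ s * b₀ u) ^ 2 ≤ (n : ℝ) ^ 2 * (4 * ε * (M + ε) + 2 * M * ε) := by
  have hn0 : (0 : ℝ) < n := by exact_mod_cast hn
  rw [avgSq, inv_mul_le_iff₀ hn0] at ha hb ha₀ hb₀
  have hbb : ∑ u, b u ^ 2 ≤ n * (2 * M + 2 * ε) := by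
    have : ∑ u, b u ^ 2 ≤ ∑ u, (2 * b₀ u ^ 2 + 2 * (b u - b₀ u) ^ 2) :=
      Finset.sum_le_sum fun u _ => by nlinarith [sq_nonneg (b u - 2 * b₀ u)]
    rw [Finset.sum_add_distrib, ← Finset.mul_sum, ← Finset.mul_sum] at this
    nlinarith
  have hterm : ∀ s u, (a s * b u - a₀ s * b₀ u) ^ 2
      ≤ 2 * ((a s - a₀ s) ^ 2 * b u ^ 2) + 2 * (a₀ s ^ 2 * (b u - b₀ u) ^ 2) := fun s u => by
    nlinarith [sq_nonneg ((a s - a₀ s) * b u - a₀ s * (b u - b₀ u))]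
  calc ∑ s, ∑ u, (a s * b u - a₀ s * b₀ u) ^ 2
      ≤ ∑ s, ∑ u, (2 * ((a s - a₀ s) ^ 2 * b u ^ 2) + 2 * (a₀ s ^ 2 * (b u - b₀ u) ^ 2)) :=
        Finset.sum_le_sum fun s _ => Finset.sum_le_sum fun u _ => hterm s u
    _ = 2 * ((∑ s, (a s - a₀ s) ^ 2) * ∑ u, b u ^ 2)
        + 2 * ((∑ s, a₀ s ^ 2) * ∑ u, (b u - b₀ u) ^ 2) := by
        simp only [Finset.sum_add_distrib, ← Finset.mul_sum, Finset.sum_mul_sum]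
    _ ≤ 2 * ((n * ε) * (n * (2 * M + 2 * ε))) + 2 * ((n * M) * (n * ε)) := by
        refine add_le_add (mul_le_mul_of_nonneg_left ?_ zero_le_two)
          (mul_le_mul_of_nonneg_left ?_ zero_le_two)
        · exact mul_le_mul ha hbb (Finset.sum_nonneg fun _ _ => sq_nonneg _) (by positivity)
        · exact mul_le_mul ha₀ hb (Finset.sum_nonneg fun _ _ => sq_nonneg _) (by positivity)
    _ = _ := by ring

/-- Chebyshev's inequality. -/
theorem measure_abs_gt_le {α : Type*} [MeasurableSpace α] {ν : Measure α} [IsFiniteMeasure ν]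
    {X : α → ℝ} (hX : Integrable (fun y => X y ^ 2) ν) {c : ℝ} (hc : 0 < c) :
    ν {y | c < |X y|} ≤ ENNReal.ofReal ((∫ y, X y ^ 2 ∂ν) / c ^ 2) := by
  have := mul_meas_ge_le_integral_of_nonneg (ae_of_all ν fun y => sq_nonneg (X y)) hX (c ^ 2)
  refine (measure_mono (t := {y | c ^ 2 ≤ X y ^ 2}) fun y (hy : c < _) => ?_).trans ?_
  · change c ^ 2 ≤ X y ^ 2
    exact sq_le_sq.2 (by rw [abs_of_pos hc]; exact hy.le)
  · rw [← ofReal_measureReal]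
    exact ENNReal.ofReal_le_ofReal (by rw [le_div_iff₀' (by positivity)]; exact this)

/-- The factor `n` of the second moment cancels against the squared rate `1 / n` and `(n - i)² ≥ n²
/ 4`; the result does not depend on `n`. -/
theorem lag_rate_bound {i n : ℕ} (hi : 1 ≤ i) (hn : 2 * i ≤ n) {q δ : ℝ} (hq : 0 ≤ q)
    (hδ : 0 < δ) : 2 * n * q / (δ * (n : ℝ) ^ (-(1 / 2) : ℝ) * ((n : ℝ) - i)) ^ 2
      ≤ 8 * q / δ ^ 2 := by
  have hi0 : (1 : ℝ) ≤ i := by exact_mod_cast hi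
  have hn0 : 2 * (i : ℝ) ≤ n := by exact_mod_cast hn
  have hnp : (0 : ℝ) < n := by linarith
  have h1 : ((n : ℝ) ^ (-(1 / 2) : ℝ)) ^ 2 = (n : ℝ)⁻¹ := by
    rw [← Real.rpow_natCast, ← Real.rpow_mul hnp.le, ← Real.rpow_neg_one]
    norm_num
  have hni : (0 : ℝ) < n - i := by linarith
  rw [mul_pow, mul_pow, h1, div_le_div_iff₀ (by positivity) (by positivity)]
  have h2 : (n : ℝ) ^ 2 ≤ 4 * (n - i) ^ 2 := by nlinarith
  have h3 : 8 * q * (δ ^ 2 * (n : ℝ)⁻¹ * (n - i) ^ 2) = 2 * n * q * δ ^ 2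
      * ((4 * (n - i) ^ 2) / n ^ 2) := by field_simp; ring
  rw [h3]
  refine le_mul_of_one_le_right (by positivity) ?_
  rwa [one_le_div (by positivity)]

/-- The event that all four averages are small is invariant under sign flips and permutations.
Truncating the array to it preserves the symmetries and makes the array bounded, so the second
moment bound and Chebyshev's inequality apply. The exceptional event enters through its probability
only. -/
theorem measure_lagSum_gt_le {E : Type*} [MeasurableSpace E] [Neg E] {μ : Measure E}
    [IsProbabilityMeasure μ] (hμ : MeasurePreserving (fun z : E => -z) μ μ) {i n : ℕ} (hi : 1 ≤ i)
    (hn : 2 * i ≤ n) {α β α₀ β₀ : (Fin n → E) → Fin n → ℝ} (hα : IsSignPermEquivariant α)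
    (hβ : IsSignPermEquivariant β) (hα₀ : IsSignPermEquivariant α₀)
    (hβ₀ : IsSignPermEquivariant β₀) {ε M δ : ℝ} (hε : 0 ≤ ε) (hM : 0 ≤ M) (hδ : 0 < δ) :
    (Measure.pi fun _ : Fin n => μ) {y | δ * (n : ℝ) ^ (-(1 / 2) : ℝ)
        < |((n : ℝ) - i)⁻¹ * ∑ p ∈ lagPairs i n, (α y p.1 * β y p.2 - α₀ y p.1 * β₀ y p.2)|}
      ≤ (((Measure.pi fun _ : Fin n => μ) {y | ε < avgSq fun s => α y s - α₀ y s}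
        + (Measure.pi fun _ : Fin n => μ) {y | ε < avgSq fun s => β y s - β₀ y s})
        + ((Measure.pi fun _ : Fin n => μ) {y | M < avgSq (α₀ y)}
        + (Measure.pi fun _ : Fin n => μ) {y | M < avgSq (β₀ y)}))
        + ENNReal.ofReal (8 * (4 * ε * (M + ε) + 2 * M * ε) / δ ^ 2) := by
  set ν := Measure.pi fun _ : Fin n => μ with hν
  set q : ℝ := 4 * ε * (M + ε) + 2 * M * ε with hq
  have hq0 : 0 ≤ q := by positivity
  have hnp : 0 < n := by omega
  have hn0 : (0 : ℝ) < n := by exact_mod_cast hnp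
  have hni : (0 : ℝ) < (n : ℝ) - i := by
    have : 2 * (i : ℝ) ≤ n := by exact_mod_cast hn
    have : (1 : ℝ) ≤ i := by exact_mod_cast hi
    linarith
  set G : Set (Fin n → E) := {y | (avgSq (fun s => α y s - α₀ y s) ≤ ε
    ∧ avgSq (fun s => β y s - β₀ y s) ≤ ε) ∧ (avgSq (α₀ y) ≤ M ∧ avgSq (β₀ y) ≤ M)} with hG
  have hGm : MeasurableSet G :=
    ((measurableSet_le (hα.sub hα₀).measurable_avgSq measurable_const).inter
      (measurableSet_le (hβ.sub hβ₀).measurable_avgSq measurable_const)).inter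
    ((measurableSet_le hα₀.measurable_avgSq measurable_const).inter
      (measurableSet_le hβ₀.measurable_avgSq measurable_const))
  have hGf : ∀ y r, (fun t => if t = r then -y t else y t) ∈ G ↔ y ∈ G := fun y r => by
    simp only [hG, mem_ofPred_eq, (hα.sub hα₀).avgSq_flip y r, (hβ.sub hβ₀).avgSq_flip y r,
      hα₀.avgSq_flip y r, hβ₀.avgSq_flip y r]
  have hGp : ∀ (π : Equiv.Perm (Fin n)) y, y ∘ π ∈ G ↔ y ∈ G := fun π y => by
    simp only [hG, mem_ofPred_eq, (hα.sub hα₀).avgSq_perm π y, (hβ.sub hβ₀).avgSq_perm π y,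
      hα₀.avgSq_perm π y, hβ₀.avgSq_perm π y]
  classical
  set B : (Fin n → E) → Fin n → Fin n → ℝ := fun y s u =>
    if y ∈ G then α y s * β y u - α₀ y s * β₀ y u else 0 with hB
  have hBm : ∀ s u, Measurable fun y => B y s u := fun s u =>
    Measurable.ite hGm (((hα.measurable s).mul (hβ.measurable u)).sub
      ((hα₀.measurable s).mul (hβ₀.measurable u))) measurable_const
  have hBq : ∀ y, ∑ s, ∑ u, B y s u ^ 2 ≤ (n : ℝ) ^ 2 * q := by
    intro y
    by_cases hy : y ∈ G
    · simp only [hB, if_pos hy]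
      exact sum_sum_sq_sub_le hnp hε hM hy.1.1 hy.1.2 hy.2.1 hy.2.2
    · simp only [hB, if_neg hy]
      simp; positivity
  have hBc : ∀ y s u, |B y s u| ≤ √((n : ℝ) ^ 2 * q) := fun y s u => by
    refine Real.abs_le_sqrt (le_trans ?_ (hBq y))
    exact (Finset.single_le_sum (f := fun u => B y s u ^ 2) (fun _ _ => sq_nonneg _)
      (Finset.mem_univ u)).trans (Finset.single_le_sum (f := fun s => ∑ u, B y s u ^ 2)
      (fun _ _ => Finset.sum_nonneg fun _ _ => sq_nonneg _) (Finset.mem_univ s))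
  have hkey := integral_sq_sum_lagPairs_le hμ hi (by omega) hBm hBc
    (fun y r s u => by
      simp only [hB, hGf, hα.flip, hβ.flip, hα₀.flip, hβ₀.flip]
      by_cases hy : y ∈ G
      · simp only [if_pos hy]; ring
      · simp only [if_neg hy, mul_zero])
    (fun π y s u => by simp only [hB, hGp, hα.perm, hβ.perm, hα₀.perm, hβ₀.perm]) hBq
  set c : ℝ := δ * (n : ℝ) ^ (-(1 / 2) : ℝ) * ((n : ℝ) - i) with hc
  have hc0 : 0 < c := mul_pos (mul_pos hδ (Real.rpow_pos_of_pos hn0 _)) hni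
  have hint : Integrable (fun y => (∑ p ∈ lagPairs i n, B y p.1 p.2) ^ 2) ν := by
    refine integrable_of_abs_le ((Finset.measurable_fun_sum _ fun p _ => hBm p.1 p.2).pow_const 2)
      (c := (∑ p ∈ lagPairs i n, √((n : ℝ) ^ 2 * q)) ^ 2) fun y => ?_
    rw [abs_pow]
    exact pow_le_pow_left₀ (abs_nonneg _) ((Finset.abs_sum_le_sum_abs _ _).trans
      (Finset.sum_le_sum fun p _ => hBc y p.1 p.2)) 2
  have hcheb : ν {y | c < |∑ p ∈ lagPairs i n, B y p.1 p.2|} ≤ ENNReal.ofReal (8 * q / δ ^ 2) := by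
    refine (measure_abs_gt_le hint hc0).trans (ENNReal.ofReal_le_ofReal ?_)
    exact (div_le_div_of_nonneg_right hkey (sq_nonneg c)).trans (lag_rate_bound hi hn hq0 hδ)
  refine (measure_mono (t := (({y | ε < avgSq fun s => α y s - α₀ y s}
    ∪ {y | ε < avgSq fun s => β y s - β₀ y s}) ∪ ({y | M < avgSq (α₀ y)}
    ∪ {y | M < avgSq (β₀ y)})) ∪ {y | c < |∑ p ∈ lagPairs i n, B y p.1 p.2|}) ?_).trans ?_
  · intro y hy
    rw [mem_ofPred_eq] at hy
    by_cases hyG : y ∈ G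
    · refine Or.inr ?_
      simp only [mem_ofPred_eq, hB, if_pos hyG]
      rwa [abs_mul, abs_of_pos (inv_pos.2 hni), inv_mul_eq_div, lt_div_iff₀ hni] at hy
    · refine Or.inl ?_
      by_contra hnot
      refine hyG ?_
      simp only [mem_union, mem_ofPred_eq, not_or, not_lt] at hnot
      exact hnot
  · exact (measure_union_le _ _).trans (add_le_add ((measure_union_le _ _).trans
      (add_le_add (measure_union_le _ _) (measure_union_le _ _))) hcheb)

/-! ### The coefficient functionals of the cross-covariance matrices -/

/-- The `a`-th row of `Cᵀ`. -/
def transposeRow {k : ℕ} (a : Fin k) (C : Matrix (Fin k) (Fin k) ℝ) : Fin k → ℝ := fun c => C c a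

/-- The `b`-th row of `C⁻¹`. -/
def inverseRow {k : ℕ} (b : Fin k) (C : Matrix (Fin k) (Fin k) ℝ) : Fin k → ℝ := fun c => C⁻¹ b c

theorem continuous_transposeRow {k : ℕ} (a : Fin k) : Continuous (transposeRow a) :=
  continuous_pi fun c => (continuous_apply a).comp (continuous_apply c)

theorem inverseRow_apply {k : ℕ} (b c : Fin k) (C : Matrix (Fin k) (Fin k) ℝ) :
    inverseRow b C c = C.det⁻¹ * C.adjugate b c := by
  rw [inverseRow, Matrix.inv_def, Ring.inverse_eq_inv, Matrix.smul_apply, smul_eq_mul]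

theorem continuous_adjugate_apply {k : ℕ} (b c : Fin k) :
    Continuous fun C : Matrix (Fin k) (Fin k) ℝ => C.adjugate b c :=
  (continuous_apply c).comp ((continuous_apply b).comp continuous_id.matrix_adjugate)

theorem continuousAt_inverseRow {k : ℕ} (b : Fin k) {S : Matrix (Fin k) (Fin k) ℝ}
    (hS : S.det ≠ 0) : ContinuousAt (inverseRow b) S := by
  refine continuousAt_pi.2 fun c => ?_
  simp only [inverseRow_apply]
  exact (continuous_id.matrix_det.continuousAt.inv₀ hS).mul
    (continuous_adjugate_apply b c).continuousAt

theorem exists_abs_apply_sub_le {k : ℕ} {l : Matrix (Fin k) (Fin k) ℝ → Fin k → ℝ}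
    {S : Matrix (Fin k) (Fin k) ℝ} (hl : ContinuousAt l S) (η : ℝ) (hη : η > 0) :
    ∃ ρ > 0, ∀ T : Matrix (Fin k) (Fin k) ℝ, IsUpperPos T →
      (∀ a b, |T a b - (1 : Matrix (Fin k) (Fin k) ℝ) a b| < ρ) →
      ∀ c, |l (T * S) c - l S c| ≤ η := by
  have hc : ContinuousAt (fun T : Matrix (Fin k) (Fin k) ℝ => l (T * S)) 1 := by
    refine ContinuousAt.comp (g := l) (f := fun T : Matrix (Fin k) (Fin k) ℝ => T * S) ?_
      (continuous_id.matrix_mul continuous_const).continuousAt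
    simpa using hl
  have h := hc.eventually (Metric.ball_mem_nhds _ hη)
  obtain ⟨ρ, hρ, h⟩ := (Metric.eventually_nhds_iff (α := Fin k → Fin k → ℝ)).1 h
  refine ⟨ρ, hρ, fun T _ hT c => ?_⟩
  have h1 : dist (l (T * S)) (l (1 * S)) < η := h (y := T) ((dist_pi_lt_iff hρ).2 fun a => (dist_pi_lt_iff hρ).2 fun b => by
    rw [Real.dist_eq]; exact hT a b)
  rw [one_mul, dist_pi_lt_iff hη] at h1
  exact (h1 c).le

theorem measurable_comp_entries {α : Type*} [MeasurableSpace α] {k : ℕ}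
    {R : α → Matrix (Fin k) (Fin k) ℝ} (hR : ∀ a b, Measurable fun y => R y a b)
    {g : Matrix (Fin k) (Fin k) ℝ → ℝ} (hg : Continuous g) : Measurable fun y => g (R y) := by
  have hg' : Continuous fun M : Fin k → Fin k → ℝ => g (Matrix.of M) := hg
  exact hg'.measurable.comp (g := fun M : Fin k → Fin k → ℝ => g (Matrix.of M))
    (f := fun y a b => R y a b) (measurable_pi_iff.2 fun a => measurable_pi_iff.2 fun b => hR a b)

theorem measurable_inverseRow {α : Type*} [MeasurableSpace α] {k : ℕ}
    {R : α → Matrix (Fin k) (Fin k) ℝ} (hR : ∀ a b, Measurable fun y => R y a b) (b c : Fin k) :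
    Measurable fun y => inverseRow b (R y) c := by
  simp only [inverseRow_apply]
  exact (measurable_comp_entries hR continuous_id.matrix_det).inv.mul
    (measurable_comp_entries hR (continuous_adjugate_apply b c))

/-! ### Lagged sums of rank statistics -/

theorem isSignPermEquivariant_rankStat {k n : ℕ} {K : ℝ → ℝ} (hK : Measurable K)
    {S : Matrix (Fin k) (Fin k) ℝ} {ρ : ℝ}
    {R : (Fin n → EuclideanSpace ℝ (Fin k)) → Matrix (Fin k) (Fin k) ℝ} (hR : IsNearRoot S ρ R)
    {l : Matrix (Fin k) (Fin k) ℝ → Fin k → ℝ} (hl : ∀ c, Measurable fun y => l (R y) c) :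
    IsSignPermEquivariant fun y s => rankStat K (l (R y)) (R y) y s where
  measurable s := measurable_rankStat hK hR.measurable hl s
  flip y r s := by rw [hR.flip, rankStat_flip]
  perm π y s := by rw [hR.perm, rankStat_perm]

theorem isSignPermEquivariant_exactStat {k n : ℕ} {K : ℝ → ℝ} (hK : Measurable K) (l : Fin k → ℝ)
    {Sig : Matrix (Fin k) (Fin k) ℝ} (hSig : Sig.PosDef) {f : ℝ → ℝ} (hf : IsRadialDensity k f) :
    IsSignPermEquivariant fun (y : Fin n → EuclideanSpace ℝ (Fin k)) s =>
      exactStat K l Sig f (y s) where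
  measurable s := (measurable_exactStat hK l hSig hf).comp (measurable_pi_apply s)
  flip y r s := by
    change exactStat K l Sig f (if s = r then -y s else y s) = _
    split_ifs
    · rw [exactStat_neg, neg_one_mul]
    · rw [one_mul]
  perm π y s := rfl

section

variable {k : ℕ} {Sig : Matrix (Fin k) (Fin k) ℝ} {f : ℝ → ℝ}

theorem exists_measure_lagSum_gt_le (hk : 1 ≤ k) (hSig : Sig.PosDef)
    (hf : IsRadialDensity k f) [IsProbabilityMeasure (ellipticLaw Sig f)] {i : ℕ} (hi : 1 ≤ i)
    {K₁ K₂ : ℝ → ℝ} (hK₁ : IsScore K₁) (hK₁m : Measurable K₁) (hK₂ : IsScore K₂)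
    (hK₂m : Measurable K₂) (a b : Fin k) {δ tol : ℝ} (hδ : 0 < δ) (htol : 0 < tol) :
    ∃ ρ > 0, ∃ N, ∀ n ≥ N, ∀ R : (Fin n → EuclideanSpace ℝ (Fin k)) → Matrix (Fin k) (Fin k) ℝ,
      IsNearRoot (invSqrt Sig) ρ R → (Measure.pi fun _ : Fin n => ellipticLaw Sig f)
        {y | δ * (n : ℝ) ^ (-(1 / 2) : ℝ) < |((n : ℝ) - i)⁻¹ * ∑ p ∈ lagPairs i n,
          (rankStat K₁ (transposeRow a (R y)) (R y) y p.1
              * rankStat K₂ (inverseRow b (R y)) (R y) y p.2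
            - exactStat K₁ (transposeRow a (invSqrt Sig)) Sig f (y p.1)
              * exactStat K₂ (inverseRow b (invSqrt Sig)) Sig f (y p.2))|}
        ≤ ENNReal.ofReal tol := by
  have hSd := (invSqrt_spec hSig).1.det_pos.ne'
  have htol5 : 0 < tol / 5 := by positivity
  obtain ⟨M₁, hM₁, h1⟩ := exists_measure_avg_exactStat_sq_le hk hSig hf hK₁ hK₁m
    (transposeRow a (invSqrt Sig)) htol5
  obtain ⟨M₂, hM₂, h2⟩ := exists_measure_avg_exactStat_sq_le hk hSig hf hK₂ hK₂m
    (inverseRow b (invSqrt Sig)) htol5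
  set M := M₁ + M₂ with hM
  -- For `ε ≤ 1`, `4 ε (M + ε) + 2 M ε ≤ ε (6 M + 4)`, so the Chebyshev term is the fifth share of
  -- `tol`.
  obtain ⟨ε, hε, hε1, hεt⟩ : ∃ ε : ℝ, 0 < ε ∧ ε ≤ 1 ∧ ε * (8 * (6 * M + 4)) ≤ δ ^ 2 * (tol / 5) := by
    refine ⟨min 1 (δ ^ 2 * (tol / 5) / (8 * (6 * M + 4))), lt_min one_pos (by positivity),
      min_le_left _ _, ?_⟩
    rw [← le_div_iff₀ (by positivity)]
    exact min_le_right _ _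
  obtain ⟨ρ₁, hρ₁, N₁, h3⟩ := exists_measure_avg_rankStat_sub_le hk hSig hf hK₁ hK₁m
    (l := transposeRow a) (exists_abs_apply_sub_le (continuous_transposeRow a).continuousAt) hε htol5
  obtain ⟨ρ₂, hρ₂, N₂, h4⟩ := exists_measure_avg_rankStat_sub_le hk hSig hf hK₂ hK₂m
    (l := inverseRow b) (exists_abs_apply_sub_le (continuousAt_inverseRow b hSd)) hε htol5
  refine ⟨min ρ₁ ρ₂, lt_min hρ₁ hρ₂, max (max N₁ N₂) (2 * i), fun n hn R hR => ?_⟩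
  have hn1 : n ≥ N₁ := (le_max_left _ _).trans ((le_max_left _ _).trans hn)
  have hn2 : n ≥ N₂ := (le_max_right _ _).trans ((le_max_left _ _).trans hn)
  have hn3 : 2 * i ≤ n := (le_max_right _ _).trans hn
  have key := measure_lagSum_gt_le (measurePreserving_neg_ellipticLaw Sig hf) hi hn3
    (isSignPermEquivariant_rankStat hK₁m hR (l := transposeRow a) fun c => hR.measurable c a)
    (isSignPermEquivariant_rankStat hK₂m hR (l := inverseRow b)
      fun c => measurable_inverseRow hR.measurable b c)
    (isSignPermEquivariant_exactStat hK₁m (transposeRow a (invSqrt Sig)) hSig hf)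
    (isSignPermEquivariant_exactStat hK₂m (inverseRow b (invSqrt Sig)) hSig hf)
    hε.le (show 0 ≤ M by positivity) hδ
  refine key.trans ?_
  have e1 := h3 n hn1 R (hR.mono (min_le_left _ _))
  have e2 := h4 n hn2 R (hR.mono (min_le_right _ _))
  have e3 : (Measure.pi fun _ : Fin n => ellipticLaw Sig f)
      {y | M < avgSq fun s => exactStat K₁ (transposeRow a (invSqrt Sig)) Sig f (y s)}
      ≤ ENNReal.ofReal (tol / 5) := (measure_mono fun y hy =>
        lt_of_le_of_lt (by linarith : M₁ ≤ M) hy).trans (h1 n)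
  have e4 : (Measure.pi fun _ : Fin n => ellipticLaw Sig f)
      {y | M < avgSq fun s => exactStat K₂ (inverseRow b (invSqrt Sig)) Sig f (y s)}
      ≤ ENNReal.ofReal (tol / 5) := (measure_mono fun y hy =>
        lt_of_le_of_lt (by linarith : M₂ ≤ M) hy).trans (h2 n)
  have e5 : ENNReal.ofReal (8 * (4 * ε * (M + ε) + 2 * M * ε) / δ ^ 2)
      ≤ ENNReal.ofReal (tol / 5) := by
    refine ENNReal.ofReal_le_ofReal ?_
    rw [div_le_iff₀ (by positivity)]
    nlinarith
  refine (add_le_add (add_le_add (add_le_add e1 e2) (add_le_add e3 e4)) e5).trans ?_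
  rw [← ENNReal.ofReal_add, ← ENNReal.ofReal_add, ← ENNReal.ofReal_add]
  · exact ENNReal.ofReal_le_ofReal (by linarith)
  all_goals positivity

theorem tendsto_measure_compl_goodSet (hk : 1 ≤ k)
    [IsProbabilityMeasure (ellipticLaw Sig f)] {δ : ℝ} (hδ : 0 < δ) :
    Tendsto (fun n : ℕ => (Measure.pi fun _ : Fin n => ellipticLaw Sig f) (goodSet Sig f δ n)ᶜ)
      atTop (𝓝 0) := by
  set u : EuclideanSpace ℝ (Fin k) → Fin k → ℝ := fun z => (direction (invSqrt Sig) z).ofLp with hu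
  have hum : ∀ a, Measurable fun z => u z a := fun a =>
    (measurable_ofLp_apply a).comp (measurable_direction _)
  have hu1 : ∀ z a, |u z a| ≤ 1 := fun z a => abs_direction_apply_le _ z a
  have h2 := tendsto_finsetSum (Finset.univ : Finset (Fin k × Fin k)) fun p _ =>
    tendsto_measure_avg_sub (ellipticLaw Sig f) (g := fun z => u z p.1 * u z p.2)
      ((hum _).mul (hum _)) (fun z => abs_mul_le_one' (hu1 z _) (hu1 z _)) hδ
  have h4 := tendsto_finsetSum (Finset.univ : Finset ((Fin k × Fin k) × (Fin k × Fin k)))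
    fun p _ => tendsto_measure_avg_sub (ellipticLaw Sig f)
      (g := fun z => u z p.1.1 * u z p.1.2 * (u z p.2.1 * u z p.2.2))
      (((hum _).mul (hum _)).mul ((hum _).mul (hum _)))
      (fun z => abs_mul_le_one' (abs_mul_le_one' (hu1 z _) (hu1 z _))
        (abs_mul_le_one' (hu1 z _) (hu1 z _))) hδ
  have h := h2.add h4
  simp only [Finset.sum_const_zero, add_zero] at h
  refine tendsto_of_tendsto_of_tendsto_of_le_of_le tendsto_const_nhds h (fun _ => zero_le)
    fun n => ?_
  refine (measure_le_sum_add ?_).trans (add_le_add le_rfl (measure_biUnion_finset_le _ _))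
  filter_upwards [pi_ae_ne_zero hk n] with y hy hyG
  by_contra hnot
  obtain ⟨n1, n2⟩ := not_or.1 hnot
  refine hyG ⟨hy, fun a b => ?_, fun a b c d => ?_⟩
  · rw [Fintype.card_fin]
    exact not_lt.1 fun h => n1 ⟨(a, b), Finset.mem_univ _, h⟩
  · rw [Fintype.card_fin]
    exact not_lt.1 fun h => n2 (mem_iUnion₂.2 ⟨((a, b), (c, d)), Finset.mem_univ _, h⟩)

end

/-! ### The entries of the cross-covariance matrices -/

theorem sum_Icc_lag_eq (i n : ℕ) (g : ℕ → ℕ → ℝ) :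
    ∑ t ∈ Finset.Icc (i + 1) n, g t (t - i) = ∑ p ∈ lagPairs i n, g (p.1 + 1) (p.2 + 1) := by
  symm
  refine Finset.sum_bij (fun p _ => (p.1 : ℕ) + 1) ?_ ?_ ?_ ?_
  · rintro ⟨s, u⟩ hp
    have hp : (s : ℕ) = u + i := (Finset.mem_filter.1 hp).2
    simp only [Finset.mem_Icc]
    omega
  · rintro ⟨s, u⟩ hp ⟨s', u'⟩ hp' h
    have hp : (s : ℕ) = u + i := (Finset.mem_filter.1 hp).2
    have hp' : (s' : ℕ) = u' + i := (Finset.mem_filter.1 hp').2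
    simp only at h
    exact Prod.ext (Fin.ext (by simp only; omega)) (Fin.ext (by simp only; omega))
  · intro t ht
    have ht := Finset.mem_Icc.1 ht
    exact ⟨(⟨t - 1, by omega⟩, ⟨t - 1 - i, by omega⟩),
      Finset.mem_filter.2 ⟨Finset.mem_univ _, by simp only; omega⟩, by simp only; omega⟩
  · rintro ⟨s, u⟩ hp
    have hp : (s : ℕ) = u + i := (Finset.mem_filter.1 hp).2
    simp only
    congr 1
    omega

/-- Every entry is a product of a functional of `v` and a functional of `w`. This product form is
what the lagged second moment bound exploits. -/
theorem transpose_conj_outer_apply {k : ℕ} (C : Matrix (Fin k) (Fin k) ℝ)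
    (v w : EuclideanSpace ℝ (Fin k)) (a b : Fin k) :
    (Cᵀ * outer v w * (Cᵀ)⁻¹) a b = (transposeRow a C ⬝ᵥ v.ofLp) * (inverseRow b C ⬝ᵥ w.ofLp) := by
  rw [outer, Matrix.mul_vecMulVec, Matrix.vecMulVec_mul, Matrix.vecMulVec_apply,
    ← Matrix.transpose_nonsing_inv, Matrix.vecMul_transpose]
  rfl

theorem conj_lagSum_apply {k : ℕ} (C : Matrix (Fin k) (Fin k) ℝ) (r : ℝ) (i n : ℕ)
    (c : ℕ → ℕ → ℝ) (v w : ℕ → EuclideanSpace ℝ (Fin k)) (a b : Fin k) :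
    (Cᵀ * (r • ∑ t ∈ Finset.Icc (i + 1) n, c t (t - i) • outer (v t) (w (t - i))) * (Cᵀ)⁻¹) a b
      = r * ∑ p ∈ lagPairs i n, c (p.1 + 1) (p.2 + 1) *
        ((transposeRow a C ⬝ᵥ (v (p.1 + 1)).ofLp) * (inverseRow b C ⬝ᵥ (w (p.2 + 1)).ofLp)) := by
  rw [Matrix.mul_smul, Matrix.smul_mul, Matrix.smul_apply, smul_eq_mul, Matrix.mul_sum,
    Matrix.sum_mul, Matrix.sum_apply]
  simp only [Matrix.mul_smul, Matrix.smul_mul, Matrix.smul_apply, smul_eq_mul,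
    transpose_conj_outer_apply]
  rw [sum_Icc_lag_eq i n fun t u => c t u *
    ((transposeRow a C ⬝ᵥ (v t).ofLp) * (inverseRow b C ⬝ᵥ (w u).ofLp))]

theorem scatterNorm_tylerScatter {k n : ℕ} (z : ℕ → EuclideanSpace ℝ (Fin k))
    (v : EuclideanSpace ℝ (Fin k)) :
    scatterNorm (tylerScatter n z) v = ‖Matrix.toEuclideanLin (tylerRoot n z) v‖ := by
  have hu : IsUnit ((tylerRoot n z)ᵀ * tylerRoot n z).det := by
    have := (isUpperPos_sampleRoot fun s : Fin n => z (s + 1)).det_pos.ne'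
    rw [← tylerRoot_eq] at this
    rw [Matrix.det_mul, Matrix.det_transpose]
    exact (mul_ne_zero this this).isUnit
  rw [scatterNorm, tylerScatter, Matrix.nonsing_inv_nonsing_inv _ hu,
    dotProduct_transpose_mul_self]

theorem pmRank_succ {k n : ℕ} (z : ℕ → EuclideanSpace ℝ (Fin k)) (s : Fin n) :
    pmRank n z (s + 1) = normRank (tylerRoot n z) (fun t : Fin n => z (t + 1)) s := by
  rw [pmRank, normRank, Finset.card_filter, Finset.card_filter]
  simp only [scatterNorm_tylerScatter]
  exact sum_Icc_one_eq n _

theorem rankCrossCov_apply {k : ℕ} (K₁ K₂ : ℝ → ℝ) (i n : ℕ) (z : ℕ → EuclideanSpace ℝ (Fin k))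
    (a b : Fin k) :
    rankCrossCov K₁ K₂ i n z a b = ((n : ℝ) - i)⁻¹ * ∑ p ∈ lagPairs i n,
      rankStat K₁ (transposeRow a (tylerRoot n z)) (tylerRoot n z) (fun s : Fin n => z (s + 1)) p.1
      * rankStat K₂ (inverseRow b (tylerRoot n z)) (tylerRoot n z)
        (fun s : Fin n => z (s + 1)) p.2 := by
  rw [rankCrossCov, conj_lagSum_apply (tylerRoot n z) _ i n
    (fun t u => K₁ ((pmRank n z t : ℝ) / (n + 1)) * K₂ ((pmRank n z u : ℝ) / (n + 1)))
    (tylerResidual n z) (tylerResidual n z)]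
  congr 1
  refine Finset.sum_congr rfl fun p _ => ?_
  rw [pmRank_succ, pmRank_succ, tylerResidual, tylerResidual, rankStat, rankStat]
  ring

theorem exactCrossCov_apply {k : ℕ} (K₁ K₂ : ℝ → ℝ) (Sig : Matrix (Fin k) (Fin k) ℝ) (f : ℝ → ℝ)
    (i n : ℕ) (z : ℕ → EuclideanSpace ℝ (Fin k)) (a b : Fin k) :
    exactCrossCov K₁ K₂ Sig f i n z a b = ((n : ℝ) - i)⁻¹ * ∑ p ∈ lagPairs i n,
      exactStat K₁ (transposeRow a (invSqrt Sig)) Sig f (z (p.1 + 1))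
      * exactStat K₂ (inverseRow b (invSqrt Sig)) Sig f (z (p.2 + 1)) := by
  rw [exactCrossCov, conj_lagSum_apply (invSqrt Sig) _ i n
    (fun t u => K₁ (radialCdf k f (scatterNorm Sig (z t)))
      * K₂ (radialCdf k f (scatterNorm Sig (z u))))
    (fun t => direction (invSqrt Sig) (z t)) (fun t => direction (invSqrt Sig) (z t))]
  congr 1
  refine Finset.sum_congr rfl fun p _ => ?_
  rw [exactStat, exactStat]
  ring

/-! ### Rescaling the root -/

theorem normRank_smul {k n : ℕ} {c : ℝ} (hc : 0 < c) (C : Matrix (Fin k) (Fin k) ℝ)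
    (y : Fin n → EuclideanSpace ℝ (Fin k)) (s : Fin n) :
    normRank (c • C) y s = normRank C y s := by
  simp only [normRank, map_smul, LinearMap.smul_apply, norm_smul, Real.norm_of_nonneg hc.le,
    mul_le_mul_iff_right₀ hc]

/-- The factor `c` from `Cᵀ` cancels against `c⁻¹` from the inverse, while ranks and directions
ignore scale. The normalisation of Tyler's root is therefore immaterial. -/
theorem rankStat_mul_rankStat_smul {k n : ℕ} {c : ℝ} (hc : 0 < c) {C : Matrix (Fin k) (Fin k) ℝ}
    (hC : C.det ≠ 0) (K₁ K₂ : ℝ → ℝ) (y : Fin n → EuclideanSpace ℝ (Fin k)) (s u : Fin n)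
    (a b : Fin k) :
    rankStat K₁ (transposeRow a (c • C)) (c • C) y s * rankStat K₂ (inverseRow b (c • C)) (c • C) y u
      = rankStat K₁ (transposeRow a C) C y s * rankStat K₂ (inverseRow b C) C y u := by
  have h1 : transposeRow a (c • C) = c • transposeRow a C := rfl
  have h2 : inverseRow b (c • C) = c⁻¹ • inverseRow b C := by
    have : (c • C)⁻¹ = c⁻¹ • C⁻¹ := by
      refine Matrix.inv_eq_right_inv ?_
      rw [Matrix.smul_mul, Matrix.mul_smul, smul_smul, mul_inv_cancel₀ hc.ne', one_smul,
        Matrix.mul_nonsing_inv _ hC.isUnit]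
    funext d
    simp only [inverseRow, this, Matrix.smul_apply, Pi.smul_apply]
  simp only [rankStat, normRank_smul hc, direction_smul_left C hc, h1, h2, smul_dotProduct,
    smul_eq_mul]
  have := hc.ne'
  field_simp

/-! ### Scores restricted to the unit interval -/

/-- Outside `]0, 1[` a score is arbitrary and possibly not measurable. Cutting it off gives a
measurable function with the same values at normalised ranks and at transformed radii of nonzero
observations. -/
theorem IsScore.indicator {K : ℝ → ℝ} (hK : IsScore K) :
    IsScore ((Ioo (0 : ℝ) 1).indicator K) where
  continuousOn := hK.continuousOn.congr fun _ hx => Set.indicator_of_mem hx K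
  exists_sub := by
    obtain ⟨g, h, h1, h2, h3, h4, h5⟩ := hK.exists_sub
    exact ⟨g, h, h1, h2, h3, h4, fun u hu => by rw [Set.indicator_of_mem hu, h5 u hu]⟩

theorem rankStat_indicator {k n : ℕ} (K : ℝ → ℝ) (l : Fin k → ℝ) (C : Matrix (Fin k) (Fin k) ℝ)
    (y : Fin n → EuclideanSpace ℝ (Fin k)) (s : Fin n) :
    rankStat ((Ioo (0 : ℝ) 1).indicator K) l C y s = rankStat K l C y s := by
  rw [rankStat, Set.indicator_of_mem (normRank_div_mem C y s), rankStat]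

theorem exactStat_indicator {k : ℕ} {Sig : Matrix (Fin k) (Fin k) ℝ} (hSig : Sig.PosDef)
    {f : ℝ → ℝ} (hf : IsRadialDensity k f) (K : ℝ → ℝ) (l : Fin k → ℝ)
    {z : EuclideanSpace ℝ (Fin k)} (hz : z ≠ 0) :
    exactStat ((Ioo (0 : ℝ) 1).indicator K) l Sig f z = exactStat K l Sig f z := by
  have : 0 < scatterNorm Sig z := by
    rw [scatterNorm_eq hSig]
    exact norm_pos_iff.2 (toEuclideanLin_ne_zero (invSqrt_spec hSig).1.det_pos.ne' hz)
  rw [exactStat, Set.indicator_of_mem (hf.radialCdf_mem this), exactStat]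

/-- The rank-based minus the exact cross-covariance, as a function of the sample. -/
def crossCovDiff {k n : ℕ} (K₁ K₂ : ℝ → ℝ) (Sig : Matrix (Fin k) (Fin k) ℝ) (f : ℝ → ℝ) (i : ℕ)
    (a b : Fin k) (C : Matrix (Fin k) (Fin k) ℝ) (y : Fin n → EuclideanSpace ℝ (Fin k)) : ℝ :=
  ((n : ℝ) - i)⁻¹ * ∑ p ∈ lagPairs i n,
    (rankStat K₁ (transposeRow a C) C y p.1 * rankStat K₂ (inverseRow b C) C y p.2
      - exactStat K₁ (transposeRow a (invSqrt Sig)) Sig f (y p.1)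
        * exactStat K₂ (inverseRow b (invSqrt Sig)) Sig f (y p.2))

theorem crossCov_sub_apply {k : ℕ} (K₁ K₂ : ℝ → ℝ) (Sig : Matrix (Fin k) (Fin k) ℝ) (f : ℝ → ℝ)
    (i n : ℕ) (z : ℕ → EuclideanSpace ℝ (Fin k)) (a b : Fin k) :
    (rankCrossCov K₁ K₂ i n z - exactCrossCov K₁ K₂ Sig f i n z) a b
      = crossCovDiff K₁ K₂ Sig f i a b (sampleRoot fun s : Fin n => z (s + 1))
        fun s : Fin n => z (s + 1) := by
  rw [Matrix.sub_apply, rankCrossCov_apply, exactCrossCov_apply, ← mul_sub,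
    ← Finset.sum_sub_distrib, tylerRoot_eq]
  rfl

/-- On the good event the near root `R y` is a positive multiple of Tyler's root, so both give the
same difference. The complement has vanishing probability. -/
theorem tendsto_measure_crossCovDiff {k : ℕ} {Sig : Matrix (Fin k) (Fin k) ℝ} {f : ℝ → ℝ}
    (hk : 1 ≤ k) (hSig : Sig.PosDef)
    (hf : IsRadialDensity k f) [IsProbabilityMeasure (ellipticLaw Sig f)] {i : ℕ} (hi : 1 ≤ i)
    {K₁ K₂ : ℝ → ℝ} (hK₁ : IsScore K₁) (hK₂ : IsScore K₂) (a b : Fin k) {δ : ℝ} (hδ : 0 < δ) :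
    Tendsto (fun n : ℕ => (Measure.pi fun _ : Fin n => ellipticLaw Sig f)
      {y | δ * (n : ℝ) ^ (-(1 / 2) : ℝ) < |crossCovDiff K₁ K₂ Sig f i a b (sampleRoot y) y|})
      atTop (𝓝 0) := by
  rw [ENNReal.tendsto_nhds_zero]
  intro t ht
  rcases eq_or_ne t ⊤ with rfl | htop
  · exact Eventually.of_forall fun _ => le_top
  have htol : 0 < t.toReal / 2 := half_pos (ENNReal.toReal_pos ht.ne' htop)
  obtain ⟨ρ, hρ, N, hN⟩ := exists_measure_lagSum_gt_le hk hSig hf hi hK₁.indicator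
    hK₁.measurable_indicator hK₂.indicator hK₂.measurable_indicator a b hδ htol
  obtain ⟨δ', hδ', hroot⟩ := exists_isNearRoot hk hSig hf hρ
  have hg := (tendsto_measure_compl_goodSet (Sig := Sig) (f := f) hk hδ').eventually
    (gt_mem_nhds (ENNReal.ofReal_pos.2 htol))
  filter_upwards [hg, eventually_ge_atTop N, eventually_gt_atTop 0] with n hn hnN hn0
  obtain ⟨R, hR, hRy⟩ := hroot n hn0
  have hsum : t = ENNReal.ofReal (t.toReal / 2) + ENNReal.ofReal (t.toReal / 2) := by
    rw [← ENNReal.ofReal_add htol.le htol.le, add_halves, ENNReal.ofReal_toReal htop]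
  rw [hsum]
  refine (measure_mono (fun y hy => ?_)).trans ((measure_union_le _ _).trans
    (add_le_add (hN n hnN R hR) hn.le))
  by_cases hyG : y ∈ goodSet Sig f δ' n
  · refine Or.inl ?_
    obtain ⟨c, hc, hcR⟩ := hRy y hyG
    have hdet := (isUpperPos_sampleRoot y).det_pos.ne'
    rw [mem_ofPred_eq] at hy ⊢
    simp only [rankStat_indicator, exactStat_indicator hSig hf _ _ (hyG.1 _), hcR,
      rankStat_mul_rankStat_smul hc hdet]
    exact hy
  · exact Or.inr hyG

/-! ### The residuals computed from the true initial values are the innovations -/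

section

variable {k : ℕ}

/-- `maCoeff`, extended by zero beyond `q`. -/
def maSeq (q : ℕ) (B : ℕ → Matrix (Fin k) (Fin k) ℝ) (j : ℕ) : Matrix (Fin k) (Fin k) ℝ :=
  if j ≤ q then maCoeff B j else 0

/-- The recursion for the Green's matrices is the identity `B(L) H(L) = 1` of formal power series
with matrix coefficients. -/
theorem maSeq_mul_green (q : ℕ) (B : ℕ → Matrix (Fin k) (Fin k) ℝ) :
    PowerSeries.mk (maSeq q B) * PowerSeries.mk (green q B) = 1 := by
  ext1 u
  rw [PowerSeries.coeff_mul, PowerSeries.coeff_one, Finset.Nat.sum_antidiagonal_eq_sum_range_succ_mk]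
  simp only [PowerSeries.coeff_mk]
  rcases u with - | u
  · simp [maSeq, maCoeff, green]
  · have h0 : maSeq q B 0 = 1 := by simp [maSeq, maCoeff]
    rw [Finset.sum_range_succ', h0, one_mul, Nat.sub_zero, if_neg u.succ_ne_zero, green,
      Fin.sum_univ_eq_sum_range (fun j => B (j + 1) * green q B (u - j)), add_neg_eq_zero]
    symm
    rw [← Finset.sum_subset (Finset.range_subset_range.2 (min_le_right q (u + 1)))]
    · refine Finset.sum_congr rfl fun j hj => ?_
      have := Finset.mem_range.1 hj
      rw [maSeq, if_pos (by omega), maCoeff, if_neg j.succ_ne_zero, Nat.add_sub_add_right]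
    · intro j hj hj'
      rw [Finset.mem_range] at hj hj'
      rw [maSeq, if_neg (by omega), zero_mul]

/-- The residuals apply `H` on the left of `B`. Matrices do not commute, but `B(L)` has constant
term `1` and hence a left inverse, which must equal the right inverse. -/
theorem green_mul_maSeq (q : ℕ) (B : ℕ → Matrix (Fin k) (Fin k) ℝ) :
    PowerSeries.mk (green q B) * PowerSeries.mk (maSeq q B) = 1 := by
  have h := PowerSeries.invOfUnit_mul (PowerSeries.mk (maSeq q B)) 1 (by simp [maSeq, maCoeff])
  have := left_inv_eq_right_inv h (maSeq_mul_green q B)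
  rwa [this] at h

theorem sum_green_mul_maSeq (q : ℕ) (B : ℕ → Matrix (Fin k) (Fin k) ℝ) (m : ℕ) :
    ∑ i ∈ Finset.range (m + 1), green q B i * maSeq q B (m - i) = if m = 0 then 1 else 0 := by
  have := congrArg (PowerSeries.coeff m) (green_mul_maSeq q B)
  rw [PowerSeries.coeff_mul, PowerSeries.coeff_one,
    Finset.Nat.sum_antidiagonal_eq_sum_range_succ_mk] at this
  simpa only [PowerSeries.coeff_mk] using this

/-- Substituting the model equation turns the residual into the triangular sum of `H_i B_j
e_{t-i-j}` over `i + j < t + q`. Grouped by `m = i + j`, the coefficient of `e_{t-m}` is that of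
`L^m` in `H(L) B(L) = 1`, so only `m = 0` survives. -/
theorem residual_eq {p q n : ℕ} {A B : ℕ → Matrix (Fin k) (Fin k) ℝ}
    {x e : ℤ → EuclideanSpace ℝ (Fin k)}
    (h : ∀ t : ℤ, 1 ≤ t → t ≤ n →
      ∑ j ∈ Finset.range (p + 1), Matrix.toEuclideanLin (arCoeff A j) (x (t - j))
        = ∑ j ∈ Finset.range (q + 1), Matrix.toEuclideanLin (maCoeff B j) (e (t - j)))
    {t : ℕ} (ht : 1 ≤ t) (htn : t ≤ n) : residual p q A B x e t = e t := by
  set F : ℕ → ℕ → EuclideanSpace ℝ (Fin k) := fun i j =>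
    Matrix.toEuclideanLin (green q B i * maSeq q B j) (e ((t : ℤ) - i - j)) with hF
  have h1 : ∀ i ∈ Finset.range t, ∑ j ∈ Finset.range (p + 1),
      Matrix.toEuclideanLin (green q B i * arCoeff A j) (x ((t : ℤ) - i - j))
      = ∑ j ∈ Finset.range (t + q - i), F i j := by
    intro i hi
    have hi := Finset.mem_range.1 hi
    have h2 := h ((t : ℤ) - i) (by omega) (by omega)
    rw [← Finset.sum_subset (Finset.range_subset_range.2 (show q + 1 ≤ t + q - i by omega))]
    · simp only [hF, toEuclideanLin_mul_apply]
      rw [← map_sum, h2, map_sum]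
      refine Finset.sum_congr rfl fun j hj => ?_
      rw [maSeq, if_pos (by have := Finset.mem_range.1 hj; omega)]
    · intro j _ hj
      rw [Finset.mem_range] at hj
      simp only [hF]
      rw [maSeq, if_neg (by omega), mul_zero, map_zero, LinearMap.zero_apply]
  -- The initial-value term consists exactly of the missing rows `t, …, t + q - 1` of the triangle,
  -- listed in reverse order.
  have h2 : ∑ a ∈ Finset.range q, ∑ b ∈ Finset.range (a + 1),
      Matrix.toEuclideanLin (green q B (t + q - 1 - a) * maCoeff B (a - b))
        (e (-(q : ℤ) + 1 + b)) = ∑ i ∈ Finset.range q, ∑ j ∈ Finset.range (t + q - (t + i)),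
          F (t + i) j := by
    rw [← Finset.sum_range_reflect]
    refine Finset.sum_congr rfl fun i hi => ?_
    have hi := Finset.mem_range.1 hi
    rw [← Finset.sum_range_reflect, show t + q - (t + i) = q - 1 - i + 1 by omega]
    refine Finset.sum_congr rfl fun j hj => ?_
    have hj := Finset.mem_range.1 hj
    simp only [hF]
    rw [show t + q - 1 - (q - 1 - i) = t + i by omega,
      show q - 1 - i - (q - 1 - i + 1 - 1 - j) = j by omega, maSeq, if_pos (by omega),
      show -(q : ℤ) + 1 + ((q - 1 - i + 1 - 1 - j : ℕ) : ℤ) = (t : ℤ) - ((t + i : ℕ) : ℤ) - j by omega]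
  rw [residual, Finset.sum_congr rfl h1, h2,
    ← Finset.sum_range_add (fun i => ∑ j ∈ Finset.range (t + q - i), F i j) t q,
    ← Finset.sum_range_diag_flip]
  have h3 : ∀ m ∈ Finset.range (t + q), ∑ i ∈ Finset.range (m + 1), F i (m - i)
      = if m = 0 then e t else 0 := by
    intro m _
    have h4 : ∀ i ∈ Finset.range (m + 1), F i (m - i)
        = Matrix.toEuclideanLin (green q B i * maSeq q B (m - i)) (e ((t : ℤ) - m)) := by
      intro i hi
      have hi := Finset.mem_range.1 hi
      simp only [hF]
      rw [show (t : ℤ) - i - ((m - i : ℕ) : ℤ) = (t : ℤ) - m by omega]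
    rw [Finset.sum_congr rfl h4, ← LinearMap.sum_apply, ← map_sum, sum_green_mul_maSeq]
    split_ifs with hm
    · rw [hm, toEuclideanLin_one_apply, Nat.cast_zero, sub_zero]
    · rw [map_zero, LinearMap.zero_apply]
  rw [Finset.sum_congr rfl h3, Finset.sum_ite_eq' (Finset.range (t + q)) 0 fun _ => e t,
    if_pos (Finset.mem_range.2 (by omega))]

end

/-! ### Transfer to the observed series -/

/-- With a single observation the product law is the law of a random variable, so the elliptic law
has mass one without computing the normalising constant. -/
theorem VARMAHypothesis.isProbabilityMeasure_ellipticLaw {k p q : ℕ}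
    {A B : ℕ → Matrix (Fin k) (Fin k) ℝ} {Sig : Matrix (Fin k) (Fin k) ℝ} {f : ℝ → ℝ}
    {Ω : Type*} [MeasurableSpace Ω] {P : Measure Ω} [IsProbabilityMeasure P]
    {X ε : ℤ → Ω → EuclideanSpace ℝ (Fin k)} (h : VARMAHypothesis p q A B Sig f 1 P X ε) :
    IsProbabilityMeasure (ellipticLaw Sig f) := by
  have : SigmaFinite (ellipticLaw Sig f) := SigmaFinite.withDensity_ofReal _
  have h1 := (h.noise.isProbabilityMeasure_iff.1 inferInstance).measure_univ
  rw [Measure.pi_univ] at h1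
  exact ⟨by simpa using h1⟩

theorem exists_lt_abs_crossCovDiff {k n : ℕ} {Sig : Matrix (Fin k) (Fin k) ℝ} {f K₁ K₂ : ℝ → ℝ}
    {i : ℕ} {c : ℝ} (hc : 0 ≤ c) {z : ℕ → EuclideanSpace ℝ (Fin k)}
    {y : Fin n → EuclideanSpace ℝ (Fin k)} (hzy : ∀ s : Fin n, z (s + 1) = y s)
    (h : c < ‖Matrix.vec (rankCrossCov K₁ K₂ i n z - exactCrossCov K₁ K₂ Sig f i n z)‖) :
    ∃ ab ∈ (Finset.univ : Finset (Fin k × Fin k)),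
      c < |crossCovDiff K₁ K₂ Sig f i ab.2 ab.1 (sampleRoot y) y| := by
  obtain rfl : (fun s : Fin n => z (s + 1)) = y := funext hzy
  by_contra! hnot
  refine absurd ((pi_norm_le_iff_of_nonneg hc).2 fun ab => ?_) (not_le.2 h)
  -- `vec` stacks columns, so its index is a pair (column, row); hence `ab.2` precedes `ab.1`.
  rw [Matrix.vec, crossCov_sub_apply, Real.norm_eq_abs]
  exact hnot ab (Finset.mem_univ _)

theorem measure_norm_vec_gt_le {k n p q : ℕ}
    {A B : ℕ → Matrix (Fin k) (Fin k) ℝ} {Sig : Matrix (Fin k) (Fin k) ℝ} {f : ℝ → ℝ}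
    {Ω : Type*} [MeasurableSpace Ω] {P : Measure Ω} [IsProbabilityMeasure P]
    {X ε : ℤ → Ω → EuclideanSpace ℝ (Fin k)} (h : VARMAHypothesis p q A B Sig f n P X ε)
    (K₁ K₂ : ℝ → ℝ) (i : ℕ) {c : ℝ} (hc : 0 ≤ c) :
    P {ω | c < ‖Matrix.vec (rankCrossCov K₁ K₂ i n (residual p q A B (fun t => X t ω) fun t => ε t ω)
        - exactCrossCov K₁ K₂ Sig f i n (residual p q A B (fun t => X t ω) fun t => ε t ω))‖}
      ≤ ∑ ab : Fin k × Fin k, (Measure.pi fun _ : Fin n => ellipticLaw Sig f)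
        {y | c < |crossCovDiff K₁ K₂ Sig f i ab.2 ab.1 (sampleRoot y) y|} := by
  -- Only an inequality is available for arbitrary sets: the event involves the chosen Tyler root,
  -- whose measurability is established on good samples only.
  have hle : ∀ S : Set (Fin n → EuclideanSpace ℝ (Fin k)),
      P ((fun ω (t : Fin n) => ε ((t : ℤ) + 1) ω) ⁻¹' S)
        ≤ (Measure.pi fun _ : Fin n => ellipticLaw Sig f) S := fun S => by
    rw [← h.noise.map_eq]
    exact Measure.le_map_apply h.noise.aemeasurable S
  refine le_trans (le_trans (measure_le_sum_add (D := ∅) (J := Finset.univ)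
    (B := fun ab : Fin k × Fin k => (fun ω (t : Fin n) => ε ((t : ℤ) + 1) ω) ⁻¹'
      {y | c < |crossCovDiff K₁ K₂ Sig f i ab.2 ab.1 (sampleRoot y) y|}) ?_)
    (add_le_add (Finset.sum_le_sum fun ab _ => hle _) measure_empty.le)) (add_zero _).le
  filter_upwards [h.equation] with ω hω hbad
  refine Or.inl (exists_lt_abs_crossCovDiff hc (fun s => ?_) hbad)
  have hs := residual_eq (x := fun t => X t ω) (e := fun t => ε t ω) hω
    (t := (s : ℕ) + 1) (by omega) (by omega)
  rw [hs]
  push_cast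
  rfl

end RankCrossCov

end

theorem proposition2 {k p q i : ℕ} (hk : 1 ≤ k) (hi : 1 ≤ i)
    (A B : ℕ → Matrix (Fin k) (Fin k) ℝ)
    (Sig : Matrix (Fin k) (Fin k) ℝ) (hSig : Sig.PosDef)
    (f : ℝ → ℝ) (hf : RankCrossCov.IsRadialDensity k f)
    (K₁ K₂ : ℝ → ℝ) (hK₁ : RankCrossCov.IsScore K₁) (hK₂ : RankCrossCov.IsScore K₂)
    {Ω : ℕ → Type*} [∀ n, MeasurableSpace (Ω n)]
    (P : ∀ n, Measure (Ω n)) [∀ n, IsProbabilityMeasure (P n)]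
    (X ε : ∀ n, ℤ → Ω n → EuclideanSpace ℝ (Fin k))
    (hH : ∀ n, RankCrossCov.VARMAHypothesis p q A B Sig f n (P n) (X n) (ε n)) :
    RankCrossCov.IsLittleOP P
      (fun n ω =>
        Matrix.vec
          (RankCrossCov.rankCrossCov K₁ K₂ i n
              (RankCrossCov.residual p q A B (fun t => X n t ω) (fun t => ε n t ω))
            - RankCrossCov.exactCrossCov K₁ K₂ Sig f i n
              (RankCrossCov.residual p q A B (fun t => X n t ω) (fun t => ε n t ω))))
      (fun n => (n : ℝ) ^ (-(1 / 2) : ℝ)) := by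
  have := (hH 1).isProbabilityMeasure_ellipticLaw
  intro δ hδ
  have h := tendsto_finsetSum (Finset.univ : Finset (Fin k × Fin k)) fun ab _ =>
    RankCrossCov.tendsto_measure_crossCovDiff hk hSig hf hi hK₁ hK₂ ab.2 ab.1 hδ
  rw [Finset.sum_const_zero] at h
  exact tendsto_of_tendsto_of_tendsto_of_le_of_le tendsto_const_nhds h (fun _ => zero_le)
    fun n => RankCrossCov.measure_norm_vec_gt_le (hH n) K₁ K₂ i (by positivity)
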